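/- Let $n\ge 1$, $\gamma\ge 0$, and let $|\cdot|$ be the Euclidean norm on $\mathbb R^n$. **Kernel.** Let $g:\mathbb R^n\times\mathbb R^n\to[0,+\infty]$ be symmetric and lower semicontinuous, and such that - for every $\epsilon>0$ there is $\delta>0$ such that $g(u,x)\le\epsilon|u-x|^{-n}$ whenever $|u-x|\le\delta$; - there are $p>1$ and real numbers $c_k\ge0$ with $c_k\to0$ as $k\to\infty$ such that, for every integer $k\ge 1$, $g=g_k+g^k$, where $g_k$ is real-valued and continuous with $g_k\le k$, $g^k\ge 0$, $\int g^k(u,x)^p\,dx\le c_k$ for all $u\in\mathbb R^n$, and $g_k(x,u)\to0$ as $|x|\to\infty$ for every $u\in\mathbb R^n$. **Potential.** Let $V:\mathbb R^n\to[0,+\infty)$ be continuous, $C^2$ outside a compact set, with $e^{-V}\in L^1(\mathbb R^n)$. Let $\mu_0$ be the probability measure proportional to $e^{-V(x)}dx$. **Equilibrium measure.** Assume that the free energy $$\mathscr F_\gamma(\mu)=\frac\gamma2\iint g(x,z)\,\mu(dx)\mu(dz)+\mathrm H(\mu\,|\,\mu_0)$$ ($\mathrm H$ being the relative entropy) has a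 unique minimizer $\mu_\gamma$ among the probability measures on $\mathbb R^n$. Put $U(x)=\int g(x,z)\,\mu_\gamma(dz)$ and $\mathrm L_\gamma=\int e^{-\gamma U(x)-V(x)}dx$, the normalization constant in $\mu_\gamma(dx)=\mathrm L_\gamma^{-1}e^{-\gamma U(x)-V(x)}dx$. **Gibbs measure.** Let $\beta=\beta_N>0$ with $\beta_N N\to\gamma$ as $N\to\infty$, and let $\mathbb P_N$ be the probability measure on $(\mathbb R^n)^N$ with density proportional to $$\exp\Big(-\beta_N\sum_{1\le i<j\le N}g(x_i,x_j)-\sum_{j=1}^N V(x_j)\Big).$$ **Zooming.** Let $E_N\in\mathbb R^n$ with $|E_N|\to\infty$ and, for all large $N$, $\nabla V(E_N)=\alpha_N\upsilon_N$ with $\alpha_N>0$ and $|\upsilon_N|=1$. Suppose that as $N\to\infty$ $$\frac{N e^{-V(E_N)}}{\mathrm L_\gamma\,\alpha_N^n}\to1,\qquad \upsilon_N\to\upsilon,\qquad \alpha_N|E_N|\to+\infty .$$ Let $\psi:\mathbb R^n\to\mathbb R^n$ be a $C^1$ diffeomorphism with Jacobian $|\det D\psi|=1$ everywhere, let $\varphi_N(x)=E_N+\alpha_N^{-1}\psi(x)$,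 and suppose that for every compact set $\mathscr K\subset\mathbb R^n$ $$\alpha_N^{-2}\,\sup_{x\in\mathscr K}\big\|\nabla^2V(\varphi_N(x))\big\|\to0\qquad(N\to\infty).$$ **Conclusion.** Under $\mathbb P_N$, the point process $\Xi_N=\sum_{j=1}^N\delta_{\varphi_N^{-1}(x_j)}$ converges in distribution as $N\to\infty$ to a Poisson point process $\Xi$ on $\mathbb R^n$ with intensity $\theta(x)=e^{-\upsilon\cdot\psi(x)}$ with respect to Lebesgue measure. That is, $\mathbb E_N[e^{-\Xi_N(f)}]\to\mathbb E[e^{-\Xi(f)}]$ for every continuous compactly supported $f:\mathbb R^n\to[0,+\infty)$, where $\Xi$ is a point process with $\mathbb E[e^{-\Xi(f)}]=\exp\big(\int(e^{-f(x)}-1)\,\theta(x)\,dx\big)$ for all Borel $f:\mathbb R^n\to[0,+\infty)$. -/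

import Mathlib

open MeasureTheory Filter Topology
open scoped ENNReal NNReal Manifold RealInnerProductSpace

noncomputable section

namespace MeanFieldGas

/-- `e^{-a}` for `a ∈ [0,+∞]`, with `e^{-∞} = 0`. -/
def expNeg (a : ℝ≥0∞) : ℝ≥0∞ := EReal.exp (-(a : EReal))

/-! ### Interaction kernels -/

/-- Symmetric, lower semicontinuous kernels `g : ℝⁿ × ℝⁿ → [0,+∞]` which are `o(dist⁻ⁿ)` near the
diagonal and which split, for every `k ≥ 1`, as `g = gₖ + gᵏ`, where `gₖ ≤ k` is continuous and
tends to `0` at infinity in its first variable, while `gᵏ ≥ 0` is small in `Lᵖ`, for some fixed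
`p > 1`. -/
structure IsDecayingKernel {n : ℕ}
    (g : EuclideanSpace ℝ (Fin n) → EuclideanSpace ℝ (Fin n) → ℝ≥0∞) : Prop where
  symm : ∀ u x, g u x = g x u
  lsc : LowerSemicontinuous
    (fun q : EuclideanSpace ℝ (Fin n) × EuclideanSpace ℝ (Fin n) => g q.1 q.2)
  near_diag : ∀ ε : ℝ, 0 < ε → ∃ δ : ℝ, 0 < δ ∧ ∀ u x, dist u x ≤ δ →
    g u x ≤ ENNReal.ofReal ε * (edist u x ^ n)⁻¹
  decomp : ∃ (gLow : ℕ → EuclideanSpace ℝ (Fin n) → EuclideanSpace ℝ (Fin n) → ℝ)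
      (gUp : ℕ → EuclideanSpace ℝ (Fin n) → EuclideanSpace ℝ (Fin n) → ℝ≥0∞)
      (p : ℝ) (c : ℕ → ℝ≥0),
    1 < p ∧ Tendsto c atTop (𝓝 0) ∧ ∀ k : ℕ, 1 ≤ k →
      (∀ u x, (g u x : EReal) = (gLow k u x : EReal) + (gUp k u x : EReal)) ∧
      Continuous (fun q : EuclideanSpace ℝ (Fin n) × EuclideanSpace ℝ (Fin n) =>
        gLow k q.1 q.2) ∧
      (∀ u x, gLow k u x ≤ k) ∧
      (∀ u, ∫⁻ x, gUp k u x ^ p ≤ c k) ∧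
      (∀ u, Tendsto (fun x => gLow k x u) (cocompact (EuclideanSpace ℝ (Fin n))) (𝓝 0))

/-! ### The Gibbs measure -/

/-- The energy `H_N(x) = β ∑_{i<j} g(x_i, x_j) + ∑_j V(x_j)`; used for `β ≥ 0` and `V ≥ 0`. -/
def hamiltonian {n : ℕ} (g : EuclideanSpace ℝ (Fin n) → EuclideanSpace ℝ (Fin n) → ℝ≥0∞)
    (V : EuclideanSpace ℝ (Fin n) → ℝ) (β : ℝ) (N : ℕ)
    (x : Fin N → EuclideanSpace ℝ (Fin n)) : ℝ≥0∞ :=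
  ENNReal.ofReal β * (∑ i : Fin N, ∑ j ∈ Finset.Ioi i, g (x i) (x j)) +
    ∑ j : Fin N, ENNReal.ofReal (V (x j))

/-- The partition function `Z_N`. -/
def partitionFunction {n : ℕ}
    (g : EuclideanSpace ℝ (Fin n) → EuclideanSpace ℝ (Fin n) → ℝ≥0∞)
    (V : EuclideanSpace ℝ (Fin n) → ℝ) (β : ℝ) (N : ℕ) : ℝ≥0∞ :=
  ∫⁻ x : Fin N → EuclideanSpace ℝ (Fin n), expNeg (hamiltonian g V β N x)

/-- The Gibbs measure `P_N(dx) = Z_N⁻¹ e^{-H_N(x)} dx` on `(ℝⁿ)^N`. -/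
def gibbs {n : ℕ} (g : EuclideanSpace ℝ (Fin n) → EuclideanSpace ℝ (Fin n) → ℝ≥0∞)
    (V : EuclideanSpace ℝ (Fin n) → ℝ) (β : ℝ) (N : ℕ) :
    Measure (Fin N → EuclideanSpace ℝ (Fin n)) :=
  (partitionFunction g V β N)⁻¹ • volume.withDensity (fun x => expNeg (hamiltonian g V β N x))

/-! ### Free energy and equilibrium measure -/

/-- The potential `U^μ(x) = ∫ g(x,z) μ(dz)`. -/
def potential {n : ℕ} (g : EuclideanSpace ℝ (Fin n) → EuclideanSpace ℝ (Fin n) → ℝ≥0∞)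
    (μ : Measure (EuclideanSpace ℝ (Fin n))) (x : EuclideanSpace ℝ (Fin n)) : ℝ≥0∞ :=
  ∫⁻ z, g x z ∂μ

/-- The free energy `(γ/2) ∬ g dμ dμ + H(μ | μ₀)`, where `μ₀` is the probability measure
proportional to `e^{-V(x)} dx` and `H` is the relative entropy. -/
def freeEnergy {n : ℕ} (γ : ℝ)
    (g : EuclideanSpace ℝ (Fin n) → EuclideanSpace ℝ (Fin n) → ℝ≥0∞)
    (V : EuclideanSpace ℝ (Fin n) → ℝ) (μ : Measure (EuclideanSpace ℝ (Fin n))) : ℝ≥0∞ :=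
  ENNReal.ofReal (γ / 2) * ∫⁻ x, potential g μ x ∂μ +
    InformationTheory.klDiv μ (volume.tilted (fun x => -V x))

/-- `μ` is the unique minimizer of the free energy among all probability measures. -/
def IsUniqueMinimizer {n : ℕ} (γ : ℝ)
    (g : EuclideanSpace ℝ (Fin n) → EuclideanSpace ℝ (Fin n) → ℝ≥0∞)
    (V : EuclideanSpace ℝ (Fin n) → ℝ) (μ : ProbabilityMeasure (EuclideanSpace ℝ (Fin n))) :
    Prop :=
  (∀ ν : ProbabilityMeasure (EuclideanSpace ℝ (Fin n)),
    freeEnergy γ g V (μ : Measure _) ≤ freeEnergy γ g V (ν : Measure _)) ∧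
  ∀ μ' : ProbabilityMeasure (EuclideanSpace ℝ (Fin n)),
    (∀ ν : ProbabilityMeasure (EuclideanSpace ℝ (Fin n)),
      freeEnergy γ g V (μ' : Measure _) ≤ freeEnergy γ g V (ν : Measure _)) → μ' = μ

/-- The constant `L = ∫ e^{-γ U^μ(x) - V(x)} dx`, that is, the normalization in the equation
`μ(dx) = L⁻¹ e^{-γ U^μ(x) - V(x)} dx` of the equilibrium measure `μ`. -/
def normConst {n : ℕ} (γ : ℝ)
    (g : EuclideanSpace ℝ (Fin n) → EuclideanSpace ℝ (Fin n) → ℝ≥0∞)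
    (V : EuclideanSpace ℝ (Fin n) → ℝ) (μ : Measure (EuclideanSpace ℝ (Fin n))) : ℝ :=
  (∫⁻ x, expNeg (ENNReal.ofReal γ * potential g μ x + ENNReal.ofReal (V x))).toReal

/-! ### Point processes -/

/-- A point process: a random locally finite sum of point masses (counted with multiplicity). -/
structure IsPointProcess {n : ℕ} {Ω : Type*} [MeasurableSpace Ω] (P : Measure Ω)
    (Ξ : Ω → Measure (EuclideanSpace ℝ (Fin n))) : Prop where
  isProbabilityMeasure : IsProbabilityMeasure P
  measurable : Measurable Ξ
  point : ∀ᵐ ω ∂P, ∃ (s : Set ℕ) (a : ℕ → EuclideanSpace ℝ (Fin n)),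
    Ξ ω = Measure.sum (fun i : s => Measure.dirac (a i))
  locallyFinite : ∀ᵐ ω ∂P, ∀ K : Set (EuclideanSpace ℝ (Fin n)), IsCompact K → Ξ ω K < ∞

/-- The Laplace functional `E[e^{-Ξ(f)}]`. -/
def laplace {n : ℕ} {Ω : Type*} [MeasurableSpace Ω] (P : Measure Ω)
    (Ξ : Ω → Measure (EuclideanSpace ℝ (Fin n))) (f : EuclideanSpace ℝ (Fin n) → ℝ≥0) : ℝ≥0∞ :=
  ∫⁻ ω, expNeg (∫⁻ x, (f x : ℝ≥0∞) ∂(Ξ ω)) ∂P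

/-- `Ξ` is a Poisson point process with intensity measure `θ`: its Laplace functional is
`exp (∫ (e^{-f} - 1) dθ) = exp (- ∫ (1 - e^{-f}) dθ)`. -/
structure IsPoissonProcess {n : ℕ} {Ω : Type*} [MeasurableSpace Ω] (P : Measure Ω)
    (Ξ : Ω → Measure (EuclideanSpace ℝ (Fin n))) (θ : Measure (EuclideanSpace ℝ (Fin n))) :
    Prop extends IsPointProcess P Ξ where
  laplace_eq : ∀ f : EuclideanSpace ℝ (Fin n) → ℝ≥0, Measurable f →
    laplace P Ξ f = expNeg (∫⁻ x, (1 - expNeg (f x : ℝ≥0∞)) ∂θ)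

/-- Convergence in distribution of point processes: convergence of the Laplace functionals on
nonnegative continuous functions with compact support. -/
def ConvergesInDistribution {n : ℕ} {Ω : ℕ → Type*} [∀ N, MeasurableSpace (Ω N)]
    (P : ∀ N, Measure (Ω N)) (Ξ : ∀ N, Ω N → Measure (EuclideanSpace ℝ (Fin n)))
    {Ω' : Type*} [MeasurableSpace Ω'] (P' : Measure Ω')
    (Ξ' : Ω' → Measure (EuclideanSpace ℝ (Fin n))) : Prop :=
  ∀ f : EuclideanSpace ℝ (Fin n) → ℝ≥0, Continuous f → HasCompactSupport f →
    Tendsto (fun N => laplace (P N) (Ξ N) f) atTop (𝓝 (laplace P' Ξ' f))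

/-! ### Zooming around a point -/

/-- The map `φ(x) = e + a⁻¹ ψ(x)`. -/
def zoom {n : ℕ} (e : EuclideanSpace ℝ (Fin n)) (a : ℝ)
    (ψ : EuclideanSpace ℝ (Fin n) → EuclideanSpace ℝ (Fin n)) (x : EuclideanSpace ℝ (Fin n)) :
    EuclideanSpace ℝ (Fin n) :=
  e + a⁻¹ • ψ x

/-- The inverse `φ⁻¹(y) = ψ⁻¹(a (y - e))` of `zoom e a ψ`, in terms of `ψinv = ψ⁻¹`. -/
def zoomInv {n : ℕ} (e : EuclideanSpace ℝ (Fin n)) (a : ℝ)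
    (ψinv : EuclideanSpace ℝ (Fin n) → EuclideanSpace ℝ (Fin n))
    (y : EuclideanSpace ℝ (Fin n)) : EuclideanSpace ℝ (Fin n) :=
  ψinv (a • (y - e))

theorem zoomInv_zoom {n : ℕ} (e : EuclideanSpace ℝ (Fin n)) {a : ℝ} (ha : 0 < a)
    (ψ : EuclideanSpace ℝ (Fin n) ≃ EuclideanSpace ℝ (Fin n)) (x : EuclideanSpace ℝ (Fin n)) :
    zoomInv e a ψ.symm (zoom e a ψ x) = x := by
  simp [zoom, zoomInv, smul_smul, ha.ne']

theorem zoom_zoomInv {n : ℕ} (e : EuclideanSpace ℝ (Fin n)) {a : ℝ} (ha : 0 < a)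
    (ψ : EuclideanSpace ℝ (Fin n) ≃ EuclideanSpace ℝ (Fin n)) (y : EuclideanSpace ℝ (Fin n)) :
    zoom e a ψ (zoomInv e a ψ.symm y) = y := by
  simp [zoom, zoomInv, smul_smul, ha.ne']

/-- The zoomed configuration `Ξ(x) = ∑_j δ_{φ⁻¹(x_j)}`. -/
def zoomedProcess {n : ℕ} (e : EuclideanSpace ℝ (Fin n)) (a : ℝ)
    (ψinv : EuclideanSpace ℝ (Fin n) → EuclideanSpace ℝ (Fin n)) (N : ℕ)
    (x : Fin N → EuclideanSpace ℝ (Fin n)) : Measure (EuclideanSpace ℝ (Fin n)) :=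
  ∑ j : Fin N, Measure.dirac (zoomInv e a ψinv (x j))

end MeanFieldGas

end

open MeanFieldGas

/-!
The Laplace functional of `Ξ_N` at `f` is the expectation of `∏_j (1 - h_N(x_j))`, where the
function `h_N = (1 - e^{-f}) ∘ φ_N⁻¹` lives in a ball which escapes to infinity.

*Law of large numbers.* The Gibbs variational principle bounds the partition functions from below
in terms of the minimal free energy. Bounding the energy from below through the truncations
`min g k`, and the entropy through test functions in the Donsker–Varadhan formula, one sees that
the empirical measure is close to a given `ν ≠ μ_γ` with exponentially small probability. As the
laws of the empirical measure are tight, it converges to `μ_γ`. Hence a particle inserted at `y` has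
the Boltzmann weight `e^{-β_N ∑_j g(y,x_j)} → e^{-γ U(y)}`, the ratios `Z_N / Z_{N+1}` converge, and
the weight tends to `1` uniformly for `y` in the support of `h_N`, since `g` decays at infinity.

*Poisson limit.* Let `T` be the limit of `N ∫ e^{-V} h_N`. Differentiating
`A(t) = E ∏_j (1 - t h_N(x_j))` singles out one particle, which by the above is almost independent
of the others, so that `A' ≈ -(T / L_γ) A` and `A(1) → e^{-T / L_γ}`.

*Intensity.* By Taylor's formula and the bound on the Hessian, `V(E_N + α_N⁻¹ z) - V(E_N) → υ · z`
uniformly for `z` in compact sets. Therefore `T / L_γ = ∫ e^{-υ · ψ} (1 - e^{-f})`, which is the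
exponent in the Laplace functional of the Poisson process.
-/

namespace MeanFieldGas

open InformationTheory ProbabilityTheory
open scoped BoundedContinuousFunction

/-! ### The function `a ↦ e^{-a}` on `[0,+∞]` -/

theorem expNeg_coe (a : ℝ≥0) : expNeg a = ENNReal.ofReal (Real.exp (-(a : ℝ))) :=
  EReal.exp_coe (-(a : ℝ))

theorem expNeg_ofReal {a : ℝ} (ha : 0 ≤ a) :
    expNeg (ENNReal.ofReal a) = ENNReal.ofReal (Real.exp (-a)) := by
  rw [ENNReal.ofReal, expNeg_coe, Real.coe_toNNReal a ha]

@[simp] theorem expNeg_zero : expNeg 0 = 1 := by simpa using expNeg_coe 0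

@[simp] theorem expNeg_top : expNeg ⊤ = 0 := by simp [expNeg]

theorem expNeg_antitone : Antitone expNeg := fun _ _ h =>
  EReal.exp_monotone (EReal.neg_le_neg_iff.2 (EReal.coe_ennreal_le_coe_ennreal_iff.2 h))

@[fun_prop] theorem measurable_expNeg : Measurable expNeg := expNeg_antitone.measurable

theorem expNeg_le_one (a : ℝ≥0∞) : expNeg a ≤ 1 := by
  simpa using expNeg_antitone (zero_le (a := a))

theorem expNeg_ne_top (a : ℝ≥0∞) : expNeg a ≠ ∞ :=
  ne_top_of_le_ne_top ENNReal.one_ne_top (expNeg_le_one a)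

theorem expNeg_add (a b : ℝ≥0∞) : expNeg (a + b) = expNeg a * expNeg b := by
  induction a with
  | top => simp
  | coe a =>
    induction b with
    | top => simp
    | coe b =>
      rw [← ENNReal.coe_add, expNeg_coe, expNeg_coe, expNeg_coe,
        ← ENNReal.ofReal_mul (Real.exp_nonneg _), ← Real.exp_add]
      push_cast
      ring_nf

theorem expNeg_sum {ι : Type*} (s : Finset ι) (f : ι → ℝ≥0∞) :
    expNeg (∑ i ∈ s, f i) = ∏ i ∈ s, expNeg (f i) := by
  classical
  induction s using Finset.induction_on with
  | empty => simp
  | insert a s ha ih => rw [Finset.sum_insert ha, Finset.prod_insert ha, expNeg_add, ih]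

theorem expNeg_pos {a : ℝ≥0∞} (ha : a ≠ ∞) : 0 < expNeg a := by
  lift a to ℝ≥0 using ha
  rw [expNeg_coe]
  exact ENNReal.ofReal_pos.2 (Real.exp_pos _)

theorem toReal_expNeg {a : ℝ≥0∞} (ha : a ≠ ∞) : (expNeg a).toReal = Real.exp (-a.toReal) := by
  lift a to ℝ≥0 using ha
  rw [expNeg_coe, ENNReal.toReal_ofReal (Real.exp_nonneg _), ENNReal.coe_toReal]

theorem expNeg_le_add (a b : ℝ≥0∞) : expNeg a ≤ expNeg (a + b) + b := by
  induction b with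
  | top => simp
  | coe b =>
    rw [expNeg_add]
    have h1 : (1 : ℝ≥0∞) ≤ expNeg b + b := by
      rw [expNeg_coe, ← ENNReal.ofReal_one, ← ENNReal.ofReal_coe_nnreal,
        ← ENNReal.ofReal_add (Real.exp_nonneg _) b.coe_nonneg]
      refine ENNReal.ofReal_le_ofReal ?_
      have := Real.add_one_le_exp (-(b : ℝ))
      linarith
    calc expNeg a = expNeg a * 1 := (mul_one _).symm
      _ ≤ expNeg a * (expNeg b + b) := by gcongr
      _ = expNeg a * expNeg b + expNeg a * b := mul_add _ _ _
      _ ≤ expNeg a * expNeg b + 1 * b := by gcongr; exact expNeg_le_one a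
      _ = _ := by rw [one_mul]

theorem one_sub_expNeg_le (a : ℝ≥0∞) : 1 - expNeg a ≤ a := by
  have := expNeg_le_add 0 a
  simpa [tsub_le_iff_left, add_comm] using this

theorem continuous_expNeg : Continuous expNeg :=
  EReal.expHomeomorph.continuous.comp (continuous_neg.comp continuous_coe_ennreal_ereal)

/-! ### Pair energies and the mean-field gas -/

section Gas

variable {X : Type*}

/-- The pair energy `∑_{i<j} g(x_i, x_j)` of a configuration of `N` labelled points. -/
noncomputable def pairEnergy (g : X → X → ℝ≥0∞) {N : ℕ} (x : Fin N → X) : ℝ≥0∞ :=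
  ∑ i : Fin N, ∑ j ∈ Finset.Ioi i, g (x i) (x j)

theorem two_mul_pairEnergy {g : X → X → ℝ≥0∞} (hg : ∀ u x, g u x = g x u) {N : ℕ}
    (x : Fin N → X) :
    2 * pairEnergy g x = ∑ i, ∑ j, if i = j then 0 else g (x i) (x j) := by
  have sum_lt : pairEnergy g x = ∑ i, ∑ j, if i < j then g (x i) (x j) else 0 :=
    Finset.sum_congr rfl fun i _ => by
      rw [← Finset.sum_filter, Finset.filter_lt_eq_Ioi]
  have sum_gt : pairEnergy g x = ∑ i, ∑ j, if j < i then g (x i) (x j) else 0 := by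
    rw [sum_lt, Finset.sum_comm]
    simp_rw [hg]
  calc 2 * pairEnergy g x
      = ∑ i, ∑ j, ((if i < j then g (x i) (x j) else 0)
          + if j < i then g (x i) (x j) else 0) := by
        simp_rw [Finset.sum_add_distrib]
        rw [two_mul, ← sum_lt, ← sum_gt]
    _ = ∑ i, ∑ j, if i = j then 0 else g (x i) (x j) := by
        refine Finset.sum_congr rfl fun i _ => Finset.sum_congr rfl fun j _ => ?_
        rcases lt_trichotomy i j with h | h | h
        · simp [h, h.ne, h.not_gt]
        · simp [h]
        · simp [h, h.ne', h.not_gt]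

theorem pairEnergy_insertNth {g : X → X → ℝ≥0∞} (hg : ∀ u x, g u x = g x u) {N : ℕ}
    (i : Fin (N + 1)) (y : X) (x : Fin N → X) :
    pairEnergy g (i.insertNth y x : Fin (N + 1) → X) = ∑ j, g y (x j) + pairEnergy g x := by
  suffices 2 * pairEnergy g (i.insertNth y x : Fin (N + 1) → X)
      = 2 * (∑ j, g y (x j) + pairEnergy g x) from
    (ENNReal.mul_right_inj two_ne_zero ENNReal.ofNat_ne_top).1 this
  have row (j : Fin N) : (∑ k, if i.succAbove j = k then 0 else
      g (x j) ((i.insertNth y x : Fin (N + 1) → X) k)) =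
        g y (x j) + ∑ k, if j = k then 0 else g (x j) (x k) := by
    rw [Fin.sum_univ_succAbove _ i]
    simp only [Fin.succAbove_ne, if_false, Fin.insertNth_apply_same,
      Fin.insertNth_apply_succAbove, Fin.succAbove_right_inj]
    rw [hg]
  rw [mul_add, two_mul_pairEnergy hg, two_mul_pairEnergy hg, Fin.sum_univ_succAbove _ i,
    Fin.sum_univ_succAbove _ i]
  simp only [if_true, Fin.insertNth_apply_same, Fin.insertNth_apply_succAbove, zero_add,
    Fin.ne_succAbove, if_false, row, Finset.sum_add_distrib]
  rw [two_mul, add_assoc]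

variable [MeasurableSpace X]

@[fun_prop] theorem measurable_pairEnergy {g : X → X → ℝ≥0∞}
    (hg : Measurable (Function.uncurry g)) {N : ℕ} :
    Measurable (pairEnergy g : (Fin N → X) → ℝ≥0∞) := by
  unfold pairEnergy
  exact Finset.measurable_sum _ fun i _ => Finset.measurable_sum _ fun j _ =>
    hg.comp (f := fun x : Fin N → X => (x i, x j))
      ((measurable_pi_apply i).prodMk (measurable_pi_apply j))

theorem measurable_sum_kernel {g : X → X → ℝ≥0∞} (hg : Measurable (Function.uncurry g)) {N : ℕ} :
    Measurable fun q : X × (Fin N → X) => ∑ j, g q.1 (q.2 j) :=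
  Finset.measurable_sum _ fun j _ =>
    hg.comp (measurable_fst.prodMk ((measurable_pi_apply j).comp measurable_snd))

theorem measurable_sum_kernel_left {g : X → X → ℝ≥0∞} (hg : Measurable (Function.uncurry g))
    {N : ℕ} (y : X) : Measurable fun x : Fin N → X => ∑ j, g y (x j) :=
  (measurable_sum_kernel hg).comp (measurable_const.prodMk measurable_id)

theorem measurable_sum_kernel_right {g : X → X → ℝ≥0∞} (hg : Measurable (Function.uncurry g))
    {N : ℕ} (x : Fin N → X) : Measurable fun y => ∑ j, g y (x j) :=
  (measurable_sum_kernel hg).comp (measurable_id.prodMk measurable_const)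

/-- The unnormalized Gibbs measure `e^{-b ∑_{i<j} g(x_i,x_j)} m^{⊗ N}(dx)`. -/
noncomputable def gas (m : Measure X) (g : X → X → ℝ≥0∞) (b : ℝ≥0) (N : ℕ) : Measure (Fin N → X) :=
  (Measure.pi fun _ => m).withDensity fun x => expNeg (b * pairEnergy g x)

theorem lintegral_pi_succ (m : Measure X) [SigmaFinite m] {N : ℕ} (i : Fin (N + 1))
    {F : (Fin (N + 1) → X) → ℝ≥0∞} (hF : Measurable F) :
    ∫⁻ x, F x ∂(Measure.pi fun _ => m) =
      ∫⁻ y, ∫⁻ x, F (i.insertNth y x : Fin (N + 1) → X) ∂(Measure.pi fun _ => m) ∂m := by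
  have h := (measurePreserving_piFinSuccAbove (fun _ : Fin (N + 1) => m) i).symm
  rw [← h.lintegral_comp hF]
  exact lintegral_prod _ (hF.comp h.measurable).aemeasurable

theorem measurable_insertNth {N : ℕ} (i : Fin (N + 1)) :
    Measurable fun q : X × (Fin N → X) => (i.insertNth q.1 q.2 : Fin (N + 1) → X) :=
  (MeasurableEquiv.piFinSuccAbove (fun _ : Fin (N + 1) => X) i).symm.measurable

theorem measurable_insertNth_right {N : ℕ} (i : Fin (N + 1)) (y : X) :
    Measurable fun x : (Fin N → X) => (i.insertNth y x : Fin (N + 1) → X) :=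
  (measurable_insertNth i).comp (measurable_const.prodMk measurable_id)

theorem lintegral_gas (m : Measure X) {g : X → X → ℝ≥0∞} (hg : Measurable (Function.uncurry g))
    (b : ℝ≥0) {N : ℕ} {F : (Fin N → X) → ℝ≥0∞} (hF : Measurable F) :
    ∫⁻ x, F x ∂(gas m g b N) =
      ∫⁻ x, F x * expNeg (b * pairEnergy g x) ∂(Measure.pi fun _ => m) := by
  rw [gas, lintegral_withDensity_eq_lintegral_mul _ (by fun_prop) hF]
  simp_rw [Pi.mul_apply, mul_comm]

theorem lintegral_gas_succ (m : Measure X) [SigmaFinite m] {g : X → X → ℝ≥0∞}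
    (hgm : Measurable (Function.uncurry g)) (hg : ∀ u x, g u x = g x u) (b : ℝ≥0) {N : ℕ}
    (i : Fin (N + 1)) {F : (Fin (N + 1) → X) → ℝ≥0∞} (hF : Measurable F) :
    ∫⁻ x, F x ∂(gas m g b (N + 1)) =
      ∫⁻ y, ∫⁻ x, F (i.insertNth y x : Fin (N + 1) → X) * expNeg (b * ∑ j, g y (x j))
        ∂(gas m g b N) ∂m := by
  rw [lintegral_gas m hgm b hF, lintegral_pi_succ m i (by fun_prop)]
  refine lintegral_congr fun y => ?_
  have hFy : Measurable fun x : Fin N → X => F (i.insertNth y x : Fin (N + 1) → X) :=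
    hF.comp (measurable_insertNth_right i y)
  have hgy : Measurable fun x : Fin N → X => expNeg (b * ∑ j, g y (x j)) :=
    measurable_expNeg.comp ((measurable_sum_kernel_left hgm y).const_mul _)
  rw [lintegral_gas m hgm b (hFy.fun_mul hgy)]
  refine lintegral_congr fun x => ?_
  rw [pairEnergy_insertNth hg, mul_add, expNeg_add, mul_assoc]

end Gas

section Variational

variable {X : Type*} [MeasurableSpace X]

theorem ofReal_integral_le_lintegral {μ : Measure X} {h : X → ℝ} (hh : Integrable h μ) :
    ENNReal.ofReal (∫ x, h x ∂μ) ≤ ∫⁻ x, ENNReal.ofReal (h x) ∂μ := by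
  calc ENNReal.ofReal (∫ x, h x ∂μ)
      ≤ ENNReal.ofReal (∫ x, max (h x) 0 ∂μ) :=
        ENNReal.ofReal_le_ofReal (integral_mono hh hh.pos_part fun x => le_max_left _ _)
    _ = ∫⁻ x, ENNReal.ofReal (max (h x) 0) ∂μ :=
        ofReal_integral_eq_lintegral_ofReal hh.pos_part (ae_of_all _ fun x => le_max_right _ _)
    _ = ∫⁻ x, ENNReal.ofReal (h x) ∂μ := by simp

theorem ofReal_exp_integral_le_lintegral {P : Measure X} [IsProbabilityMeasure P] {h : X → ℝ}
    (hh : Integrable h P) :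
    ENNReal.ofReal (Real.exp (∫ x, h x ∂P)) ≤ ∫⁻ x, ENNReal.ofReal (Real.exp (h x)) ∂P := by
  set c := ∫ x, h x ∂P with hc
  have tangent (t : ℝ) : Real.exp c * (1 - c + t) ≤ Real.exp t := by
    calc Real.exp c * (1 - c + t) ≤ Real.exp c * Real.exp (t - c) := by
          gcongr
          linarith [Real.add_one_le_exp (t - c)]
      _ = Real.exp t := by rw [← Real.exp_add, add_sub_cancel]
  have integral_tangent : ∫ x, Real.exp c * (1 - c + h x) ∂P = Real.exp c := by
    rw [integral_const_mul, integral_add (integrable_const _) hh, ← hc]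
    simp
  calc ENNReal.ofReal (Real.exp c)
      = ENNReal.ofReal (∫ x, Real.exp c * (1 - c + h x) ∂P) := by rw [integral_tangent]
    _ ≤ ∫⁻ x, ENNReal.ofReal (Real.exp c * (1 - c + h x)) ∂P :=
        ofReal_integral_le_lintegral (((integrable_const _).add hh).const_mul _)
    _ ≤ ∫⁻ x, ENNReal.ofReal (Real.exp (h x)) ∂P :=
        lintegral_mono fun x => ENNReal.ofReal_le_ofReal (tangent _)

theorem lintegral_ofReal_exp_neg_llr_mul_le (m P : Measure X) [SigmaFinite m] [SigmaFinite P]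
    (hac : P ≪ m) {F : X → ℝ≥0∞} (hF : Measurable F) :
    ∫⁻ x, ENNReal.ofReal (Real.exp (-llr P m x)) * F x ∂P ≤ ∫⁻ x, F x ∂m := by
  calc ∫⁻ x, ENNReal.ofReal (Real.exp (-llr P m x)) * F x ∂P
      = ∫⁻ x, m.rnDeriv P x * F x ∂P := by
        refine lintegral_congr_ae ?_
        filter_upwards [exp_neg_llr hac, Measure.rnDeriv_ne_top m P] with x hx hx'
        rw [hx, ENNReal.ofReal_toReal hx']
    _ = ∫⁻ x, F x ∂(P.withDensity (m.rnDeriv P)) :=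
        (lintegral_withDensity_eq_lintegral_mul _ (Measure.measurable_rnDeriv _ _) hF).symm
    _ ≤ ∫⁻ x, F x ∂m := lintegral_mono' (Measure.withDensity_rnDeriv_le _ _) le_rfl

theorem expNeg_lintegral_add_klDiv_le (m P : Measure X) [IsProbabilityMeasure m]
    [IsProbabilityMeasure P] {S : X → ℝ≥0∞} (hS : Measurable S) :
    expNeg (∫⁻ x, S x ∂P + klDiv P m) ≤ ∫⁻ x, expNeg (S x) ∂m := by
  by_cases hk : klDiv P m = ∞
  · simp [hk]
  by_cases hs : ∫⁻ x, S x ∂P = ∞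
  · simp [hs]
  obtain ⟨hac, hllr⟩ := klDiv_ne_top_iff.1 hk
  have hSint : Integrable (fun x => (S x).toReal) P :=
    integrable_toReal_of_lintegral_ne_top hS.aemeasurable hs
  have hexponent : (∫⁻ x, S x ∂P + klDiv P m).toReal
      = -∫ x, (-llr P m x + -(S x).toReal) ∂P := by
    rw [ENNReal.toReal_add hs hk, toReal_klDiv_of_measure_eq hac (by simp),
      ← integral_toReal hS.aemeasurable (ae_lt_top hS hs)]
    simp_rw [← neg_add, integral_neg, neg_neg]
    rw [integral_add hllr hSint, add_comm]
  calc expNeg (∫⁻ x, S x ∂P + klDiv P m)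
      = ENNReal.ofReal (Real.exp (∫ x, (-llr P m x + -(S x).toReal) ∂P)) := by
        rw [← ENNReal.ofReal_toReal (expNeg_ne_top _),
          toReal_expNeg (ENNReal.add_ne_top.2 ⟨hs, hk⟩), hexponent, neg_neg]
    _ ≤ ∫⁻ x, ENNReal.ofReal (Real.exp (-llr P m x + -(S x).toReal)) ∂P :=
        ofReal_exp_integral_le_lintegral (hllr.neg.add hSint.neg)
    _ = ∫⁻ x, ENNReal.ofReal (Real.exp (-llr P m x)) * expNeg (S x) ∂P := by
        refine lintegral_congr_ae ?_
        filter_upwards [ae_lt_top hS hs] with x hx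
        rw [Real.exp_add, ENNReal.ofReal_mul (Real.exp_nonneg _), ← toReal_expNeg hx.ne,
          ENNReal.ofReal_toReal (expNeg_ne_top _)]
    _ ≤ ∫⁻ x, expNeg (S x) ∂m := lintegral_ofReal_exp_neg_llr_mul_le m P hac (by fun_prop)

theorem expNeg_lintegral_le (m : Measure X) [IsProbabilityMeasure m] {S : X → ℝ≥0∞}
    (hS : Measurable S) : expNeg (∫⁻ x, S x ∂m) ≤ ∫⁻ x, expNeg (S x) ∂m := by
  simpa using expNeg_lintegral_add_klDiv_le m m hS

theorem expNeg_lintegral_pi_add_klDiv_le (m P : Measure X) [IsProbabilityMeasure m]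
    [IsProbabilityMeasure P] (N : ℕ) {S : (Fin N → X) → ℝ≥0∞} (hS : Measurable S) :
    expNeg (∫⁻ x, S x ∂(Measure.pi fun _ => P) + N * klDiv P m) ≤
      ∫⁻ x, expNeg (S x) ∂(Measure.pi fun _ => m) := by
  induction N with
  | zero =>
    rw [Measure.pi_of_empty, Measure.pi_of_empty, lintegral_dirac' _ hS,
      lintegral_dirac' _ (by fun_prop)]
    simp
  | succ N ih =>
    have hmean : Measurable fun y => ∫⁻ x, S ((0 : Fin (N + 1)).insertNth y x)
        ∂(Measure.pi fun _ : Fin N => P) :=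
      (hS.comp (measurable_insertNth 0)).lintegral_prod_right'
    rw [lintegral_pi_succ m 0 (by fun_prop), lintegral_pi_succ P 0 hS]
    calc expNeg (∫⁻ y, ∫⁻ x, S ((0 : Fin (N + 1)).insertNth y x)
            ∂(Measure.pi fun _ => P) ∂P + (N + 1 : ℕ) * klDiv P m)
        = expNeg (∫⁻ y, (∫⁻ x, S ((0 : Fin (N + 1)).insertNth y x)
            ∂(Measure.pi fun _ => P) + N * klDiv P m) ∂P + klDiv P m) := by
          rw [lintegral_add_right _ measurable_const]
          simp only [lintegral_const, measure_univ, mul_one]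
          push_cast
          ring_nf
      _ ≤ ∫⁻ y, expNeg (∫⁻ x, S ((0 : Fin (N + 1)).insertNth y x)
            ∂(Measure.pi fun _ => P) + N * klDiv P m) ∂m :=
          expNeg_lintegral_add_klDiv_le m P (hmean.add_const _)
      _ ≤ _ := lintegral_mono fun y => ih (hS.comp (measurable_insertNth_right 0 y))

theorem lintegral_pi_eval (P : Measure X) [IsProbabilityMeasure P] {N : ℕ} (i : Fin N)
    {f : X → ℝ≥0∞} (hf : Measurable f) :
    ∫⁻ x, f (x i) ∂(Measure.pi fun _ : Fin N => P) = ∫⁻ z, f z ∂P :=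
  (measurePreserving_eval (fun _ : Fin N => P) i).lintegral_comp hf

theorem lintegral_pairEnergy (P : Measure X) [IsProbabilityMeasure P] {g : X → X → ℝ≥0∞}
    (hgm : Measurable (Function.uncurry g)) (hg : ∀ u x, g u x = g x u) (N : ℕ) :
    ∫⁻ x, pairEnergy g x ∂(Measure.pi fun _ : Fin N => P) =
      N.choose 2 * ∫⁻ y, ∫⁻ z, g y z ∂P ∂P := by
  induction N with
  | zero => simp [pairEnergy]
  | succ N ih =>
    have insert_particle (y : X) :
        ∫⁻ x, (∑ j, g y (x j) + pairEnergy g x) ∂(Measure.pi fun _ : Fin N => P)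
          = N * ∫⁻ z, g y z ∂P + N.choose 2 * ∫⁻ y, ∫⁻ z, g y z ∂P ∂P := by
      have hgj (j : Fin N) (_ : j ∈ Finset.univ) : Measurable fun x : Fin N → X => g y (x j) :=
        hgm.of_uncurry_left.comp (measurable_pi_apply j)
      rw [lintegral_add_right _ (measurable_pairEnergy hgm), ih, lintegral_finsetSum _ hgj]
      simp [lintegral_pi_eval P _ (hgm.of_uncurry_left (x := y))]
    have hpot : Measurable fun y => ∫⁻ z, g y z ∂P := hgm.lintegral_prod_right'
    rw [lintegral_pi_succ P 0 (measurable_pairEnergy hgm)]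
    simp_rw [pairEnergy_insertNth hg, insert_particle]
    rw [lintegral_add_right _ measurable_const, lintegral_const_mul _ hpot]
    simp only [lintegral_const, measure_univ, mul_one]
    rw [Nat.choose_succ_succ' N 1]
    push_cast
    simp only [Nat.choose_one_right]
    ring

instance isFiniteMeasure_gas (m : Measure X) [IsProbabilityMeasure m] (g : X → X → ℝ≥0∞)
    (b : ℝ≥0) (N : ℕ) : IsFiniteMeasure (gas m g b N) := by
  refine isFiniteMeasure_withDensity (ne_top_of_le_ne_top ENNReal.one_ne_top ?_)
  calc ∫⁻ x, expNeg (b * pairEnergy g x) ∂(Measure.pi fun _ : Fin N => m)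
      ≤ ∫⁻ _, 1 ∂(Measure.pi fun _ : Fin N => m) := lintegral_mono fun x => expNeg_le_one _
    _ = 1 := by simp

theorem expNeg_le_gas_univ (m P : Measure X) [IsProbabilityMeasure m] [IsProbabilityMeasure P]
    {g : X → X → ℝ≥0∞} (hgm : Measurable (Function.uncurry g)) (hg : ∀ u x, g u x = g x u)
    (b : ℝ≥0) (N : ℕ) :
    expNeg (b * (N.choose 2 * ∫⁻ y, ∫⁻ z, g y z ∂P ∂P) + N * klDiv P m) ≤
      gas m g b N Set.univ := by
  rw [gas, withDensity_apply _ MeasurableSet.univ, setLIntegral_univ,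
    ← lintegral_pairEnergy P hgm hg, ← lintegral_const_mul _ (measurable_pairEnergy hgm)]
  exact expNeg_lintegral_pi_add_klDiv_le m P N (by fun_prop)

theorem gas_succ_univ (m : Measure X) [IsProbabilityMeasure m]
    {g : X → X → ℝ≥0∞} (hgm : Measurable (Function.uncurry g)) (hg : ∀ u x, g u x = g x u)
    (b : ℝ≥0) (N : ℕ) :
    gas m g b (N + 1) Set.univ =
      ∫⁻ y, ∫⁻ x, expNeg (b * ∑ j, g y (x j)) ∂(gas m g b N) ∂m := by
  have := lintegral_gas_succ m hgm hg b (0 : Fin (N + 1)) (F := fun _ => 1) measurable_const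
  simpa using this

theorem mul_gas_univ_le_gas_succ_univ (m : Measure X) [IsProbabilityMeasure m]
    {g : X → X → ℝ≥0∞} (hgm : Measurable (Function.uncurry g)) (hg : ∀ u x, g u x = g x u)
    {G : ℝ≥0∞} (hG : ∀ y, ∫⁻ x, g y x ∂m ≤ G) (b : ℝ≥0) (N : ℕ) :
    expNeg (b * (N * G)) * gas m g b N Set.univ ≤ gas m g b (N + 1) Set.univ := by
  have mean_energy_le (x : Fin N → X) : ∫⁻ y, b * ∑ j, g y (x j) ∂m ≤ b * (N * G) := by
    have energy_le (z : X) : ∫⁻ y, g y z ∂m ≤ G := by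
      simp_rw [hg _ z]
      exact hG z
    rw [lintegral_const_mul _ (measurable_sum_kernel_right hgm x),
      lintegral_finsetSum _ fun j _ => hgm.of_uncurry_right]
    gcongr
    exact (Finset.sum_le_sum fun j _ => energy_le (x j)).trans_eq (by simp)
  have weight_measurable : Measurable fun q : X × (Fin N → X) =>
      expNeg (b * ∑ j, g q.1 (q.2 j)) :=
    measurable_expNeg.comp ((measurable_sum_kernel hgm).const_mul _)
  rw [gas_succ_univ m hgm hg, lintegral_lintegral_swap weight_measurable.aemeasurable]
  calc expNeg (b * (N * G)) * gas m g b N Set.univ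
      = ∫⁻ _, expNeg (b * (N * G)) ∂(gas m g b N) := by simp
    _ ≤ ∫⁻ x, expNeg (∫⁻ y, b * ∑ j, g y (x j) ∂m) ∂(gas m g b N) :=
        lintegral_mono fun x => expNeg_antitone (mean_energy_le x)
    _ ≤ _ := lintegral_mono fun x =>
        expNeg_lintegral_le m ((measurable_sum_kernel_right hgm x).const_mul _)

theorem gas_univ_pos (m : Measure X) [IsProbabilityMeasure m]
    {g : X → X → ℝ≥0∞} (hgm : Measurable (Function.uncurry g)) (hg : ∀ u x, g u x = g x u)
    {G : ℝ≥0∞} (hGt : G ≠ ∞) (hG : ∀ y, ∫⁻ x, g y x ∂m ≤ G) (b : ℝ≥0) (N : ℕ) :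
    0 < gas m g b N Set.univ := by
  induction N with
  | zero =>
    rw [gas, withDensity_apply _ MeasurableSet.univ, setLIntegral_univ]
    simp [pairEnergy]
  | succ N ih =>
    refine lt_of_lt_of_le (ENNReal.mul_pos (expNeg_pos ?_).ne' ih.ne')
      (mul_gas_univ_le_gas_succ_univ m hgm hg hG b N)
    exact ENNReal.mul_ne_top (by simp) (ENNReal.mul_ne_top (by simp) hGt)

theorem lintegral_gas_eval_le (m : Measure X) [IsProbabilityMeasure m]
    {g : X → X → ℝ≥0∞} (hgm : Measurable (Function.uncurry g)) (hg : ∀ u x, g u x = g x u)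
    {G : ℝ≥0∞} (hG : ∀ y, ∫⁻ x, g y x ∂m ≤ G) (b : ℝ≥0) {N : ℕ} (i : Fin N)
    {F : X → ℝ≥0∞} (hF : Measurable F) :
    expNeg (b * (N * G)) * ∫⁻ x, F (x i) ∂(gas m g b N) ≤
      (∫⁻ z, F z ∂m) * gas m g b N Set.univ := by
  cases N with
  | zero => exact i.elim0
  | succ N =>
    have weight_le (y : X) (x : Fin N → X) : F y * expNeg (b * ∑ j, g y (x j)) ≤ F y :=
      mul_le_of_le_one_right' (expNeg_le_one _)
    have expNeg_le : expNeg (b * ((N + 1 : ℕ) * G)) ≤ expNeg (b * (N * G)) :=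
      expNeg_antitone (by gcongr; exact N.le_succ)
    have eval_measurable : Measurable fun x : Fin (N + 1) → X => F (x i) :=
      hF.comp (measurable_pi_apply i)
    rw [lintegral_gas_succ m hgm hg b i eval_measurable]
    simp only [Fin.insertNth_apply_same]
    calc expNeg (b * ((N + 1 : ℕ) * G)) *
          ∫⁻ y, ∫⁻ x, F y * expNeg (b * ∑ j, g y (x j)) ∂(gas m g b N) ∂m
        ≤ expNeg (b * (N * G)) * ∫⁻ y, ∫⁻ _, F y ∂(gas m g b N) ∂m :=
          mul_le_mul' expNeg_le (lintegral_mono fun y => lintegral_mono (weight_le y))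
      _ = (∫⁻ z, F z ∂m) * (expNeg (b * (N * G)) * gas m g b N Set.univ) := by
          simp only [lintegral_const]
          rw [lintegral_mul_const _ hF]
          ring
      _ ≤ (∫⁻ z, F z ∂m) * gas m g b (N + 1) Set.univ := by
          gcongr
          exact mul_gas_univ_le_gas_succ_univ m hgm hg hG b N

end Variational

/-! ### The Donsker–Varadhan formula with bounded continuous test functions -/

section DonskerVaradhan

/-- The truncation of `s` to the interval `[t⁻¹, t]` (for `1 ≤ t`), whose logarithm is bounded. It
turns the optimal test function `log (dP/dm)` of the Donsker–Varadhan formula into a bounded one. -/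
noncomputable def logClamp (t s : ℝ) : ℝ :=
  max t⁻¹ (min s t)

theorem inv_le_logClamp (t s : ℝ) : t⁻¹ ≤ logClamp t s :=
  le_max_left _ _

theorem logClamp_le {t : ℝ} (ht : 1 ≤ t) (s : ℝ) : logClamp t s ≤ t :=
  max_le ((inv_le_one_of_one_le₀ ht).trans ht) (min_le_right _ _)

theorem logClamp_pos {t : ℝ} (ht : 1 ≤ t) (s : ℝ) : 0 < logClamp t s :=
  (inv_pos.2 (one_pos.trans_le ht)).trans_le (inv_le_logClamp t s)

theorem abs_log_logClamp_le {t : ℝ} (ht : 1 ≤ t) (s : ℝ) :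
    |Real.log (logClamp t s)| ≤ Real.log t := by
  refine abs_le.2 ⟨?_, Real.log_le_log (logClamp_pos ht s) (logClamp_le ht s)⟩
  rw [← Real.log_inv]
  exact Real.log_le_log (inv_pos.2 (one_pos.trans_le ht)) (inv_le_logClamp t s)

@[fun_prop]
theorem measurable_logClamp (t : ℝ) : Measurable (logClamp t) := by
  unfold logClamp
  fun_prop

theorem sub_logClamp_mul_log_nonneg {t : ℝ} (ht : 1 ≤ t) (s : ℝ) :
    0 ≤ (s - logClamp t s) * Real.log (logClamp t s) := by
  have inv_le_one : t⁻¹ ≤ 1 := inv_le_one_of_one_le₀ ht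
  have inv_pos : 0 < t⁻¹ := inv_pos.2 (one_pos.trans_le ht)
  unfold logClamp
  rcases le_total s t⁻¹ with h | h
  · rw [max_eq_left ((min_le_left _ _).trans h)]
    exact mul_nonneg_of_nonpos_of_nonpos (sub_nonpos.2 h) (Real.log_nonpos inv_pos.le inv_le_one)
  · rcases le_total s t with h' | h'
    · simp [min_eq_left h', max_eq_right h]
    · rw [min_eq_right h', max_eq_right (inv_le_one.trans ht)]
      exact mul_nonneg (sub_nonneg.2 h') (Real.log_nonneg ht)

theorem mul_log_logClamp_nonneg {t : ℝ} (ht : 1 ≤ t) (s : ℝ) :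
    0 ≤ s * Real.log (logClamp t s) + 1 - logClamp t s := by
  have klFun_nonneg := klFun_nonneg (logClamp_pos ht s).le
  rw [klFun_apply] at klFun_nonneg
  linarith [sub_logClamp_mul_log_nonneg ht s]

theorem tendsto_mul_log_logClamp {s : ℝ} (hs : 0 ≤ s) :
    Tendsto (fun n : ℕ => s * Real.log (logClamp (n + 1) s) + 1 - logClamp (n + 1) s) atTop
      (𝓝 (klFun s)) := by
  have inv_tendsto : Tendsto (fun n : ℕ => ((n : ℝ) + 1)⁻¹) atTop (𝓝 0) := by
    simpa using tendsto_one_div_add_atTop_nhds_zero_nat (𝕜 := ℝ)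
  rcases hs.eq_or_lt with rfl | hpos
  · have clamp_zero (n : ℕ) : logClamp (n + 1) 0 = ((n : ℝ) + 1)⁻¹ := by
      rw [logClamp, min_eq_left (by positivity), max_eq_left (by positivity)]
    simpa [clamp_zero, klFun_zero] using inv_tendsto.const_sub 1
  · refine tendsto_const_nhds.congr' ?_
    filter_upwards [inv_tendsto.eventually_lt_const hpos, eventually_ge_atTop ⌈s⌉₊]
      with n inv_lt ceil_le
    have le_succ : s ≤ n + 1 :=
      (Nat.le_ceil s).trans (by exact_mod_cast ceil_le.trans n.le_succ)
    rw [logClamp, min_eq_left le_succ, max_eq_right inv_lt.le, klFun_apply]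

variable {X : Type*} [MeasurableSpace X]

theorem exists_measurable_lt_of_not_absolutelyContinuous {m P : Measure X}
    [IsProbabilityMeasure m] [IsFiniteMeasure P] (hPm : ¬ P ≪ m) (c : ℝ) :
    ∃ (f : X → ℝ) (R : ℝ), Measurable f ∧ (∀ x, |f x| ≤ R) ∧
      c < ∫ x, f x ∂P + 1 - ∫ x, Real.exp (f x) ∂m := by
  obtain ⟨A, hA, mA, PA⟩ : ∃ A, MeasurableSet A ∧ m A = 0 ∧ P A ≠ 0 := by
    by_contra! h
    exact hPm (Measure.AbsolutelyContinuous.mk h)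
  have PA_pos : 0 < P.real A := ENNReal.toReal_pos PA (measure_ne_top _ _)
  set t := (|c| + 1) / P.real A with ht
  have t_nonneg : 0 ≤ t := by positivity
  have integral_exp : ∫ x, Real.exp (A.indicator (fun _ => t) x) ∂m = 1 := by
    have exp_eq_one : (fun x => Real.exp (A.indicator (fun _ => t) x)) =ᵐ[m] fun _ => 1 := by
      filter_upwards [measure_eq_zero_iff_ae_notMem.1 mA] with x hx
      simp [hx]
    simp [integral_congr_ae exp_eq_one]
  refine ⟨A.indicator fun _ => t, t, measurable_const.indicator hA, fun x => ?_, ?_⟩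
  · by_cases hx : x ∈ A <;> simp [hx, abs_of_nonneg t_nonneg, t_nonneg]
  · rw [integral_exp, integral_indicator_const _ hA, smul_eq_mul, ht,
      mul_div_cancel₀ _ PA_pos.ne']
    linarith [le_abs_self c]

theorem exists_lt_lintegral_logClamp {m P : Measure X} [IsFiniteMeasure m] [IsFiniteMeasure P]
    (hPm : P ≪ m) {c : ℝ≥0∞} (hc : c < klDiv P m) :
    ∃ n : ℕ, c < ∫⁻ x, ENNReal.ofReal ((P.rnDeriv m x).toReal *
      Real.log (logClamp (n + 1) (P.rnDeriv m x).toReal) + 1 -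
        logClamp (n + 1) (P.rnDeriv m x).toReal) ∂m := by
  have : Measurable fun x => (P.rnDeriv m x).toReal :=
    (Measure.measurable_rnDeriv _ _).ennreal_toReal
  have liminf_eq (x : X) := (ENNReal.tendsto_ofReal (tendsto_mul_log_logClamp
    (ENNReal.toReal_nonneg (a := P.rnDeriv m x)))).liminf_eq
  refine (eventually_lt_of_lt_liminf (f := atTop) (hc.trans_le ?_)).exists
  simp_rw [klDiv_eq_lintegral_klFun_of_ac hPm, ← liminf_eq]
  exact lintegral_liminf_le fun n => by fun_prop

theorem exists_measurable_lt_of_lt_klDiv {m P : Measure X} [IsProbabilityMeasure m]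
    [IsProbabilityMeasure P] {c : ℝ} (hc : ENNReal.ofReal c < klDiv P m) :
    ∃ (f : X → ℝ) (R : ℝ), Measurable f ∧ (∀ x, |f x| ≤ R) ∧
      c < ∫ x, f x ∂P + 1 - ∫ x, Real.exp (f x) ∂m := by
  by_cases hPm : P ≪ m
  swap
  · exact exists_measurable_lt_of_not_absolutelyContinuous hPm c
  obtain ⟨n, hn⟩ := exists_lt_lintegral_logClamp hPm hc
  have one_le : 1 ≤ (n : ℝ) + 1 := by simp
  set φ : X → ℝ := fun x => (P.rnDeriv m x).toReal
  have φ_measurable : Measurable φ := (Measure.measurable_rnDeriv _ _).ennreal_toReal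
  have log_le (x : X) := abs_log_logClamp_le one_le (φ x)
  have clamp_int : Integrable (fun x => logClamp (n + 1) (φ x)) m := by
    refine .of_bound (Measurable.aestronglyMeasurable (by fun_prop)) (n + 1)
      (ae_of_all _ fun x => ?_)
    rw [Real.norm_of_nonneg (logClamp_pos one_le _).le]
    exact logClamp_le one_le _
  have mul_log_int : Integrable (fun x => φ x * Real.log (logClamp (n + 1) (φ x))) m :=
    Measure.integrable_toReal_rnDeriv.mul_bdd (Measurable.aestronglyMeasurable (by fun_prop))
      (ae_of_all _ log_le)
  have integral_mul_log : ∫ x, φ x * Real.log (logClamp (n + 1) (φ x)) ∂m =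
      ∫ x, Real.log (logClamp (n + 1) (φ x)) ∂P :=
    integral_rnDeriv_smul (f := fun x => Real.log (logClamp (n + 1) (φ x))) hPm
  have add_one_int : Integrable (fun x => φ x * Real.log (logClamp (n + 1) (φ x)) + 1) m :=
    mul_log_int.add (integrable_const 1)
  have integrand_int : Integrable
      (fun x => φ x * Real.log (logClamp (n + 1) (φ x)) + 1 - logClamp (n + 1) (φ x)) m :=
    add_one_int.sub clamp_int
  refine ⟨fun x => Real.log (logClamp (n + 1) (φ x)), Real.log (n + 1), by fun_prop, log_le, ?_⟩
  calc c
      < ∫ x, (φ x * Real.log (logClamp (n + 1) (φ x)) + 1 - logClamp (n + 1) (φ x)) ∂m := by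
        rw [← ofReal_integral_eq_lintegral_ofReal integrand_int
          (ae_of_all _ fun x => mul_log_logClamp_nonneg one_le _)] at hn
        exact lt_of_not_ge fun h => hn.not_ge (ENNReal.ofReal_le_ofReal h)
    _ = ∫ x, (φ x * Real.log (logClamp (n + 1) (φ x)) + 1) ∂m -
          ∫ x, logClamp (n + 1) (φ x) ∂m := integral_sub add_one_int clamp_int
    _ = _ := by
        rw [integral_add mul_log_int (integrable_const 1), integral_mul_log]
        simp [Real.exp_log (logClamp_pos one_le _)]

theorem abs_exp_sub_exp_le {a b R : ℝ} (ha : a ≤ R) (hb : b ≤ R) :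
    |Real.exp a - Real.exp b| ≤ Real.exp R * |a - b| := by
  have exp_lipschitz : ∀ x ∈ Set.Iic R, ‖deriv Real.exp x‖ ≤ Real.exp R := fun x hx => by
    rw [Real.deriv_exp, Real.norm_eq_abs, Real.abs_exp]
    exact Real.exp_le_exp.2 hx
  simpa using (convex_Iic R).norm_image_sub_le_of_norm_deriv_le
    (fun x _ => Real.differentiableAt_exp) exp_lipschitz hb ha

theorem abs_sub_clamp_le {a b R : ℝ} (ha : |a| ≤ R) :
    |a - max (-R) (min b R)| ≤ |a - b| := by
  obtain ⟨le_a, a_le⟩ := abs_le.1 ha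
  calc |a - max (-R) (min b R)| = |max (min a R) (-R) - max (min b R) (-R)| := by
        rw [min_eq_left a_le, max_eq_left le_a, max_comm]
    _ ≤ |min a R - min b R| := abs_max_sub_max_le_abs _ _ _
    _ ≤ |a - b| := by simpa using abs_min_sub_min_le_max a R b R

theorem integrable_exp_of_abs_le {μ : Measure X} [IsFiniteMeasure μ] {f : X → ℝ} {R : ℝ}
    (hf : Measurable f) (hR : ∀ x, |f x| ≤ R) : Integrable (fun x => Real.exp (f x)) μ := by
  refine .of_bound (by fun_prop) (Real.exp R) (ae_of_all _ fun x => ?_)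
  rw [Real.norm_eq_abs, Real.abs_exp]
  exact Real.exp_le_exp.2 (abs_le.1 (hR x)).2

theorem integral_exp_le_add {m : Measure X} [IsFiniteMeasure m] {f h : X → ℝ} {R : ℝ}
    (hf : Measurable f) (hfR : ∀ x, |f x| ≤ R) (hh : Measurable h) (hhR : ∀ x, |h x| ≤ R) :
    ∫ x, Real.exp (h x) ∂m ≤ ∫ x, Real.exp (f x) ∂m + Real.exp R * ∫ x, |f x - h x| ∂m := by
  have abs_sub_int : Integrable (fun x => |f x - h x|) m :=
    ((Integrable.of_bound hf.aestronglyMeasurable R (ae_of_all _ hfR)).sub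
      (.of_bound hh.aestronglyMeasurable R (ae_of_all _ hhR))).abs
  have exp_int := integrable_exp_of_abs_le (μ := m) hf hfR
  rw [← integral_const_mul, ← integral_add exp_int (abs_sub_int.const_mul _)]
  refine integral_mono (integrable_exp_of_abs_le hh hhR)
    (exp_int.add (abs_sub_int.const_mul _)) fun x => sub_le_iff_le_add'.1 ?_
  rw [abs_sub_comm]
  exact (le_abs_self _).trans
    (abs_exp_sub_exp_le (abs_le.1 (hhR x)).2 (abs_le.1 (hfR x)).2)

variable [TopologicalSpace X] [BorelSpace X] [NormalSpace X]

theorem exists_boundedContinuous_abs_le_integral_sub_le {μ : Measure X} [IsFiniteMeasure μ]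
    [μ.WeaklyRegular] {f : X → ℝ} {R : ℝ} (hf : Measurable f) (hfR : ∀ x, |f x| ≤ R)
    {ε : ℝ} (hε : 0 < ε) :
    ∃ h : X →ᵇ ℝ, (∀ x, |h x| ≤ R) ∧ ∫ x, |f x - h x| ∂μ ≤ ε := by
  have f_int : Integrable f μ := .of_bound hf.aestronglyMeasurable R (ae_of_all _ hfR)
  obtain ⟨g, integral_sub_le, g_int⟩ := f_int.exists_boundedContinuous_integral_sub_le hε
  have clamp_le (x : X) : |max (-R) (min (g x) R)| ≤ R :=
    abs_le.2 ⟨le_max_left _ _, max_le (neg_le_self ((abs_nonneg _).trans (hfR x)))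
      (min_le_right _ _)⟩
  refine ⟨.ofNormedAddCommGroup (fun x => max (-R) (min (g x) R)) (by fun_prop) R clamp_le,
    clamp_le, (integral_mono_of_nonneg (ae_of_all _ fun x => abs_nonneg _)
      (f_int.sub g_int).norm (ae_of_all _ fun x => abs_sub_clamp_le (hfR x))).trans
        integral_sub_le⟩

theorem exists_boundedContinuous_lt_of_lt_klDiv (m P : Measure X) [IsProbabilityMeasure m]
    [IsProbabilityMeasure P] [(P + m).WeaklyRegular] {c : ℝ}
    (hc : c < 0 ∨ ENNReal.ofReal c < klDiv P m) :
    ∃ f : X →ᵇ ℝ, c < ∫ x, f x ∂P + 1 - ∫ x, Real.exp (f x) ∂m := by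
  rcases hc with hc | hc
  · exact ⟨0, by simpa using hc⟩
  obtain ⟨f, R, hf, hfR, c_lt⟩ := exists_measurable_lt_of_lt_klDiv hc
  set gap := ∫ x, f x ∂P + 1 - ∫ x, Real.exp (f x) ∂m - c
  have gap_pos : 0 < gap := by linarith
  obtain ⟨h, hhR, integral_sub_le⟩ := exists_boundedContinuous_abs_le_integral_sub_le
    (μ := P + m) hf hfR (ε := gap / (2 * (1 + Real.exp R))) (by positivity)
  have hh : Measurable h := h.continuous.measurable
  have int_of_abs_le (Q : Measure X) [IsProbabilityMeasure Q] {k : X → ℝ} (hk : Measurable k)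
      (hkR : ∀ x, |k x| ≤ R) : Integrable k Q :=
    .of_bound hk.aestronglyMeasurable R (ae_of_all _ hkR)
  have abs_sub_int (Q : Measure X) [IsProbabilityMeasure Q] : Integrable (fun x => |f x - h x|) Q :=
    ((int_of_abs_le Q hf hfR).sub (int_of_abs_le Q hh hhR)).abs
  rw [integral_add_measure (abs_sub_int P) (abs_sub_int m)] at integral_sub_le
  have integral_P_sub_le : ∫ x, f x ∂P - ∫ x, h x ∂P ≤ ∫ x, |f x - h x| ∂P := by
    rw [← integral_sub (int_of_abs_le P hf hfR) (int_of_abs_le P hh hhR)]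
    exact integral_mono ((int_of_abs_le P hf hfR).sub (int_of_abs_le P hh hhR)) (abs_sub_int P)
      fun x => le_abs_self _
  have integral_exp_le := integral_exp_le_add (m := m) hf hfR hh hhR
  have P_nonneg : 0 ≤ ∫ x, |f x - h x| ∂P := integral_nonneg fun x => abs_nonneg _
  have m_nonneg : 0 ≤ ∫ x, |f x - h x| ∂m := integral_nonneg fun x => abs_nonneg _
  have error_le : (1 + Real.exp R) * (∫ x, |f x - h x| ∂P + ∫ x, |f x - h x| ∂m) ≤ gap / 2 := by
    calc _ ≤ (1 + Real.exp R) * (gap / (2 * (1 + Real.exp R))) := by gcongr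
      _ = gap / 2 := by field_simp
  refine ⟨h, ?_⟩
  nlinarith [Real.exp_pos R]

end DonskerVaradhan

section LowerSemicontinuity

variable {X : Type*} [MeasurableSpace X] [TopologicalSpace X] [BorelSpace X]
  [HasOuterApproxClosed X]

theorem lintegral_le_liminf_of_lowerSemicontinuous {ι : Type*} {L : Filter ι}
    [L.IsCountablyGenerated] {μ : ProbabilityMeasure X} {μs : ι → ProbabilityMeasure X}
    (h : Tendsto μs L (𝓝 μ)) {f : X → ℝ≥0∞} (hf : LowerSemicontinuous f) (hf_top : ∀ x, f x ≠ ∞) :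
    ∫⁻ x, f x ∂(μ : Measure X) ≤ L.liminf fun i => ∫⁻ x, f x ∂(μs i : Measure X) := by
  have lintegral_eq (Q : Measure X) :
      ∫⁻ x, f x ∂Q = ∫⁻ t in Set.Ioi (0 : ℝ), Q {x | t < (f x).toReal} := by
    rw [← lintegral_eq_lintegral_meas_lt Q (ae_of_all _ fun x => ENNReal.toReal_nonneg)
      hf.measurable.ennreal_toReal.aemeasurable]
    simp_rw [ENNReal.ofReal_toReal (hf_top _)]
  have tail_antitone (Q : Measure X) : Antitone fun t : ℝ => Q {x | t < (f x).toReal} :=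
    fun s t hst => measure_mono fun x hx => lt_of_le_of_lt hst hx
  simp_rw [lintegral_eq]
  refine le_trans ?_ (lintegral_liminf_le fun i => (tail_antitone _).measurable)
  refine setLIntegral_mono' measurableSet_Ioi fun t ht => ?_
  refine ProbabilityMeasure.le_liminf_measure_open_of_tendsto h ?_
  have superlevel_eq : {x | t < (f x).toReal} = f ⁻¹' Set.Ioi (ENNReal.ofReal t) := by
    ext x
    simp [ENNReal.ofReal_lt_iff_lt_toReal (Set.mem_Ioi.1 ht).le (hf_top x)]
  rw [superlevel_eq]
  exact hf.isOpen_preimage _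

theorem exists_eventually_lt_lintegral_min [FirstCountableTopology (ProbabilityMeasure X)]
    {f : X → ℝ≥0∞} (hf : LowerSemicontinuous f) (μ : ProbabilityMeasure X) {a : ℝ≥0∞}
    (ha : a < ∫⁻ x, f x ∂(μ : Measure X)) :
    ∃ k : ℕ, ∀ᶠ ν : ProbabilityMeasure X in 𝓝 μ, a < ∫⁻ x, min (f x) k ∂(ν : Measure X) := by
  have lintegral_eq_iSup :
      ∫⁻ x, f x ∂(μ : Measure X) = ⨆ k : ℕ, ∫⁻ x, min (f x) k ∂(μ : Measure X) := by
    rw [← lintegral_iSup (fun k => hf.measurable.min measurable_const)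
      fun i j hij x => min_le_min_left _ (by exact_mod_cast hij)]
    refine lintegral_congr fun x => ?_
    rw [← inf_iSup_eq, ENNReal.iSup_natCast, inf_top_eq]
  rw [lintegral_eq_iSup, lt_iSup_iff] at ha
  obtain ⟨k, hk⟩ := ha
  exact ⟨k, eventually_lt_of_lt_liminf <| hk.trans_le <|
    lintegral_le_liminf_of_lowerSemicontinuous tendsto_id (hf.inf lowerSemicontinuous_const)
      fun x => ne_top_of_le_ne_top (ENNReal.natCast_ne_top k) (min_le_right _ _)⟩

end LowerSemicontinuity

section GasProb

variable {X : Type*} [MeasurableSpace X]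

theorem lintegral_pi_prod (m : Measure X) [SigmaFinite m] {N : ℕ} {f : Fin N → X → ℝ≥0∞}
    (hf : ∀ i, Measurable (f i)) :
    ∫⁻ x, ∏ i, f i (x i) ∂(Measure.pi fun _ : Fin N => m) = ∏ i, ∫⁻ z, f i z ∂m := by
  induction N with
  | zero => simp
  | succ N ih =>
    have prod_measurable {M : ℕ} {f : Fin M → X → ℝ≥0∞} (hf : ∀ i, Measurable (f i)) :
        Measurable fun x : Fin M → X => ∏ i, f i (x i) :=
      Finset.measurable_prod _ fun i _ => (hf i).comp (measurable_pi_apply i)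
    rw [lintegral_pi_succ m 0 (prod_measurable hf), Fin.prod_univ_succAbove _ 0,
      ← ih (fun i => hf _), ← lintegral_mul_const _ (hf 0)]
    refine lintegral_congr fun y => ?_
    rw [← lintegral_const_mul _ (prod_measurable fun i => hf _)]
    refine lintegral_congr fun x => ?_
    rw [Fin.prod_univ_succAbove _ 0]
    simp

/-- The mean-field Gibbs measure: the probability measure proportional to `gas m g b N`. -/
noncomputable def gasProb (m : Measure X) (g : X → X → ℝ≥0∞) (b : ℝ≥0) (N : ℕ) :
    Measure (Fin N → X) :=
  (gas m g b N Set.univ)⁻¹ • gas m g b N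

theorem isProbabilityMeasure_gasProb (m : Measure X) [IsProbabilityMeasure m]
    {g : X → X → ℝ≥0∞} (hgm : Measurable (Function.uncurry g)) (hg : ∀ u x, g u x = g x u)
    {G : ℝ≥0∞} (hGt : G ≠ ∞) (hG : ∀ y, ∫⁻ x, g y x ∂m ≤ G) (b : ℝ≥0) (N : ℕ) :
    IsProbabilityMeasure (gasProb m g b N) := by
  refine ⟨?_⟩
  rw [gasProb, Measure.smul_apply, smul_eq_mul]
  exact ENNReal.inv_mul_cancel (gas_univ_pos m hgm hg hGt hG b N).ne' (measure_ne_top _ _)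

theorem lintegral_gasProb_eval_le (m : Measure X) [IsProbabilityMeasure m]
    {g : X → X → ℝ≥0∞} (hgm : Measurable (Function.uncurry g)) (hg : ∀ u x, g u x = g x u)
    {G : ℝ≥0∞} (hGt : G ≠ ∞) (hG : ∀ y, ∫⁻ x, g y x ∂m ≤ G) {b : ℝ≥0} {N : ℕ} {B : ℝ≥0}
    (hB : b * N ≤ B) (i : Fin N) {F : X → ℝ≥0∞} (hF : Measurable F) :
    ∫⁻ x, F (x i) ∂(gasProb m g b N) ≤ (expNeg (B * G))⁻¹ * ∫⁻ z, F z ∂m := by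
  have expNeg_le : expNeg (B * G) ≤ expNeg (b * (N * G)) := by
    refine expNeg_antitone ?_
    rw [← mul_assoc]
    gcongr
    exact_mod_cast hB
  have expNeg_pos : 0 < expNeg (B * G) := expNeg_pos (ENNReal.mul_ne_top (by simp) hGt)
  rw [gasProb, lintegral_smul_measure, smul_eq_mul, mul_comm (gas m g b N Set.univ)⁻¹,
    mul_comm (expNeg (B * G))⁻¹, ← div_eq_mul_inv, ← div_eq_mul_inv]
  refine ENNReal.div_le_of_le_mul ?_
  rw [ENNReal.mul_comm_div, mul_div_assoc', mul_comm]
  refine (ENNReal.le_div_iff_mul_le (.inl expNeg_pos.ne') (.inl (expNeg_ne_top _))).2 ?_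
  calc (∫⁻ x, F (x i) ∂(gas m g b N)) * expNeg (B * G)
      ≤ expNeg (b * (N * G)) * ∫⁻ x, F (x i) ∂(gas m g b N) := by
        rw [mul_comm]
        gcongr
    _ ≤ gas m g b N Set.univ * ∫⁻ z, F z ∂m := by
        rw [mul_comm (gas m g b N Set.univ)]
        exact lintegral_gas_eval_le m hgm hg hG b i hF

end GasProb

section Empirical

variable {X : Type*} [MeasurableSpace X]

/-- The empirical measure of a configuration. It is defined for `N + 1` points only, so that it is
a probability measure. -/
noncomputable def empirical {N : ℕ} (x : Fin (N + 1) → X) : ProbabilityMeasure X :=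
  ⟨((N + 1 : ℕ) : ℝ≥0∞)⁻¹ • ∑ j, Measure.dirac (x j), ⟨by
    simp only [Measure.smul_apply, Measure.coe_finsetSum, Finset.sum_apply, measure_univ,
      Finset.sum_const, Finset.card_univ, Fintype.card_fin, smul_eq_mul, nsmul_eq_mul, mul_one]
    exact ENNReal.inv_mul_cancel (by simp) (by simp)⟩⟩

theorem coe_empirical {N : ℕ} (x : Fin (N + 1) → X) : (empirical x : Measure X) =
    ((N + 1 : ℕ) : ℝ≥0∞)⁻¹ • ∑ j, Measure.dirac (x j) := rfl

theorem lintegral_empirical {N : ℕ} (x : Fin (N + 1) → X) {f : X → ℝ≥0∞} (hf : Measurable f) :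
    ∫⁻ z, f z ∂(empirical x : Measure X) = ((N + 1 : ℕ) : ℝ≥0∞)⁻¹ * ∑ j, f (x j) := by
  rw [coe_empirical, lintegral_smul_measure, lintegral_finsetSum_measure, smul_eq_mul]
  simp_rw [lintegral_dirac' _ hf]

theorem integral_empirical {N : ℕ} (x : Fin (N + 1) → X) {f : X → ℝ} (hf : Measurable f) :
    ∫ z, f z ∂(empirical x : Measure X) = ((N + 1 : ℕ) : ℝ)⁻¹ * ∑ j, f (x j) := by
  rw [coe_empirical, integral_smul_measure, integral_finsetSum_measure]
  · simp_rw [integral_dirac' _ _ hf.stronglyMeasurable]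
    rw [ENNReal.toReal_inv, ENNReal.toReal_natCast, smul_eq_mul]
  · exact fun j _ => integrable_dirac' hf.stronglyMeasurable (by simp)

end Empirical

section LargeDeviations

variable {X : Type*}

theorem lt_or_exists_lt_mul_add {F c A H : ℝ≥0∞} (hc : c ≠ ∞) (h : F < c * A + H) :
    F < H ∨ ∃ a < A, F < c * a + H := by
  by_cases hA : A = 0
  · exact .inl (by simpa [hA] using h)
  · have affine_continuous : Continuous fun a : ℝ≥0∞ => c * a + H :=
      (ENNReal.continuous_const_mul hc).add continuous_const
    have eventually_lt : ∀ᶠ a in 𝓝[<] A, F < c * a + H :=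
      (affine_continuous.continuousAt.eventually_const_lt h).filter_mono nhdsWithin_le_nhds
    have : (𝓝[<] A).NeBot := nhdsLT_neBot_of_exists_lt ⟨0, pos_iff_ne_zero.2 hA⟩
    obtain ⟨a, lt_add, lt_A⟩ := (eventually_lt.and self_mem_nhdsWithin).exists
    exact .inr ⟨a, lt_A, lt_add⟩

theorem expNeg_ofReal_le (t : ℝ) : expNeg (ENNReal.ofReal t) ≤ ENNReal.ofReal (Real.exp (-t)) := by
  rcases le_total 0 t with ht | ht
  · exact (expNeg_ofReal ht).le
  · rw [ENNReal.ofReal_of_nonpos ht]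
    exact (expNeg_le_one 0).trans
      (ENNReal.one_le_ofReal.2 (Real.one_le_exp (neg_nonneg.2 ht)))

theorem expNeg_mul_pairEnergy_le {g : X → X → ℝ≥0∞} (b : ℝ≥0) {N : ℕ} {x : Fin N → X}
    {f : X → ℝ} {u v : ℝ} (energy_ge : ENNReal.ofReal u ≤ pairEnergy g x)
    (sum_ge : v ≤ ∑ j, f (x j)) :
    expNeg (b * pairEnergy g x) ≤ ENNReal.ofReal (Real.exp (-(b * u) - v)) *
      ∏ j, ENNReal.ofReal (Real.exp (f (x j))) := by
  calc expNeg (b * pairEnergy g x)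
      ≤ expNeg (ENNReal.ofReal (b * u)) := by
        refine expNeg_antitone ?_
        rw [ENNReal.ofReal_mul b.coe_nonneg, ENNReal.ofReal_coe_nnreal]
        gcongr
    _ ≤ ENNReal.ofReal (Real.exp (-(b * u))) := expNeg_ofReal_le _
    _ ≤ ENNReal.ofReal (Real.exp (-(b * u) - v + ∑ j, f (x j))) := by
        gcongr
        linarith
    _ = _ := by
        rw [← ENNReal.ofReal_prod_of_nonneg fun j _ => Real.exp_nonneg _, ← Real.exp_sum,
          ← ENNReal.ofReal_mul (Real.exp_nonneg _), ← Real.exp_add]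

variable [MeasurableSpace X]

/-- The free energy of `P` for an arbitrary reference measure `m`, of which the free energy of the
statement is the case `m = refMeasure V`. -/
noncomputable def refFreeEnergy (γ : ℝ) (g : X → X → ℝ≥0∞) (m P : Measure X) : ℝ≥0∞ :=
  ENNReal.ofReal (γ / 2) * ∫⁻ y, ∫⁻ z, g y z ∂P ∂P + klDiv P m

theorem sq_mul_le_two_mul_pairEnergy_add {g : X → X → ℝ≥0∞} (hg : ∀ u x, g u x = g x u) {N : ℕ}
    (hgm : Measurable (Function.uncurry g)) (k : ℕ) (x : Fin (N + 1) → X) :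
    ((N + 1 : ℕ) : ℝ≥0∞) ^ 2 * ∫⁻ q, min (g q.1 q.2) k
        ∂((empirical x : Measure X).prod (empirical x : Measure X)) ≤
      2 * pairEnergy g x + (N + 1 : ℕ) * k := by
  have min_measurable : Measurable fun q : X × X => min (g q.1 q.2) (k : ℝ≥0∞) :=
    hgm.min measurable_const
  have lintegral_min_left (j : Fin (N + 1)) :
      ∫⁻ z, min (g (x j) z) (k : ℝ≥0∞) ∂(empirical x : Measure X) =
        ((N + 1 : ℕ) : ℝ≥0∞)⁻¹ * ∑ l, min (g (x j) (x l)) k :=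
    lintegral_empirical x (min_measurable.comp (measurable_const.prodMk measurable_id))
  have mul_inv : ((N + 1 : ℕ) : ℝ≥0∞) * ((N + 1 : ℕ) : ℝ≥0∞)⁻¹ = 1 :=
    ENNReal.mul_inv_cancel (by simp) (by simp)
  have sq_mul_inv_mul_inv (S : ℝ≥0∞) : ((N + 1 : ℕ) : ℝ≥0∞) ^ 2 *
      (((N + 1 : ℕ) : ℝ≥0∞)⁻¹ * (((N + 1 : ℕ) : ℝ≥0∞)⁻¹ * S)) = S := by
    calc _ = (((N + 1 : ℕ) : ℝ≥0∞) * ((N + 1 : ℕ) : ℝ≥0∞)⁻¹) *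
          (((N + 1 : ℕ) : ℝ≥0∞) * ((N + 1 : ℕ) : ℝ≥0∞)⁻¹) * S := by ring
      _ = S := by rw [mul_inv, one_mul, one_mul]
  have min_le (i l : Fin (N + 1)) : min (g (x i) (x l)) (k : ℝ≥0∞) ≤
      (if i = l then 0 else g (x i) (x l)) + if i = l then (k : ℝ≥0∞) else 0 := by
    by_cases h : i = l <;> simp [h]
  rw [lintegral_prod _ min_measurable.aemeasurable,
    lintegral_empirical x min_measurable.lintegral_prod_right']
  simp_rw [lintegral_min_left, ← Finset.mul_sum]
  rw [sq_mul_inv_mul_inv, two_mul_pairEnergy hg]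
  calc ∑ i, ∑ l, min (g (x i) (x l)) (k : ℝ≥0∞)
      ≤ ∑ i : Fin (N + 1), ∑ l : Fin (N + 1), ((if i = l then 0 else g (x i) (x l)) +
          if i = l then (k : ℝ≥0∞) else 0) := by gcongr with i _ l _; exact min_le i l
    _ = _ := by simp [Finset.sum_add_distrib]

theorem lintegral_pi_prod_exp_le {m : Measure X} [IsProbabilityMeasure m] {N : ℕ} {f : X → ℝ}
    (hf : Measurable f) {R : ℝ} (hfR : ∀ x, |f x| ≤ R) :
    ∫⁻ x, ∏ j, ENNReal.ofReal (Real.exp (f (x j))) ∂(Measure.pi fun _ : Fin N => m) ≤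
      ENNReal.ofReal (Real.exp (N * (∫ z, Real.exp (f z) ∂m - 1))) := by
  rw [lintegral_pi_prod m (f := fun _ z => ENNReal.ofReal (Real.exp (f z)))
      fun _ => hf.exp.ennreal_ofReal,
    ← ofReal_integral_eq_lintegral_ofReal (integrable_exp_of_abs_le hf hfR)
      (ae_of_all _ fun x => Real.exp_nonneg _), Finset.prod_const, Finset.card_univ,
    Fintype.card_fin, Real.exp_nat_mul, ENNReal.ofReal_pow (Real.exp_nonneg _)]
  gcongr
  simpa using Real.add_one_le_exp (∫ z, Real.exp (f z) ∂m - 1)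

theorem gas_apply_le {m : Measure X} [IsProbabilityMeasure m] {g : X → X → ℝ≥0∞}
    (hgm : Measurable (Function.uncurry g)) (b : ℝ≥0) (N : ℕ) {f : X → ℝ} (hf : Measurable f)
    {R : ℝ} (hfR : ∀ x, |f x| ≤ R) (u v : ℝ) :
    gas m g b N ({x | ENNReal.ofReal u ≤ pairEnergy g x} ∩ {x | v ≤ ∑ j, f (x j)}) ≤
      ENNReal.ofReal (Real.exp (-(b * u) - v + N * (∫ z, Real.exp (f z) ∂m - 1))) := by
  set T := {x : Fin N → X | ENNReal.ofReal u ≤ pairEnergy g x} ∩ {x | v ≤ ∑ j, f (x j)}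
  have T_measurable : MeasurableSet T :=
    (measurableSet_le measurable_const (measurable_pairEnergy hgm)).inter
      (measurableSet_le measurable_const
        (Finset.measurable_sum _ fun j _ => hf.comp (measurable_pi_apply j)))
  rw [gas, withDensity_apply _ T_measurable, Real.exp_add,
    ENNReal.ofReal_mul (Real.exp_nonneg _)]
  calc ∫⁻ x in T, expNeg (b * pairEnergy g x) ∂(Measure.pi fun _ => m)
      ≤ ∫⁻ x in T, ENNReal.ofReal (Real.exp (-(b * u) - v)) *
          ∏ j, ENNReal.ofReal (Real.exp (f (x j))) ∂(Measure.pi fun _ => m) :=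
        setLIntegral_mono' T_measurable fun x hx => expNeg_mul_pairEnergy_le b hx.1 hx.2
    _ ≤ ∫⁻ x, ENNReal.ofReal (Real.exp (-(b * u) - v)) *
          ∏ j, ENNReal.ofReal (Real.exp (f (x j))) ∂(Measure.pi fun _ => m) :=
        setLIntegral_le_lintegral _ _
    _ ≤ _ := by
        rw [lintegral_const_mul' _ _ ENNReal.ofReal_ne_top]
        gcongr
        exact lintegral_pi_prod_exp_le hf hfR

end LargeDeviations

section LocalEstimate

variable {X : Type*} [MeasurableSpace X]

theorem ofReal_exp_le_gas_univ (m P : Measure X) [IsProbabilityMeasure m] [IsProbabilityMeasure P]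
    {g : X → X → ℝ≥0∞} (hgm : Measurable (Function.uncurry g)) (hg : ∀ u x, g u x = g x u)
    (hI : ∫⁻ y, ∫⁻ z, g y z ∂P ∂P ≠ ∞) (hH : klDiv P m ≠ ∞) (b : ℝ≥0) (N : ℕ) :
    ENNReal.ofReal (Real.exp (-(b * ((N + 1 : ℕ) * N / 2 * (∫⁻ y, ∫⁻ z, g y z ∂P ∂P).toReal) +
      (N + 1 : ℕ) * (klDiv P m).toReal))) ≤ gas m g b (N + 1) Set.univ := by
  refine le_of_eq_of_le ?_ (expNeg_le_gas_univ m P hgm hg b (N + 1))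
  have choose_eq :
      (((N + 1).choose 2 : ℕ) : ℝ≥0∞) = ENNReal.ofReal (((N + 1 : ℕ) : ℝ) * N / 2) := by
    rw [← ENNReal.ofReal_natCast, Nat.cast_choose_two]
    push_cast
    ring_nf
  conv_rhs => rw [← ENNReal.ofReal_toReal hI, ← ENNReal.ofReal_toReal hH]
  rw [choose_eq, ← ENNReal.ofReal_mul (by positivity), ← ENNReal.ofReal_coe_nnreal (p := b),
    ← ENNReal.ofReal_mul (by positivity), ← ENNReal.ofReal_natCast,
    ← ENNReal.ofReal_mul (by positivity), ← ENNReal.ofReal_add (by positivity) (by positivity),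
    expNeg_ofReal (by positivity)]

theorem ofReal_le_pairEnergy_of_le_lintegral_empirical {g : X → X → ℝ≥0∞}
    (hgm : Measurable (Function.uncurry g)) (hg : ∀ u x, g u x = g x u) {a : ℝ≥0} {k N : ℕ}
    {x : Fin (N + 1) → X} (hx : (a : ℝ≥0∞) ≤ ∫⁻ q, min (g q.1 q.2) k
      ∂((empirical x : Measure X).prod (empirical x : Measure X))) :
    ENNReal.ofReal ((((N + 1 : ℕ) : ℝ) ^ 2 * a - (N + 1 : ℕ) * k) / 2) ≤ pairEnergy g x := by
  have sq_mul_le : ENNReal.ofReal (((N + 1 : ℕ) : ℝ) ^ 2 * a) ≤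
      2 * pairEnergy g x + ENNReal.ofReal ((N + 1 : ℕ) * k) := by
    rw [ENNReal.ofReal_mul (by positivity), ENNReal.ofReal_mul (by positivity),
      ENNReal.ofReal_pow (by positivity), ENNReal.ofReal_natCast, ENNReal.ofReal_natCast,
      ENNReal.ofReal_coe_nnreal]
    exact (mul_le_mul_right hx _).trans (sq_mul_le_two_mul_pairEnergy_add hg hgm k x)
  rw [ENNReal.ofReal_div_of_pos two_pos, ENNReal.ofReal_sub _ (by positivity),
    ENNReal.ofReal_ofNat]
  exact ENNReal.div_le_of_le_mul' (tsub_le_iff_right.2 sq_mul_le)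

theorem tendsto_ofReal_exp_mul_zero {θ : ℕ → ℝ} {l : ℝ} (hl : l < 0)
    (hθ : Tendsto θ atTop (𝓝 l)) :
    Tendsto (fun N => ENNReal.ofReal (Real.exp ((N + 1 : ℕ) * θ N))) atTop (𝓝 0) := by
  have tendsto_atBot : Tendsto (fun N => ((N + 1 : ℕ) : ℝ) * θ N) atTop atBot :=
    (tendsto_natCast_atTop_atTop.comp (tendsto_add_atTop_nat 1)).atTop_mul_neg hl hθ
  simpa using ENNReal.tendsto_ofReal (Real.tendsto_exp_atBot.comp tendsto_atBot)

theorem tendsto_zero_of_tendsto_succ_mul {b : ℕ → ℝ} {γ : ℝ}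
    (hb : Tendsto (fun N => ((N + 1 : ℕ) : ℝ) * b N) atTop (𝓝 γ)) : Tendsto b atTop (𝓝 0) := by
  refine (hb.div_atTop (tendsto_natCast_atTop_atTop.comp (tendsto_add_atTop_nat 1))).congr
    fun N => ?_
  rw [Function.comp_apply, mul_div_cancel_left₀ _ (by positivity)]

theorem gasProb_empirical_mem_le [TopologicalSpace X] [BorelSpace X] {m μ : Measure X}
    [IsProbabilityMeasure m] [IsProbabilityMeasure μ] {g : X → X → ℝ≥0∞}
    (hgm : Measurable (Function.uncurry g)) (hg : ∀ u x, g u x = g x u)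
    (hI : ∫⁻ y, ∫⁻ z, g y z ∂μ ∂μ ≠ ∞) (hH : klDiv μ m ≠ ∞) (b : ℝ≥0) (N : ℕ) (a : ℝ≥0) (k : ℕ)
    (f : X →ᵇ ℝ) (w : ℝ) :
    gasProb m g b (N + 1) {x | (a : ℝ≥0∞) ≤ ∫⁻ q, min (g q.1 q.2) k
        ∂((empirical x : Measure X).prod (empirical x : Measure X)) ∧
          w ≤ ∫ z, f z ∂(empirical x : Measure X)} ≤
      ENNReal.ofReal (Real.exp ((N + 1 : ℕ) * (-(((N + 1 : ℕ) * b * a - b * k) / 2) - w +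
        (∫ z, Real.exp (f z) ∂m - 1) +
          ((N + 1 : ℕ) * b - b) / 2 * (∫⁻ y, ∫⁻ z, g y z ∂μ ∂μ).toReal + (klDiv μ m).toReal))) := by
  have sum_ge {x : Fin (N + 1) → X} (hx : w ≤ ∫ z, f z ∂(empirical x : Measure X)) :
      ((N + 1 : ℕ) : ℝ) * w ≤ ∑ j, f (x j) := by
    rwa [integral_empirical x f.continuous.measurable, inv_mul_eq_div,
      le_div_iff₀' (by positivity)] at hx
  have subset : {x : Fin (N + 1) → X | (a : ℝ≥0∞) ≤ ∫⁻ q, min (g q.1 q.2) k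
      ∂((empirical x : Measure X).prod (empirical x : Measure X)) ∧
        w ≤ ∫ z, f z ∂(empirical x : Measure X)} ⊆
      {x | ENNReal.ofReal ((((N + 1 : ℕ) : ℝ) ^ 2 * a - (N + 1 : ℕ) * k) / 2) ≤
        pairEnergy g x} ∩ {x | ((N + 1 : ℕ) : ℝ) * w ≤ ∑ j, f (x j)} := fun x hx =>
    ⟨ofReal_le_pairEnergy_of_le_lintegral_empirical hgm hg hx.1, sum_ge hx.2⟩
  rw [gasProb, Measure.smul_apply, smul_eq_mul]
  refine (mul_le_mul' (ENNReal.inv_le_inv.2 (ofReal_exp_le_gas_univ m μ hgm hg hI hH b N))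
    ((measure_mono subset).trans (gas_apply_le (m := m) hgm b (N + 1) f.continuous.measurable
      f.norm_coe_le_norm _ _))).trans_eq ?_
  rw [← ENNReal.ofReal_inv_of_pos (Real.exp_pos _), ← Real.exp_neg,
    ← ENNReal.ofReal_mul (Real.exp_nonneg _), ← Real.exp_add]
  push_cast
  ring_nf

end LocalEstimate

section LocalLargeDeviations

variable {X : Type*} [MeasurableSpace X] [MetricSpace X] [SecondCountableTopology X]
  [BorelSpace X]

theorem exists_eventually_le_energy {g : X → X → ℝ≥0∞}
    (hlsc : LowerSemicontinuous fun q : X × X => g q.1 q.2) {F c H : ℝ≥0∞} (hc : c ≠ ∞)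
    (P : ProbabilityMeasure X)
    (h : F < c * ∫⁻ y, ∫⁻ z, g y z ∂(P : Measure X) ∂(P : Measure X) + H) :
    ∃ (a : ℝ≥0) (k : ℕ), (∀ᶠ Q : ProbabilityMeasure X in 𝓝 P,
      (a : ℝ≥0∞) ≤ ∫⁻ q, min (g q.1 q.2) k ∂((Q : Measure X).prod (Q : Measure X))) ∧
      F < c * a + H := by
  rcases lt_or_exists_lt_mul_add hc h with h | ⟨a, ha, h⟩
  · exact ⟨0, 0, Eventually.of_forall fun _ => by simp, by simpa using h⟩
  · lift a to ℝ≥0 using (ha.trans_le le_top).ne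
    have lintegral_prod_eq :
        ∫⁻ q, g q.1 q.2 ∂(((P.prod P : ProbabilityMeasure (X × X))) : Measure (X × X)) =
          ∫⁻ y, ∫⁻ z, g y z ∂(P : Measure X) ∂(P : Measure X) :=
      lintegral_prod _ hlsc.measurable.aemeasurable
    rw [← lintegral_prod_eq] at ha
    obtain ⟨k, hk⟩ := exists_eventually_lt_lintegral_min hlsc (P.prod P) ha
    have prod_continuous : Continuous fun Q : ProbabilityMeasure X => Q.prod Q :=
      ProbabilityMeasure.continuous_prod.comp (continuous_id.prodMk continuous_id)
    exact ⟨a, k, (prod_continuous.continuousAt.eventually hk).mono fun Q hQ => hQ.le, h⟩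

theorem exists_test_of_lt_refFreeEnergy {γ : ℝ} (hγ : 0 ≤ γ) {m : Measure X}
    [IsProbabilityMeasure m] {g : X → X → ℝ≥0∞}
    (hlsc : LowerSemicontinuous fun q : X × X => g q.1 q.2) {P : ProbabilityMeasure X} {F : ℝ}
    (hF : ENNReal.ofReal F < refFreeEnergy γ g m P) :
    ∃ (a : ℝ≥0) (k : ℕ) (f : X →ᵇ ℝ) (w : ℝ),
      (∀ᶠ Q : ProbabilityMeasure X in 𝓝 P,
        (a : ℝ≥0∞) ≤ ∫⁻ q, min (g q.1 q.2) k ∂((Q : Measure X).prod (Q : Measure X)) ∧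
          w ≤ ∫ x, f x ∂(Q : Measure X)) ∧
      F < γ / 2 * a + w + 1 - ∫ x, Real.exp (f x) ∂m := by
  obtain ⟨a, k, energy_ge, F_lt⟩ := exists_eventually_le_energy hlsc ENNReal.ofReal_ne_top P hF
  have entropy_gt : F - γ / 2 * a < 0 ∨
      ENNReal.ofReal (F - γ / 2 * a) < klDiv (P : Measure X) m := by
    refine (lt_or_ge _ 0).imp_right fun h => ?_
    rw [← add_sub_cancel (γ / 2 * a) F, ENNReal.ofReal_add (by positivity) h,
      ENNReal.ofReal_mul (by positivity), ENNReal.ofReal_coe_nnreal] at F_lt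
    exact lt_of_add_lt_add_left F_lt
  obtain ⟨f, hf⟩ := exists_boundedContinuous_lt_of_lt_klDiv m (P : Measure X) entropy_gt
  obtain ⟨w, w_gt, w_lt⟩ : ∃ w, F - γ / 2 * a + (∫ x, Real.exp (f x) ∂m - 1) < w ∧
      w < ∫ x, f x ∂(P : Measure X) := exists_between (by linarith)
  have integral_continuous : Continuous fun Q : ProbabilityMeasure X => ∫ x, f x ∂(Q : Measure X) :=
    ProbabilityMeasure.continuous_integral_boundedContinuousFunction f
  have integral_ge : ∀ᶠ Q : ProbabilityMeasure X in 𝓝 P, w ≤ ∫ x, f x ∂(Q : Measure X) :=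
    (integral_continuous.continuousAt.eventually_const_lt w_lt).mono fun _ h => h.le
  exact ⟨a, k, f, w, energy_ge.and integral_ge, by linarith⟩

theorem tendsto_gasProb_empirical_mem {γ : ℝ} (hγ : 0 ≤ γ) {m : Measure X}
    [IsProbabilityMeasure m] {g : X → X → ℝ≥0∞} (hg : ∀ u x, g u x = g x u)
    (hlsc : LowerSemicontinuous fun q : X × X => g q.1 q.2) {μ : ProbabilityMeasure X}
    (hI : ∫⁻ y, ∫⁻ z, g y z ∂(μ : Measure X) ∂(μ : Measure X) ≠ ∞)
    (hH : klDiv (μ : Measure X) m ≠ ∞)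
    {b : ℕ → ℝ≥0} (hb : Tendsto (fun N => ((N + 1 : ℕ) : ℝ) * b N) atTop (𝓝 γ))
    {P : ProbabilityMeasure X} (hlt : refFreeEnergy γ g m μ < refFreeEnergy γ g m P) :
    ∃ B ∈ 𝓝 P, Tendsto (fun N => gasProb m g (b N) (N + 1) {x | empirical x ∈ B}) atTop (𝓝 0) := by
  set I := (∫⁻ y, ∫⁻ z, g y z ∂(μ : Measure X) ∂(μ : Measure X)).toReal
  set H := (klDiv (μ : Measure X) m).toReal
  have refFreeEnergy_eq : refFreeEnergy γ g m μ = ENNReal.ofReal (γ / 2 * I + H) := by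
    rw [refFreeEnergy, ENNReal.ofReal_add (by positivity) (by positivity),
      ENNReal.ofReal_mul (by positivity), ENNReal.ofReal_toReal hI, ENNReal.ofReal_toReal hH]
  rw [refFreeEnergy_eq] at hlt
  obtain ⟨a, k, f, w, hB, test_lt⟩ := exists_test_of_lt_refFreeEnergy hγ hlsc hlt
  have hb0 : Tendsto (fun N => (b N : ℝ)) atTop (𝓝 0) := tendsto_zero_of_tendsto_succ_mul hb
  have exponent_tendsto := ((((((hb.mul_const (a : ℝ)).sub (hb0.mul_const (k : ℝ))).div_const
    2).neg.sub_const w).add_const (∫ z, Real.exp (f z) ∂m - 1)).add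
      (((hb.sub hb0).div_const 2).mul_const I)).add_const H
  refine ⟨_, hB, tendsto_of_tendsto_of_tendsto_of_le_of_le tendsto_const_nhds
    (tendsto_ofReal_exp_mul_zero ?_ exponent_tendsto) (fun _ => zero_le)
    fun N => gasProb_empirical_mem_le hlsc.measurable hg hI hH (b N) N a k f w⟩
  linarith

end LocalLargeDeviations

/-! ### Law of large numbers for the empirical measure -/

section MeanEmpirical

variable {X : Type*} [MeasurableSpace X]

theorem measurable_lintegral_empirical {N : ℕ} {F : X → ℝ≥0∞} (hF : Measurable F) :
    Measurable fun x : Fin (N + 1) → X => ∫⁻ z, F z ∂(empirical x : Measure X) := by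
  simp_rw [lintegral_empirical _ hF]
  fun_prop

theorem lintegral_gasProb_empirical_le (m : Measure X) [IsProbabilityMeasure m]
    {g : X → X → ℝ≥0∞} (hgm : Measurable (Function.uncurry g)) (hg : ∀ u x, g u x = g x u)
    {G : ℝ≥0∞} (hGt : G ≠ ∞) (hG : ∀ y, ∫⁻ x, g y x ∂m ≤ G) {b : ℝ≥0} {N : ℕ} {B : ℝ≥0}
    (hB : b * (N + 1 : ℕ) ≤ B) {F : X → ℝ≥0∞} (hF : Measurable F) :
    ∫⁻ x, ∫⁻ z, F z ∂(empirical x : Measure X) ∂(gasProb m g b (N + 1)) ≤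
      (expNeg (B * G))⁻¹ * ∫⁻ z, F z ∂m := by
  simp_rw [lintegral_empirical _ hF]
  rw [lintegral_const_mul' _ _ (by simp), lintegral_finsetSum _ fun j _ =>
    (show Measurable fun x : Fin (N + 1) → X => F (x j) from hF.comp (measurable_pi_apply j))]
  calc ((N + 1 : ℕ) : ℝ≥0∞)⁻¹ * ∑ j, ∫⁻ x, F (x j) ∂(gasProb m g b (N + 1))
      ≤ ((N + 1 : ℕ) : ℝ≥0∞)⁻¹ * ∑ _j : Fin (N + 1), (expNeg (B * G))⁻¹ * ∫⁻ z, F z ∂m := by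
        gcongr with j
        exact lintegral_gasProb_eval_le m hgm hg hGt hG hB j hF
    _ = _ := by
        rw [Finset.sum_const, Finset.card_univ, Fintype.card_fin, nsmul_eq_mul, ← mul_assoc,
          ENNReal.inv_mul_cancel (by simp) (by simp), one_mul]

theorem gasProb_le_empirical_apply_le (m : Measure X) [IsProbabilityMeasure m]
    {g : X → X → ℝ≥0∞} (hgm : Measurable (Function.uncurry g)) (hg : ∀ u x, g u x = g x u)
    {G : ℝ≥0∞} (hGt : G ≠ ∞) (hG : ∀ y, ∫⁻ x, g y x ∂m ≤ G) {b : ℝ≥0} {N : ℕ} {B : ℝ≥0}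
    (hB : b * (N + 1 : ℕ) ≤ B) {S : Set X} (hS : MeasurableSet S) {u : ℝ≥0∞} (hu : u ≠ 0)
    (hut : u ≠ ∞) :
    gasProb m g b (N + 1) {x | u ≤ (empirical x : Measure X) S} ≤
      (expNeg (B * G))⁻¹ * m S / u := by
  have indicator_measurable : Measurable (S.indicator fun _ => (1 : ℝ≥0∞)) :=
    measurable_const.indicator hS
  have lintegral_indicator (Q : Measure X) : ∫⁻ z, S.indicator (fun _ => 1) z ∂Q = Q S :=
    lintegral_indicator_one hS
  have mean_le := lintegral_gasProb_empirical_le m hgm hg hGt hG hB indicator_measurable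
  have apply_measurable := measurable_lintegral_empirical (N := N) indicator_measurable
  simp_rw [lintegral_indicator] at mean_le apply_measurable
  refine (meas_ge_le_lintegral_div apply_measurable.aemeasurable hu hut).trans ?_
  gcongr

end MeanEmpirical

section LawOfLargeNumbers

variable {X : Type*} [MeasurableSpace X] [MetricSpace X] [SecondCountableTopology X]
  [BorelSpace X] [CompleteSpace X]

theorem exists_isCompact_gasProb_le (m : Measure X) [IsProbabilityMeasure m]
    {g : X → X → ℝ≥0∞} (hgm : Measurable (Function.uncurry g)) (hg : ∀ u x, g u x = g x u)
    {G : ℝ≥0∞} (hGt : G ≠ ∞) (hG : ∀ y, ∫⁻ x, g y x ∂m ≤ G) {b : ℕ → ℝ≥0} {B : ℝ≥0}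
    (hB : ∀ N, b N * (N + 1 : ℕ) ≤ B) {η : ℝ≥0∞} (hη : η ≠ 0) :
    ∃ 𝒦 : Set (ProbabilityMeasure X), IsCompact 𝒦 ∧
      ∀ N, gasProb m g (b N) (N + 1) {x | empirical x ∉ 𝒦} ≤ η := by
  set C := (expNeg (B * G))⁻¹
  have C_ne_zero : C ≠ 0 := ENNReal.inv_ne_zero.2 (expNeg_ne_top _)
  have C_ne_top : C ≠ ∞ :=
    ENNReal.inv_ne_top.2 (expNeg_pos (ENNReal.mul_ne_top (by simp) hGt)).ne'
  obtain ⟨ε, ε_pos, tsum_ε_lt⟩ := ENNReal.exists_pos_sum_of_countable hη ℕ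
  obtain ⟨u, -, u_pos, u_lim⟩ : ∃ u : ℕ → ℝ≥0, StrictAnti u ∧ (∀ n, 0 < u n) ∧
      Tendsto u atTop (𝓝 0) := exists_seq_strictAnti_tendsto 0
  have u_ne_zero (n : ℕ) : (u n : ℝ≥0∞) ≠ 0 := by simpa using (u_pos n).ne'
  have exists_compact (n : ℕ) : ∃ K : Set X, IsCompact K ∧ m Kᶜ ≤ u n * ε n / C := by
    obtain ⟨K, K_compact, measure_le⟩ := isTightMeasureSet_iff_exists_isCompact_measure_compl_le.1
      (isTightMeasureSet_singleton (μ := m)) (u n * ε n / C)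
      (ENNReal.div_pos (mul_ne_zero (u_ne_zero n) (by simpa using (ε_pos n).ne')) C_ne_top)
    exact ⟨K, K_compact, measure_le m rfl⟩
  choose K K_compact measure_K_le using exists_compact
  refine ⟨{μ : ProbabilityMeasure X | ∀ n, μ (K n)ᶜ ≤ u n},
    isCompact_setOfPred_probabilityMeasure_mass_eq_compl_isCompact_le u_lim K_compact
      (Or.inl inferInstance), fun N => ?_⟩
  have notMem_subset : {x : Fin (N + 1) → X | empirical x ∉ {μ : ProbabilityMeasure X |
      ∀ n, μ (K n)ᶜ ≤ u n}} ⊆ ⋃ n, {x | (u n : ℝ≥0∞) ≤ (empirical x : Measure X) (K n)ᶜ} := by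
    intro x hx
    obtain ⟨n, hn⟩ : ∃ n, u n < (empirical x) (K n)ᶜ := by
      by_contra! h
      exact hx h
    refine Set.mem_iUnion.2 ⟨n, ?_⟩
    rw [Set.mem_ofPred_eq, ← ProbabilityMeasure.ennreal_coeFn_eq_coeFn_toMeasure]
    exact_mod_cast hn.le
  refine (measure_mono notMem_subset).trans ((measure_iUnion_le _).trans
    ((ENNReal.tsum_le_tsum fun n => ?_).trans tsum_ε_lt.le))
  calc gasProb m g (b N) (N + 1) {x | (u n : ℝ≥0∞) ≤ (empirical x : Measure X) (K n)ᶜ}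
      ≤ C * m (K n)ᶜ / u n := gasProb_le_empirical_apply_le m hgm hg hGt hG (hB N)
        (K_compact n).measurableSet.compl (u_ne_zero n) ENNReal.coe_ne_top
    _ ≤ C * (u n * ε n / C) / u n := by gcongr; exact measure_K_le n
    _ = ε n := by
        rw [ENNReal.mul_div_cancel C_ne_zero C_ne_top, mul_comm,
          ENNReal.mul_div_cancel_right (u_ne_zero n) ENNReal.coe_ne_top]

omit [CompleteSpace X] in
theorem tendsto_gasProb_empirical_mem_of_isCompact {γ : ℝ} (hγ : 0 ≤ γ) {m : Measure X}
    [IsProbabilityMeasure m] {g : X → X → ℝ≥0∞} (hg : ∀ u x, g u x = g x u)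
    (hlsc : LowerSemicontinuous fun q : X × X => g q.1 q.2) {μ : ProbabilityMeasure X}
    (hI : ∫⁻ y, ∫⁻ z, g y z ∂(μ : Measure X) ∂(μ : Measure X) ≠ ∞)
    (hH : klDiv (μ : Measure X) m ≠ ∞)
    {b : ℕ → ℝ≥0} (hb : Tendsto (fun N => ((N + 1 : ℕ) : ℝ) * b N) atTop (𝓝 γ))
    {𝒦 : Set (ProbabilityMeasure X)} (h𝒦 : IsCompact 𝒦)
    (hlt : ∀ P ∈ 𝒦, refFreeEnergy γ g m μ < refFreeEnergy γ g m P) :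
    Tendsto (fun N => gasProb m g (b N) (N + 1) {x | empirical x ∈ 𝒦}) atTop (𝓝 0) := by
  refine h𝒦.induction_on (p := fun S =>
    Tendsto (fun N => gasProb m g (b N) (N + 1) {x | empirical x ∈ S}) atTop (𝓝 0)) ?_ ?_ ?_ ?_
  · simp
  · intro S T hST hT
    exact tendsto_of_tendsto_of_tendsto_of_le_of_le tendsto_const_nhds hT (fun _ => zero_le)
      fun N => measure_mono fun x hx => hST hx
  · intro S T hS hT
    have sum_tendsto := hS.add hT
    rw [add_zero] at sum_tendsto
    exact tendsto_of_tendsto_of_tendsto_of_le_of_le tendsto_const_nhds sum_tendsto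
      (fun _ => zero_le) fun N => measure_union_le _ _
  · intro P hP
    obtain ⟨B, hB, B_tendsto⟩ := tendsto_gasProb_empirical_mem hγ hg hlsc hI hH hb (hlt P hP)
    exact ⟨B, mem_nhdsWithin_of_mem_nhds hB, B_tendsto⟩

theorem exists_mul_le_of_tendsto {γ : ℝ} {b : ℕ → ℝ≥0}
    (hb : Tendsto (fun N => ((N + 1 : ℕ) : ℝ) * b N) atTop (𝓝 γ)) :
    ∃ B : ℝ≥0, ∀ N, b N * (N + 1 : ℕ) ≤ B := by
  obtain ⟨B, hB⟩ := hb.bddAbove_range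
  refine ⟨B.toNNReal, fun N => NNReal.coe_le_coe.1 ?_⟩
  rw [NNReal.coe_mul, NNReal.coe_natCast, mul_comm]
  exact (hB ⟨N, rfl⟩).trans (Real.le_coe_toNNReal B)

theorem tendsto_gasProb_empirical_notMem {γ : ℝ} (hγ : 0 ≤ γ) {m : Measure X}
    [IsProbabilityMeasure m] {g : X → X → ℝ≥0∞} (hg : ∀ u x, g u x = g x u)
    (hlsc : LowerSemicontinuous fun q : X × X => g q.1 q.2)
    {G : ℝ≥0∞} (hGt : G ≠ ∞) (hG : ∀ y, ∫⁻ x, g y x ∂m ≤ G) {μ : ProbabilityMeasure X}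
    (hI : ∫⁻ y, ∫⁻ z, g y z ∂(μ : Measure X) ∂(μ : Measure X) ≠ ∞)
    (hH : klDiv (μ : Measure X) m ≠ ∞)
    (hmin : ∀ P : ProbabilityMeasure X, P ≠ μ → refFreeEnergy γ g m μ < refFreeEnergy γ g m P)
    {b : ℕ → ℝ≥0} (hb : Tendsto (fun N => ((N + 1 : ℕ) : ℝ) * b N) atTop (𝓝 γ))
    {O : Set (ProbabilityMeasure X)} (hO : O ∈ 𝓝 μ) :
    Tendsto (fun N => gasProb m g (b N) (N + 1) {x | empirical x ∉ O}) atTop (𝓝 0) := by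
  obtain ⟨B, hB⟩ := exists_mul_le_of_tendsto hb
  obtain ⟨U, U_subset, U_open, mem_U⟩ := mem_nhds_iff.1 hO
  refine ENNReal.tendsto_nhds_zero.2 fun ε hε => ?_
  have half_pos : 0 < ε / 2 := ENNReal.half_pos hε.ne'
  obtain ⟨𝒦, 𝒦_compact, 𝒦_compl_le⟩ :=
    exists_isCompact_gasProb_le m hlsc.measurable hg hGt hG hB half_pos.ne'
  have diff_tendsto := tendsto_gasProb_empirical_mem_of_isCompact hγ hg hlsc hI hH hb
    (𝒦_compact.diff U_open) fun P hP => hmin P fun h => hP.2 (h ▸ mem_U)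
  filter_upwards [ENNReal.tendsto_nhds_zero.1 diff_tendsto (ε / 2) half_pos] with N diff_le
  calc gasProb m g (b N) (N + 1) {x | empirical x ∉ O}
      ≤ gasProb m g (b N) (N + 1) ({x | empirical x ∈ 𝒦 \ U} ∪ {x | empirical x ∉ 𝒦}) := by
        refine measure_mono fun x hx => ?_
        by_cases h : empirical x ∈ 𝒦
        · exact .inl ⟨h, fun h' => hx (U_subset h')⟩
        · exact .inr h
    _ ≤ ε / 2 + ε / 2 := (measure_union_le _ _).trans (add_le_add diff_le (𝒦_compl_le N))
    _ = ε := ENNReal.add_halves ε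

theorem lintegral_ofReal_abs_le {Ω : Type*} [MeasurableSpace Ω] {Q : Measure Ω}
    [IsProbabilityMeasure Q] {Y : Ω → ℝ} (hY : Measurable Y) {C : ℝ} (hC : ∀ ω, |Y ω| ≤ C)
    (δ : ℝ) :
    ∫⁻ ω, ENNReal.ofReal |Y ω| ∂Q ≤
      ENNReal.ofReal δ + ENNReal.ofReal C * Q {ω | δ ≤ |Y ω|} := by
  have abs_le (ω : Ω) : ENNReal.ofReal |Y ω| ≤ ENNReal.ofReal δ +
      {ω | δ ≤ |Y ω|}.indicator (fun _ => ENNReal.ofReal C) ω := by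
    rcases lt_or_ge |Y ω| δ with h | h
    · exact (ENNReal.ofReal_le_ofReal h.le).trans le_self_add
    · rw [Set.indicator_of_mem (by exact h)]
      exact (ENNReal.ofReal_le_ofReal (hC ω)).trans le_add_self
  refine (lintegral_mono abs_le).trans_eq ?_
  rw [lintegral_add_left measurable_const,
    lintegral_indicator_const (measurableSet_le measurable_const hY.abs)]
  simp

theorem tendsto_lintegral_ofReal_abs_zero {Ω : ℕ → Type*} [∀ N, MeasurableSpace (Ω N)]
    {Q : ∀ N, Measure (Ω N)} [∀ N, IsProbabilityMeasure (Q N)] {Y : ∀ N, Ω N → ℝ}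
    (hY : ∀ N, Measurable (Y N)) {C : ℝ} (hC : ∀ N ω, |Y N ω| ≤ C)
    (hQ : ∀ δ > 0, Tendsto (fun N => Q N {ω | δ ≤ |Y N ω|}) atTop (𝓝 0)) :
    Tendsto (fun N => ∫⁻ ω, ENNReal.ofReal |Y N ω| ∂(Q N)) atTop (𝓝 0) := by
  refine ENNReal.tendsto_nhds_zero.2 fun ε hε => ?_
  obtain ⟨δ, δ_pos, δ_lt⟩ : ∃ δ : ℝ≥0, 0 < (δ : ℝ≥0∞) ∧ δ < ε :=
    ENNReal.lt_iff_exists_nnreal_btwn.1 hε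
  have bound_tendsto : Tendsto (fun N => ENNReal.ofReal δ + ENNReal.ofReal C *
      Q N {ω | (δ : ℝ) ≤ |Y N ω|}) atTop (𝓝 (ENNReal.ofReal δ)) := by
    simpa using (ENNReal.Tendsto.const_mul (hQ δ (by exact_mod_cast δ_pos))
      (.inr ENNReal.ofReal_ne_top)).const_add (ENNReal.ofReal δ)
  filter_upwards [bound_tendsto.eventually_lt_const (by simpa using δ_lt)] with N bound_lt
  exact (lintegral_ofReal_abs_le (hY N) (hC N) δ).trans bound_lt.le

theorem tendsto_lintegral_gasProb_abs_sub {γ : ℝ} (hγ : 0 ≤ γ) {m : Measure X}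
    [IsProbabilityMeasure m] {g : X → X → ℝ≥0∞} (hg : ∀ u x, g u x = g x u)
    (hlsc : LowerSemicontinuous fun q : X × X => g q.1 q.2)
    {G : ℝ≥0∞} (hGt : G ≠ ∞) (hG : ∀ y, ∫⁻ x, g y x ∂m ≤ G) {μ : ProbabilityMeasure X}
    (hI : ∫⁻ y, ∫⁻ z, g y z ∂(μ : Measure X) ∂(μ : Measure X) ≠ ∞)
    (hH : klDiv (μ : Measure X) m ≠ ∞)
    (hmin : ∀ P : ProbabilityMeasure X, P ≠ μ → refFreeEnergy γ g m μ < refFreeEnergy γ g m P)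
    {b : ℕ → ℝ≥0} (hb : Tendsto (fun N => ((N + 1 : ℕ) : ℝ) * b N) atTop (𝓝 γ))
    (f : X →ᵇ ℝ) :
    Tendsto (fun N => ∫⁻ x, ENNReal.ofReal |∫ z, f z ∂(empirical x : Measure X) -
      ∫ z, f z ∂(μ : Measure X)| ∂(gasProb m g (b N) (N + 1))) atTop (𝓝 0) := by
  have (N : ℕ) := isProbabilityMeasure_gasProb m hlsc.measurable hg hGt hG (b N) (N + 1)
  have integral_continuous : Continuous fun P : ProbabilityMeasure X =>
      |∫ z, f z ∂(P : Measure X) - ∫ z, f z ∂(μ : Measure X)| :=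
    ((ProbabilityMeasure.continuous_integral_boundedContinuousFunction f).sub continuous_const).abs
  have integral_measurable (N : ℕ) : Measurable fun x : Fin (N + 1) → X =>
      ∫ z, f z ∂(empirical x : Measure X) - ∫ z, f z ∂(μ : Measure X) := by
    have := f.continuous.measurable
    simp_rw [integral_empirical _ this]
    fun_prop
  have abs_integral_le (P : ProbabilityMeasure X) : |∫ z, f z ∂(P : Measure X)| ≤ ‖f‖ :=
    f.norm_integral_le_norm (P : Measure X)
  refine tendsto_lintegral_ofReal_abs_zero integral_measurable (C := ‖f‖ + ‖f‖) (fun N x =>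
    (abs_sub _ _).trans (add_le_add (abs_integral_le _) (abs_integral_le μ))) fun δ hδ => ?_
  have ball_mem : {P : ProbabilityMeasure X |
      |∫ z, f z ∂(P : Measure X) - ∫ z, f z ∂(μ : Measure X)| < δ} ∈ 𝓝 μ :=
    (isOpen_lt integral_continuous continuous_const).mem_nhds (by simpa using hδ)
  simpa using tendsto_gasProb_empirical_notMem hγ hg hlsc hGt hG hI hH hmin hb ball_mem

end LawOfLargeNumbers

/-! ### Convergence of the potential felt by an inserted particle -/

section ApproxKernel

variable {X : Type*} [MeasurableSpace X] [TopologicalSpace X]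

/-- The kernel `g` is approximated from below, in `L¹(m)` in its second variable and uniformly in
its first one, by bounded continuous kernels which vanish at infinity in the first variable. The
decomposition `g = g_k + g^k` of the theorem provides such approximations. -/
def IsApproxKernel (g : X → X → ℝ≥0∞) (m : Measure X) : Prop :=
  ∀ ε : ℝ≥0, 0 < ε → ∃ (k : ℝ≥0) (q : X → X → ℝ≥0), Continuous (Function.uncurry q) ∧
    (∀ u x, q u x ≤ k) ∧ (∀ u x, (q u x : ℝ≥0∞) ≤ g u x) ∧
    (∀ u, ∫⁻ x, (g u x - q u x) ∂m ≤ ε) ∧ ∀ x, Tendsto (fun u => q u x) (cocompact X) (𝓝 0)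

theorem IsApproxKernel.exists_boundedContinuous_le {g : X → X → ℝ≥0∞} {m : Measure X}
    (h : IsApproxKernel g m) {ε : ℝ≥0} (hε : 0 < ε) (u : X) :
    ∃ q : X →ᵇ ℝ≥0, (∀ x, (q x : ℝ≥0∞) ≤ g u x) ∧ ∫⁻ x, (g u x - q x) ∂m ≤ ε := by
  obtain ⟨k, q, q_continuous, q_le, q_le_g, lintegral_le, -⟩ := h ε hε
  have dist_le (x y : X) : dist (q u x) (q u y) ≤ k :=
    abs_sub_le_of_nonneg_of_le (q u x).coe_nonneg (q_le u x) (q u y).coe_nonneg (q_le u y)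
  exact ⟨.mkOfBound ⟨q u, q_continuous.comp (Continuous.prodMk_right u)⟩ k dist_le, q_le_g u,
    lintegral_le u⟩

variable [OpensMeasurableSpace X]

theorem lintegral_le_lintegral_coe_add {φ : X → ℝ≥0∞} {q : X → ℝ≥0} (hq : Continuous q)
    (m : Measure X) : ∫⁻ x, φ x ∂m ≤ ∫⁻ x, q x ∂m + ∫⁻ x, (φ x - q x) ∂m :=
  tsub_le_iff_left.1 (lintegral_sub_le _ _ hq.measurable.coe_nnreal_ennreal)

theorem IsApproxKernel.exists_lintegral_le {g : X → X → ℝ≥0∞} {m : Measure X}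
    [IsProbabilityMeasure m] (h : IsApproxKernel g m) : ∃ G : ℝ≥0, ∀ u, ∫⁻ x, g u x ∂m ≤ G := by
  obtain ⟨k, q, q_continuous, q_le, -, lintegral_le, -⟩ := h 1 one_pos
  refine ⟨k + 1, fun u => (lintegral_le_lintegral_coe_add
    (q_continuous.comp (Continuous.prodMk_right u)) m).trans ?_⟩
  rw [ENNReal.coe_add]
  refine add_le_add ((lintegral_mono fun x => ENNReal.coe_le_coe.2 (q_le u x)).trans_eq ?_)
    (lintegral_le u)
  rw [lintegral_const, measure_univ, mul_one]

theorem IsApproxKernel.tendsto_lintegral_cocompact {g : X → X → ℝ≥0∞} {m : Measure X}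
    [(cocompact X).IsCountablyGenerated] [IsProbabilityMeasure m] (h : IsApproxKernel g m) :
    Tendsto (fun u => ∫⁻ x, g u x ∂m) (cocompact X) (𝓝 0) := by
  refine ENNReal.tendsto_nhds_zero.2 fun ε hε => ?_
  have half_pos : 0 < ε / 2 := ENNReal.half_pos hε.ne'
  obtain ⟨δ, δ_pos, δ_lt⟩ : ∃ δ : ℝ≥0, 0 < (δ : ℝ≥0∞) ∧ δ < ε / 2 :=
    ENNReal.lt_iff_exists_nnreal_btwn.1 half_pos
  obtain ⟨k, q, q_continuous, q_le, -, lintegral_le, q_tendsto⟩ := h δ (by exact_mod_cast δ_pos)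
  have q_section_continuous (u : X) : Continuous (q u) :=
    q_continuous.comp (Continuous.prodMk_right u)
  have lintegral_tendsto :
      Tendsto (fun u => ∫⁻ x, (q u x : ℝ≥0∞) ∂m) (cocompact X) (𝓝 (∫⁻ _, 0 ∂m)) :=
    tendsto_lintegral_filter_of_dominated_convergence (fun _ => (k : ℝ≥0∞))
      (.of_forall fun u => (q_section_continuous u).measurable.coe_nnreal_ennreal)
      (.of_forall fun u => ae_of_all _ fun x => ENNReal.coe_le_coe.2 (q_le u x)) (by simp)
      (ae_of_all _ fun x => by simpa using ENNReal.tendsto_coe.2 (q_tendsto x))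
  rw [lintegral_zero] at lintegral_tendsto
  filter_upwards [ENNReal.tendsto_nhds_zero.1 lintegral_tendsto (ε / 2) half_pos] with u hu
  exact ((lintegral_le_lintegral_coe_add (q_section_continuous u) m).trans
    (add_le_add hu ((lintegral_le u).trans δ_lt.le))).trans_eq (ENNReal.add_halves ε)

end ApproxKernel

section ExpDifference

theorem ofReal_abs_expNeg_sub_le {a a' d : ℝ≥0∞} (le : a' ≤ a) (le_add : a ≤ a' + d) :
    ENNReal.ofReal |(expNeg a).toReal - (expNeg a').toReal| ≤ d := by
  rw [abs_sub_comm, abs_of_nonneg (sub_nonneg.2 (ENNReal.toReal_mono (expNeg_ne_top _)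
      (expNeg_antitone le))),
    ENNReal.ofReal_sub _ ENNReal.toReal_nonneg, ENNReal.ofReal_toReal (expNeg_ne_top _),
    ENNReal.ofReal_toReal (expNeg_ne_top _), tsub_le_iff_left]
  exact (expNeg_le_add a' d).trans (add_le_add_left (expNeg_antitone le_add) d)

theorem abs_exp_neg_sub_exp_neg_le {s t : ℝ} (hs : 0 ≤ s) (ht : 0 ≤ t) :
    |Real.exp (-s) - Real.exp (-t)| ≤ |s - t| := by
  have := abs_exp_sub_exp_le (R := 0) (neg_nonpos.2 hs) (neg_nonpos.2 ht)
  rw [Real.exp_zero, one_mul] at this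
  rwa [show -s - -t = -(s - t) by ring, abs_neg] at this

theorem abs_exp_neg_mul_sub_le {s γ A A' B k : ℝ} (hs : 0 ≤ s) (hsB : s ≤ B) (hγ : 0 ≤ γ)
    (hA : 0 ≤ A) (hA' : 0 ≤ A') (hA'k : A' ≤ k) :
    |Real.exp (-(s * A)) - Real.exp (-(γ * A'))| ≤ |s - γ| * k + B * |A - A'| :=
  calc |Real.exp (-(s * A)) - Real.exp (-(γ * A'))|
      ≤ |s * A - γ * A'| := abs_exp_neg_sub_exp_neg_le (by positivity) (by positivity)
    _ = |(s - γ) * A' + s * (A - A')| := by ring_nf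
    _ ≤ |s - γ| * |A'| + |s| * |A - A'| := by
        rw [← abs_mul, ← abs_mul]
        exact abs_add_le _ _
    _ ≤ |s - γ| * k + B * |A - A'| := by
        rw [abs_of_nonneg hA', abs_of_nonneg hs]
        gcongr

theorem ofReal_abs_sub_le_add_add (r s t u : ℝ) :
    ENNReal.ofReal |r - u| ≤
      ENNReal.ofReal |r - s| + ENNReal.ofReal |s - t| + ENNReal.ofReal |u - t| := by
  rw [← ENNReal.ofReal_add (by positivity) (by positivity),
    ← ENNReal.ofReal_add (by positivity) (by positivity), abs_sub_comm u t]
  exact ENNReal.ofReal_le_ofReal (by linarith [abs_sub_le r s u, abs_sub_le s t u])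

theorem ofReal_abs_expNeg_lintegral_sub_le {X : Type*} [MeasurableSpace X] {φ q : X → ℝ≥0∞}
    (hq : Measurable q) (hqφ : q ≤ φ) {μ m : Measure X} {C : ℝ≥0∞} (hμ : μ ≤ C • m) {c B : ℝ≥0∞}
    (hc : c ≤ B) :
    ENNReal.ofReal |(expNeg (c * ∫⁻ z, φ z ∂μ)).toReal - (expNeg (c * ∫⁻ z, q z ∂μ)).toReal| ≤
      B * (C * ∫⁻ z, (φ z - q z) ∂m) := by
  refine (ofReal_abs_expNeg_sub_le (d := c * ∫⁻ z, (φ z - q z) ∂μ) ?_ ?_).trans ?_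
  · gcongr with z
    exact hqφ z
  · rw [← mul_add, ← lintegral_add_left hq]
    gcongr with z
    exact le_add_tsub
  · rw [← smul_eq_mul C, ← lintegral_smul_measure]
    gcongr

end ExpDifference

section Domination

variable {X : Type*} [MeasurableSpace X] [MetricSpace X] [SecondCountableTopology X]
  [BorelSpace X]

theorem le_smul_of_forall_lintegral_le {μ m : Measure X} [IsFiniteMeasure μ] [IsFiniteMeasure m]
    {C : ℝ≥0∞} (hC : C ≠ ∞)
    (h : ∀ f : X →ᵇ ℝ≥0, ∫⁻ x, f x ∂μ ≤ C * ∫⁻ x, f x ∂m) : μ ≤ C • m := by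
  have lintegral_thickened_tendsto (ν : Measure X) [IsFiniteMeasure ν] {F : Set X}
      (hF : IsClosed F) :=
    tendsto_lintegral_thickenedIndicator_of_isClosed ν hF
      (δs := fun n : ℕ => 1 / ((n : ℝ) + 1)) (fun n => by positivity)
      tendsto_one_div_add_atTop_nhds_zero_nat
  have closed_le {F : Set X} (hF : IsClosed F) : μ F ≤ C * m F :=
    le_of_tendsto_of_tendsto' (lintegral_thickened_tendsto μ hF)
      (ENNReal.Tendsto.const_mul (lintegral_thickened_tendsto m hF) (.inr hC)) fun n => h _
  refine Measure.le_iff.2 fun s hs => ?_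
  rw [Measure.smul_apply, smul_eq_mul, hs.measure_eq_iSup_isClosed_of_ne_top (measure_ne_top _ _)]
  exact iSup₂_le fun F hF => iSup_le fun F_closed => (closed_le F_closed).trans (by gcongr)

end Domination

section SumBounds

variable {X : Type*} [MeasurableSpace X]

theorem lintegral_gasProb_sum_le (m : Measure X) [IsProbabilityMeasure m]
    {g : X → X → ℝ≥0∞} (hgm : Measurable (Function.uncurry g)) (hg : ∀ u x, g u x = g x u)
    {G : ℝ≥0∞} (hGt : G ≠ ∞) (hG : ∀ y, ∫⁻ x, g y x ∂m ≤ G) {b : ℝ≥0} {N : ℕ} {B : ℝ≥0}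
    (hB : b * N ≤ B) {F : X → ℝ≥0∞} (hF : Measurable F) :
    ∫⁻ x, b * ∑ j, F (x j) ∂(gasProb m g b N) ≤ B * ((expNeg (B * G))⁻¹ * ∫⁻ z, F z ∂m) := by
  rw [lintegral_const_mul' _ _ (by simp), lintegral_finsetSum _ fun j _ =>
    (show Measurable fun x : Fin N → X => F (x j) from hF.comp (measurable_pi_apply j))]
  calc (b : ℝ≥0∞) * ∑ j, ∫⁻ x, F (x j) ∂(gasProb m g b N)
      ≤ b * ∑ _j : Fin N, (expNeg (B * G))⁻¹ * ∫⁻ z, F z ∂m := by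
        gcongr with j
        exact lintegral_gasProb_eval_le m hgm hg hGt hG hB j hF
    _ = (b * N) * ((expNeg (B * G))⁻¹ * ∫⁻ z, F z ∂m) := by
        rw [Finset.sum_const, Finset.card_univ, Fintype.card_fin, nsmul_eq_mul, mul_assoc]
    _ ≤ _ := by
        gcongr
        exact_mod_cast hB

theorem lintegral_gasProb_one_sub_expNeg_le (m : Measure X) [IsProbabilityMeasure m]
    {g : X → X → ℝ≥0∞} (hgm : Measurable (Function.uncurry g)) (hg : ∀ u x, g u x = g x u)
    {G : ℝ≥0∞} (hGt : G ≠ ∞) (hG : ∀ y, ∫⁻ x, g y x ∂m ≤ G) {b : ℝ≥0} {N : ℕ} {B : ℝ≥0}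
    (hB : b * N ≤ B) (y : X) :
    ∫⁻ x, (1 - expNeg (b * ∑ j, g y (x j))) ∂(gasProb m g b N) ≤
      B * ((expNeg (B * G))⁻¹ * ∫⁻ z, g y z ∂m) :=
  (lintegral_mono fun _ => one_sub_expNeg_le _).trans
    (lintegral_gasProb_sum_le m hgm hg hGt hG hB (hgm.of_uncurry_left (x := y)))

end SumBounds

section PotentialComparison

variable {X : Type*} [MeasurableSpace X] [TopologicalSpace X] [OpensMeasurableSpace X]

theorem lintegral_coe_le_add_ofReal_abs (f : X →ᵇ ℝ≥0) (P Q : Measure X) [IsFiniteMeasure P]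
    [IsFiniteMeasure Q] :
    ∫⁻ x, f x ∂Q ≤
      ∫⁻ x, f x ∂P + ENNReal.ofReal |∫ x, (f x : ℝ) ∂P - ∫ x, (f x : ℝ) ∂Q| := by
  have lintegral_eq (ν : Measure X) [IsFiniteMeasure ν] :
      ∫⁻ x, f x ∂ν = ENNReal.ofReal (∫ x, (f x : ℝ) ∂ν) := by
    rw [← BoundedContinuousFunction.toReal_lintegral_coe_eq_integral,
      ENNReal.ofReal_toReal (BoundedContinuousFunction.lintegral_lt_top_of_nnreal ν f).ne]
  rw [lintegral_eq P, lintegral_eq Q,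
    ← ENNReal.ofReal_add (integral_nonneg fun x => (f x).coe_nonneg) (abs_nonneg _)]
  exact ENNReal.ofReal_le_ofReal (sub_le_iff_le_add'.1 (abs_sub_comm (α := ℝ) _ _ ▸ le_abs_self _))

theorem ofReal_abs_expNeg_sum_sub_le {γ : ℝ} (hγ : 0 ≤ γ) {b B : ℝ≥0} {N : ℕ}
    (hB : b * (N + 1 : ℕ) ≤ B) (q : X →ᵇ ℝ≥0) (μ : ProbabilityMeasure X) (x : Fin (N + 1) → X) :
    ENNReal.ofReal |(expNeg (b * ∑ j, (q (x j) : ℝ≥0∞))).toReal -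
        (expNeg (ENNReal.ofReal γ * ∫⁻ z, q z ∂(μ : Measure X))).toReal| ≤
      ENNReal.ofReal |((N + 1 : ℕ) : ℝ) * b - γ| * nndist q 0 + B * ENNReal.ofReal
        |∫ z, (q z : ℝ) ∂(empirical x : Measure X) - ∫ z, (q z : ℝ) ∂(μ : Measure X)| := by
  have sum_eq : ((b : ℝ≥0∞) * ∑ j, (q (x j) : ℝ≥0∞)).toReal =
      ((N + 1 : ℕ) : ℝ) * b * ∫ z, (q z : ℝ) ∂(empirical x : Measure X) := by
    rw [integral_empirical x q.continuous.measurable.coe_nnreal_real, ENNReal.toReal_mul,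
      ENNReal.toReal_sum (by simp)]
    simp only [ENNReal.coe_toReal]
    field_simp
  have lintegral_eq : (ENNReal.ofReal γ * ∫⁻ z, q z ∂(μ : Measure X)).toReal =
      γ * ∫ z, (q z : ℝ) ∂(μ : Measure X) := by
    rw [ENNReal.toReal_mul, ENNReal.toReal_ofReal hγ,
      BoundedContinuousFunction.toReal_lintegral_coe_eq_integral]
  have integral_le : ∫ z, (q z : ℝ) ∂(μ : Measure X) ≤ nndist q 0 := by
    have norm_le (z : X) : ‖(q z : ℝ)‖ ≤ nndist q 0 := by
      rw [NNReal.norm_eq]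
      exact_mod_cast BoundedContinuousFunction.NNReal.upper_bound q z
    simpa using (le_abs_self _).trans
      (norm_integral_le_of_norm_le_const (ae_of_all (μ : Measure X) norm_le))
  rw [toReal_expNeg (ENNReal.mul_ne_top (by simp) (by simp)),
    toReal_expNeg (ENNReal.mul_ne_top (by simp)
      (BoundedContinuousFunction.lintegral_lt_top_of_nnreal _ q).ne), sum_eq, lintegral_eq,
    ← ENNReal.ofReal_coe_nnreal (p := B), ← ENNReal.ofReal_coe_nnreal (p := nndist q 0),
    ← ENNReal.ofReal_mul (by positivity), ← ENNReal.ofReal_mul (by positivity),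
    ← ENNReal.ofReal_add (by positivity) (by positivity)]
  exact ENNReal.ofReal_le_ofReal (abs_exp_neg_mul_sub_le (by positivity)
    (by rw [mul_comm]; exact_mod_cast hB) hγ (integral_nonneg fun z => (q z).coe_nonneg)
    (integral_nonneg fun z => (q z).coe_nonneg) integral_le)

theorem lintegral_gasProb_abs_expNeg_sub_le {γ : ℝ} (hγ : 0 ≤ γ) {m : Measure X}
    [IsProbabilityMeasure m] {g : X → X → ℝ≥0∞} (hgm : Measurable (Function.uncurry g))
    (hg : ∀ u x, g u x = g x u) {G : ℝ≥0∞} (hGt : G ≠ ∞) (hG : ∀ y, ∫⁻ x, g y x ∂m ≤ G)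
    {b B : ℝ≥0} {N : ℕ} (hB : b * (N + 1 : ℕ) ≤ B) (hγB : ENNReal.ofReal γ ≤ B)
    {μ : ProbabilityMeasure X} (hμ : (μ : Measure X) ≤ (expNeg (B * G))⁻¹ • m)
    {φ : X → ℝ≥0∞} (hφ : Measurable φ) {q : X →ᵇ ℝ≥0} (hqφ : ∀ x, (q x : ℝ≥0∞) ≤ φ x) :
    ∫⁻ x, ENNReal.ofReal |(expNeg (b * ∑ j, φ (x j))).toReal -
        (expNeg (ENNReal.ofReal γ * ∫⁻ z, φ z ∂(μ : Measure X))).toReal|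
          ∂(gasProb m g b (N + 1)) ≤
      B * ((expNeg (B * G))⁻¹ * ∫⁻ z, (φ z - q z) ∂m) +
        (ENNReal.ofReal |((N + 1 : ℕ) : ℝ) * b - γ| * nndist q 0 + B * ∫⁻ x, ENNReal.ofReal
          |∫ z, (q z : ℝ) ∂(empirical x : Measure X) - ∫ z, (q z : ℝ) ∂(μ : Measure X)|
            ∂(gasProb m g b (N + 1))) +
        B * ((expNeg (B * G))⁻¹ * ∫⁻ z, (φ z - q z) ∂m) := by
  have := isProbabilityMeasure_gasProb m hgm hg hGt hG b (N + 1)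
  have q_measurable : Measurable fun x => (q x : ℝ≥0∞) :=
    q.continuous.measurable.coe_nnreal_ennreal
  have sub_measurable : Measurable fun x => φ x - q x := hφ.sub q_measurable
  have sum_measurable :
      Measurable fun x : Fin (N + 1) → X => (b : ℝ≥0∞) * ∑ j, (φ (x j) - q (x j)) := by
    fun_prop
  have expNeg_sum_sub_le (x : Fin (N + 1) → X) :
      ENNReal.ofReal |(expNeg (b * ∑ j, φ (x j))).toReal -
        (expNeg (b * ∑ j, (q (x j) : ℝ≥0∞))).toReal| ≤ b * ∑ j, (φ (x j) - q (x j)) := by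
    refine ofReal_abs_expNeg_sub_le ?_ ?_
    · gcongr with j
      exact hqφ _
    · rw [← mul_add, ← Finset.sum_add_distrib]
      gcongr with j
      exact le_add_tsub
  refine (lintegral_mono fun x => (ofReal_abs_sub_le_add_add _ _ _ _).trans
    (add_le_add (add_le_add (expNeg_sum_sub_le x) (ofReal_abs_expNeg_sum_sub_le hγ hB q μ x))
      (ofReal_abs_expNeg_lintegral_sub_le q_measurable hqφ hμ hγB))).trans ?_
  rw [lintegral_add_right _ measurable_const, lintegral_add_left sum_measurable,
    lintegral_add_left measurable_const, lintegral_const_mul' (B : ℝ≥0∞) _ (by simp)]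
  simp only [lintegral_const, measure_univ, mul_one]
  gcongr
  exact lintegral_gasProb_sum_le m hgm hg hGt hG hB sub_measurable

end PotentialComparison

section PotentialLimit

variable {X : Type*} [MeasurableSpace X] [MetricSpace X] [SecondCountableTopology X]
  [BorelSpace X]

theorem le_smul_of_tendsto_gasProb {m : Measure X} [IsProbabilityMeasure m] {g : X → X → ℝ≥0∞}
    (hgm : Measurable (Function.uncurry g)) (hg : ∀ u x, g u x = g x u)
    {G : ℝ≥0∞} (hGt : G ≠ ∞) (hG : ∀ y, ∫⁻ x, g y x ∂m ≤ G) {b : ℕ → ℝ≥0} {B : ℝ≥0}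
    (hB : ∀ N, b N * (N + 1 : ℕ) ≤ B) {μ : ProbabilityMeasure X}
    (hlln : ∀ f : X →ᵇ ℝ, Tendsto (fun N => ∫⁻ x, ENNReal.ofReal
      |∫ z, f z ∂(empirical x : Measure X) - ∫ z, f z ∂(μ : Measure X)|
        ∂(gasProb m g (b N) (N + 1))) atTop (𝓝 0)) :
    (μ : Measure X) ≤ (expNeg (B * G))⁻¹ • m := by
  refine le_smul_of_forall_lintegral_le
    (ENNReal.inv_ne_top.2 (expNeg_pos (ENNReal.mul_ne_top (by simp) hGt)).ne') fun f => ?_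
  have f_measurable : Measurable fun x => (f x : ℝ≥0∞) :=
    f.continuous.measurable.coe_nnreal_ennreal
  have lintegral_le (N : ℕ) : ∫⁻ x, f x ∂(μ : Measure X) ≤
      (expNeg (B * G))⁻¹ * ∫⁻ z, f z ∂m + ∫⁻ x, ENNReal.ofReal
        |∫ z, (f z : ℝ) ∂(empirical x : Measure X) - ∫ z, (f z : ℝ) ∂(μ : Measure X)|
          ∂(gasProb m g (b N) (N + 1)) := by
    have := isProbabilityMeasure_gasProb m hgm hg hGt hG (b N) (N + 1)
    calc ∫⁻ x, f x ∂(μ : Measure X)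
        = ∫⁻ _, (∫⁻ x, f x ∂(μ : Measure X)) ∂(gasProb m g (b N) (N + 1)) := by simp
      _ ≤ ∫⁻ x, (∫⁻ z, f z ∂(empirical x : Measure X) + ENNReal.ofReal
            |∫ z, (f z : ℝ) ∂(empirical x : Measure X) - ∫ z, (f z : ℝ) ∂(μ : Measure X)|)
            ∂(gasProb m g (b N) (N + 1)) :=
          lintegral_mono fun x => lintegral_coe_le_add_ofReal_abs f _ _
      _ = _ := lintegral_add_left (measurable_lintegral_empirical f_measurable) _
      _ ≤ _ := by
          gcongr
          exact lintegral_gasProb_empirical_le m hgm hg hGt hG (hB N) f_measurable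
  have bound_tendsto := (hlln (f.comp _ NNReal.isometry_coe.lipschitz)).const_add
    ((expNeg (B * G))⁻¹ * ∫⁻ z, f z ∂m)
  rw [add_zero] at bound_tendsto
  exact ge_of_tendsto' bound_tendsto lintegral_le

theorem tendsto_lintegral_gasProb_abs_expNeg_sub {γ : ℝ} (hγ : 0 ≤ γ) {m : Measure X}
    [IsProbabilityMeasure m] {g : X → X → ℝ≥0∞} (hgm : Measurable (Function.uncurry g))
    (hg : ∀ u x, g u x = g x u) (happ : IsApproxKernel g m) {μ : ProbabilityMeasure X}
    {b : ℕ → ℝ≥0} (hb : Tendsto (fun N => ((N + 1 : ℕ) : ℝ) * b N) atTop (𝓝 γ))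
    (hlln : ∀ f : X →ᵇ ℝ, Tendsto (fun N => ∫⁻ x, ENNReal.ofReal
      |∫ z, f z ∂(empirical x : Measure X) - ∫ z, f z ∂(μ : Measure X)|
        ∂(gasProb m g (b N) (N + 1))) atTop (𝓝 0)) (y : X) :
    Tendsto (fun N => ∫⁻ x, ENNReal.ofReal |(expNeg (b N * ∑ j, g y (x j))).toReal -
      (expNeg (ENNReal.ofReal γ * ∫⁻ z, g y z ∂(μ : Measure X))).toReal|
        ∂(gasProb m g (b N) (N + 1))) atTop (𝓝 0) := by
  obtain ⟨G, hG⟩ := happ.exists_lintegral_le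
  obtain ⟨B, hB⟩ := exists_mul_le_of_tendsto hb
  have γ_le : ENNReal.ofReal γ ≤ B := ENNReal.ofReal_le_of_le_toReal
    (le_of_tendsto' hb fun N => by rw [mul_comm]; exact_mod_cast hB N)
  set C := (expNeg (B * G))⁻¹
  have C_ne_top : C ≠ ∞ :=
    ENNReal.inv_ne_top.2 (expNeg_pos (ENNReal.mul_ne_top (by simp) ENNReal.coe_ne_top)).ne'
  have μ_le : (μ : Measure X) ≤ C • m :=
    le_smul_of_tendsto_gasProb hgm hg ENNReal.coe_ne_top hG hB hlln
  refine ENNReal.tendsto_nhds_zero.2 fun ε hε => ?_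
  have third_pos : 0 < ε / 3 := ENNReal.div_pos hε.ne' (by simp)
  obtain ⟨δ, δ_pos, δ_lt⟩ :=
    ENNReal.exists_nnreal_pos_mul_lt (ENNReal.mul_ne_top ENNReal.coe_ne_top C_ne_top) third_pos.ne'
  obtain ⟨q, q_le, lintegral_sub_le⟩ := happ.exists_boundedContinuous_le δ_pos y
  have approx_le : (B : ℝ≥0∞) * (C * ∫⁻ z, (g y z - q z) ∂m) ≤ ε / 3 := by
    rw [← mul_assoc]
    exact (mul_le_mul_right lintegral_sub_le _).trans (by rw [mul_comm]; exact δ_lt.le)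
  have coupling_tendsto :
      Tendsto (fun N : ℕ => ENNReal.ofReal |((N + 1 : ℕ) : ℝ) * b N - γ|) atTop (𝓝 0) := by
    simpa using ENNReal.tendsto_ofReal (hb.sub_const γ).abs
  have middle_tendsto := (ENNReal.Tendsto.mul_const coupling_tendsto
    (.inr (ENNReal.coe_ne_top (r := nndist q 0)))).add (ENNReal.Tendsto.const_mul
      (hlln (q.comp _ NNReal.isometry_coe.lipschitz)) (.inr (ENNReal.coe_ne_top (r := B))))
  rw [zero_mul, mul_zero, add_zero] at middle_tendsto
  filter_upwards [ENNReal.tendsto_nhds_zero.1 middle_tendsto (ε / 3) third_pos] with N middle_le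
  exact ((lintegral_gasProb_abs_expNeg_sub_le hγ hgm hg ENNReal.coe_ne_top hG (hB N) γ_le μ_le
    hgm.of_uncurry_left q_le).trans (add_le_add (add_le_add approx_le middle_le)
      approx_le)).trans_eq (ENNReal.add_thirds ε)

end PotentialLimit

/-! ### Removing a particle and comparing Laplace functionals -/

section UnitInterval

theorem toReal_expNeg_mem_unitInterval (a : ℝ≥0∞) : (expNeg a).toReal ∈ unitInterval :=
  ⟨ENNReal.toReal_nonneg,
    ENNReal.toReal_le_of_le_ofReal zero_le_one (by simpa using expNeg_le_one a)⟩

theorem one_sub_mul_mem_unitInterval {s t : ℝ} (hs : s ∈ unitInterval) (ht : t ∈ unitInterval) :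
    1 - s * t ∈ unitInterval :=
  Set.Icc.mem_iff_one_sub_mem.1 (unitInterval.mul_mem hs ht)

theorem abs_sub_mem_unitInterval {s t : ℝ} (hs : s ∈ unitInterval) (ht : t ∈ unitInterval) :
    |s - t| ∈ unitInterval :=
  ⟨abs_nonneg _, Real.dist_le_of_mem_Icc_01 hs ht⟩

variable {Y : Type*} [MeasurableSpace Y] {P : Measure Y}

theorem integrable_of_mem_unitInterval [IsFiniteMeasure P] {f : Y → ℝ} (hf : Measurable f)
    (hf01 : ∀ y, f y ∈ unitInterval) : Integrable f P :=
  .of_mem_Icc 0 1 hf.aemeasurable (ae_of_all _ hf01)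

theorem integral_mem_unitInterval [IsProbabilityMeasure P] {f : Y → ℝ} (hf : Measurable f)
    (hf01 : ∀ y, f y ∈ unitInterval) : ∫ y, f y ∂P ∈ unitInterval :=
  (convex_Icc 0 1).integral_mem isClosed_Icc (ae_of_all _ hf01)
    (integrable_of_mem_unitInterval hf hf01)

theorem abs_integral_mul_sub_mul_integral_le [IsFiniteMeasure P] {Λ w : Y → ℝ} (hΛ : Measurable Λ)
    (hΛ01 : ∀ y, Λ y ∈ unitInterval) (hw : Integrable w P) (c : ℝ) :
    |∫ y, Λ y * w y ∂P - c * ∫ y, Λ y ∂P| ≤ ∫ y, |w y - c| ∂P := by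
  have Λ_integrable : Integrable Λ P := integrable_of_mem_unitInterval hΛ hΛ01
  have mul_integrable : Integrable (fun y => Λ y * w y) P :=
    hw.bdd_mul hΛ.aestronglyMeasurable
      (ae_of_all _ fun y => (abs_of_nonneg (hΛ01 y).1).trans_le (hΛ01 y).2)
  rw [← integral_const_mul, ← integral_sub mul_integrable (Λ_integrable.const_mul c)]
  refine norm_integral_le_of_norm_le (G := ℝ) (hw.sub (integrable_const c)).abs
    (ae_of_all _ fun y => ?_)
  rw [mul_comm c, ← mul_sub, norm_mul, Real.norm_of_nonneg (hΛ01 y).1]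
  exact mul_le_of_le_one_left (norm_nonneg _) (hΛ01 y).2

theorem abs_integral_mul_sub_integral_mul_le {h a : Y → ℝ} {c η : ℝ} (hh : Integrable h P)
    (hha : Integrable (fun y => h y * a y) P) (h0 : ∀ y, 0 ≤ h y)
    (ha : ∀ y, h y ≠ 0 → |a y - c| ≤ η) :
    |∫ y, h y * a y ∂P - (∫ y, h y ∂P) * c| ≤ (∫ y, h y ∂P) * η := by
  rw [← integral_mul_const, ← integral_sub hha (hh.mul_const c), ← integral_mul_const]
  refine norm_integral_le_of_norm_le (G := ℝ) (hh.mul_const η) (ae_of_all _ fun y => ?_)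
  rw [← mul_sub, norm_mul, Real.norm_of_nonneg (h0 y)]
  by_cases hy : h y = 0
  · simp [hy]
  · exact mul_le_mul_of_nonneg_left (ha y hy) (h0 y)

theorem abs_integral_integral_mul_sub_mul_le {X : Type*} [MeasurableSpace X] {m : Measure X}
    [IsFiniteMeasure m] [IsProbabilityMeasure P] {Λ : Y → ℝ} (hΛ : Measurable Λ)
    (hΛ01 : ∀ x, Λ x ∈ unitInterval) {w : X → Y → ℝ} (hw : Measurable (Function.uncurry w))
    (hw01 : ∀ y x, w y x ∈ unitInterval) {l : X → ℝ} (hl : Measurable l)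
    (hl01 : ∀ y, l y ∈ unitInterval) :
    |∫ y, ∫ x, Λ x * w y x ∂P ∂m - (∫ y, l y ∂m) * ∫ x, Λ x ∂P| ≤
      ∫ y, ∫ x, |w y x - l y| ∂P ∂m := by
  have Λw_integrable : Integrable (fun q : X × Y => Λ q.2 * w q.1 q.2) (m.prod P) :=
    integrable_of_mem_unitInterval ((hΛ.comp measurable_snd).mul hw)
      fun q => unitInterval.mul_mem (hΛ01 q.2) (hw01 q.1 q.2)
  have abs_sub_integrable : Integrable (fun q : X × Y => |w q.1 q.2 - l q.1|) (m.prod P) :=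
    integrable_of_mem_unitInterval (hw.sub (hl.comp measurable_fst)).abs
      fun q => abs_sub_mem_unitInterval (hw01 q.1 q.2) (hl01 q.1)
  rw [← integral_mul_const, ← integral_sub Λw_integrable.integral_prod_left
    ((integrable_of_mem_unitInterval hl hl01).mul_const _)]
  exact norm_integral_le_of_norm_le (G := ℝ) abs_sub_integrable.integral_prod_left
    (ae_of_all _ fun y => abs_integral_mul_sub_mul_integral_le hΛ hΛ01
      (integrable_of_mem_unitInterval hw.of_uncurry_left (hw01 y)) (l y))

theorem integral_integral_eq_toReal {X : Type*} [MeasurableSpace X] {m : Measure X} [SFinite m]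
    [SFinite P] {f : X × Y → ℝ} (hf : Measurable f) (h0 : ∀ q, 0 ≤ f q)
    (hint : Integrable f (m.prod P)) :
    ∫ y, ∫ x, f (y, x) ∂P ∂m = (∫⁻ y, ∫⁻ x, ENNReal.ofReal (f (y, x)) ∂P ∂m).toReal := by
  rw [← integral_prod _ hint, integral_eq_lintegral_of_nonneg_ae (ae_of_all _ h0)
    hf.aestronglyMeasurable, lintegral_prod _ hf.ennreal_ofReal.aemeasurable]

end UnitInterval

section Removal

variable {X : Type*}

/-- The Boltzmann weight of a particle inserted at `y` into the configuration `x`. -/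
noncomputable def insertionWeight (g : X → X → ℝ≥0∞) (b : ℝ≥0) {N : ℕ} (y : X) (x : Fin N → X) :
    ℝ :=
  (expNeg (b * ∑ j, g y (x j))).toReal

theorem insertionWeight_mem_unitInterval (g : X → X → ℝ≥0∞) (b : ℝ≥0) {N : ℕ} (y : X)
    (x : Fin N → X) : insertionWeight g b y x ∈ unitInterval :=
  toReal_expNeg_mem_unitInterval _

theorem prod_erase_insertNth {N : ℕ} (f : X → ℝ) (i : Fin (N + 1)) (y : X) (x : Fin N → X) :
    ∏ j ∈ Finset.univ.erase i, f ((i.insertNth y x : Fin (N + 1) → X) j) = ∏ j, f (x j) := by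
  have erase_eq : Finset.univ.erase i = Finset.univ.image i.succAbove := by
    rw [Fin.image_succAbove_univ]
    ext j
    simp
  rw [erase_eq, Finset.prod_image fun a _ b _ hab => Fin.succAbove_right_injective hab]
  simp

variable [MeasurableSpace X]

theorem measurable_insertionWeight {g : X → X → ℝ≥0∞} (hg : Measurable (Function.uncurry g))
    (b : ℝ≥0) (N : ℕ) :
    Measurable (Function.uncurry (insertionWeight g b : X → (Fin N → X) → ℝ)) :=
  (measurable_expNeg.comp ((measurable_sum_kernel hg).const_mul _)).ennreal_toReal

theorem measurable_prod_comp_eval {N : ℕ} {f : X → ℝ} (hf : Measurable f) (s : Finset (Fin N)) :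
    Measurable fun x : Fin N → X => ∏ j ∈ s, f (x j) :=
  Finset.measurable_prod _ fun j _ => hf.comp (measurable_pi_apply j)

/-- The ratio `Z_N / Z_{N+1}` of consecutive partition functions, the normalization needed when a
particle is inserted into the gas of `N` particles with its Boltzmann weight. -/
noncomputable def partitionRatio (m : Measure X) (g : X → X → ℝ≥0∞) (b : ℝ≥0) (N : ℕ) : ℝ :=
  (gas m g b N Set.univ).toReal / (gas m g b (N + 1) Set.univ).toReal

theorem partitionRatio_nonneg (m : Measure X) (g : X → X → ℝ≥0∞) (b : ℝ≥0) (N : ℕ) :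
    0 ≤ partitionRatio m g b N :=
  div_nonneg ENNReal.toReal_nonneg ENNReal.toReal_nonneg

variable (m : Measure X) [IsProbabilityMeasure m] {g : X → X → ℝ≥0∞}

theorem integral_gasProb_succ (hgm : Measurable (Function.uncurry g))
    (hg : ∀ u x, g u x = g x u) {G : ℝ≥0∞} (hGt : G ≠ ∞) (hG : ∀ y, ∫⁻ x, g y x ∂m ≤ G)
    (b : ℝ≥0) {N : ℕ} (i : Fin (N + 1)) {F : (Fin (N + 1) → X) → ℝ} (hF : Measurable F)
    (hF01 : ∀ x, F x ∈ unitInterval) :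
    ∫ x, F x ∂(gasProb m g b (N + 1)) = partitionRatio m g b N *
      ∫ y, ∫ x, F (i.insertNth y x : Fin (N + 1) → X) * insertionWeight g b y x
        ∂(gasProb m g b N) ∂m := by
  have := isProbabilityMeasure_gasProb m hgm hg hGt hG b N
  have Z_pos := gas_univ_pos m hgm hg hGt hG b N
  have integrand_measurable : Measurable fun q : X × (Fin N → X) =>
      F (i.insertNth q.1 q.2) * insertionWeight g b q.1 q.2 :=
    (hF.comp (measurable_insertNth i)).mul (measurable_insertionWeight hgm b N)
  have integrand_mem (q : X × (Fin N → X)) :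
      F (i.insertNth q.1 q.2) * insertionWeight g b q.1 q.2 ∈ unitInterval :=
    unitInterval.mul_mem (hF01 _) (insertionWeight_mem_unitInterval g b _ _)
  rw [integral_integral_eq_toReal integrand_measurable (fun q => (integrand_mem q).1)
      (integrable_of_mem_unitInterval integrand_measurable integrand_mem),
    integral_eq_lintegral_of_nonneg_ae (ae_of_all _ fun x => (hF01 x).1) hF.aestronglyMeasurable]
  simp_rw [insertionWeight, ENNReal.ofReal_mul (hF01 _).1, ENNReal.ofReal_toReal (expNeg_ne_top _)]
  rw [gasProb, gasProb, lintegral_smul_measure, lintegral_gas_succ m hgm hg b i hF.ennreal_ofReal]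
  simp_rw [lintegral_smul_measure, smul_eq_mul]
  rw [lintegral_const_mul' _ _ (ENNReal.inv_ne_top.2 Z_pos.ne'), ENNReal.toReal_mul,
    ENNReal.toReal_mul, ENNReal.toReal_inv, ENNReal.toReal_inv, partitionRatio]
  have Z_toReal_ne_zero : (gas m g b N Set.univ).toReal ≠ 0 :=
    (ENNReal.toReal_pos Z_pos.ne' (measure_ne_top _ _)).ne'
  field_simp

theorem integral_gasProb_succ_prod_erase_mul (hgm : Measurable (Function.uncurry g))
    (hg : ∀ u x, g u x = g x u) {G : ℝ≥0∞} (hGt : G ≠ ∞) (hG : ∀ y, ∫⁻ x, g y x ∂m ≤ G)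
    (b : ℝ≥0) {N : ℕ} (i : Fin (N + 1)) {f h : X → ℝ} (hf : Measurable f)
    (hf01 : ∀ y, f y ∈ unitInterval) (hh : Measurable h) (hh01 : ∀ y, h y ∈ unitInterval) :
    ∫ x, (∏ j ∈ Finset.univ.erase i, f (x j)) * h (x i) ∂(gasProb m g b (N + 1)) =
      partitionRatio m g b N *
        ∫ y, h y * ∫ x, (∏ j, f (x j)) * insertionWeight g b y x ∂(gasProb m g b N) ∂m := by
  rw [integral_gasProb_succ m hgm hg hGt hG b i
    (F := fun x => (∏ j ∈ Finset.univ.erase i, f (x j)) * h (x i))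
    ((measurable_prod_comp_eval hf _).mul (hh.comp (measurable_pi_apply i)))
    fun x => unitInterval.mul_mem (unitInterval.prod_mem fun j _ => hf01 _) (hh01 _)]
  congr 2 with y
  rw [← integral_const_mul]
  congr 1 with x
  rw [prod_erase_insertNth f, Fin.insertNth_apply_same]
  ring

theorem integral_gasProb_succ_prod (hgm : Measurable (Function.uncurry g))
    (hg : ∀ u x, g u x = g x u) {G : ℝ≥0∞} (hGt : G ≠ ∞) (hG : ∀ y, ∫⁻ x, g y x ∂m ≤ G)
    (b : ℝ≥0) (N : ℕ) {f : X → ℝ} (hf : Measurable f) (hf01 : ∀ y, f y ∈ unitInterval) :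
    ∫ x, ∏ j, f (x j) ∂(gasProb m g b (N + 1)) = partitionRatio m g b N *
      ∫ y, f y * ∫ x, (∏ j, f (x j)) * insertionWeight g b y x ∂(gasProb m g b N) ∂m := by
  rw [← integral_gasProb_succ_prod_erase_mul m hgm hg hGt hG b 0 hf hf01 hf hf01]
  congr 1 with x
  exact (Finset.prod_erase_mul _ _ (Finset.mem_univ 0)).symm

end Removal

section Interpolation

variable {X : Type*}

theorem abs_prod_one_sub_mul_le {N : ℕ} {h : X → ℝ} {R : ℝ≥0} (hR : ∀ x, |h x| ≤ R) {t r : ℝ}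
    (ht : |t| ≤ r) (s : Finset (Fin N)) (x : Fin N → X) :
    |∏ j ∈ s, (1 - t * h (x j))| ≤ (1 + r * R) ^ N := by
  have r_nonneg : 0 ≤ r := (abs_nonneg t).trans ht
  have factor_le (z : X) : |1 - t * h z| ≤ 1 + r * R := by
    calc |1 - t * h z| ≤ |1| + |t * h z| := abs_sub _ _
      _ = 1 + |t| * |h z| := by rw [abs_one, abs_mul]
      _ ≤ 1 + r * R := by gcongr; exact hR z
  calc |∏ j ∈ s, (1 - t * h (x j))| = ∏ j ∈ s, |1 - t * h (x j)| := Finset.abs_prod _ _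
    _ ≤ ∏ _j ∈ s, (1 + r * R) :=
        Finset.prod_le_prod (fun _ _ => abs_nonneg _) fun j _ => factor_le _
    _ = (1 + r * R) ^ s.card := Finset.prod_const _
    _ ≤ (1 + r * R) ^ N :=
        pow_le_pow_right₀ (le_add_of_nonneg_right (by positivity)) (by simpa using s.card_le_univ)

theorem hasDerivAt_prod_one_sub_mul {N : ℕ} (h : X → ℝ) (x : Fin N → X) (t : ℝ) :
    HasDerivAt (fun t => ∏ j, (1 - t * h (x j)))
      (-∑ i, (∏ j ∈ Finset.univ.erase i, (1 - t * h (x j))) * h (x i)) t := by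
  have := HasDerivAt.fun_finsetProd (u := Finset.univ) (f := fun (j : Fin N) t => 1 - t * h (x j))
    (f' := fun j => -h (x j)) (x := t) fun j _ => by
      simpa using ((hasDerivAt_id t).mul_const (h (x j))).const_sub 1
  simpa [smul_eq_mul] using this

variable [MeasurableSpace X]

theorem hasDerivAt_integral_prod_one_sub_mul {N : ℕ} (P : Measure (Fin N → X)) [IsFiniteMeasure P]
    {h : X → ℝ} (hh : Measurable h) {R : ℝ≥0} (hR : ∀ x, |h x| ≤ R) (t₀ : ℝ) :
    HasDerivAt (fun t => ∫ x, ∏ j, (1 - t * h (x j)) ∂P)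
      (-∑ i, ∫ x, (∏ j ∈ Finset.univ.erase i, (1 - t₀ * h (x j))) * h (x i) ∂P) t₀ := by
  have abs_le {t : ℝ} (ht : t ∈ Metric.ball t₀ 1) : |t| ≤ |t₀| + 1 := by
    have := abs_sub_abs_le_abs_sub t t₀
    rw [Metric.mem_ball, Real.dist_eq] at ht
    linarith
  have prod_measurable (t : ℝ) (s : Finset (Fin N)) :
      Measurable fun x : Fin N → X => ∏ j ∈ s, (1 - t * h (x j)) :=
    measurable_prod_comp_eval (f := fun z => 1 - t * h z) (by fun_prop) s
  have term_measurable (t : ℝ) (i : Fin N) :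
      Measurable fun x : Fin N → X =>
        (∏ j ∈ Finset.univ.erase i, (1 - t * h (x j))) * h (x i) :=
    (prod_measurable t _).mul (hh.comp (measurable_pi_apply i))
  have term_le {t : ℝ} (ht : t ∈ Metric.ball t₀ 1) (x : Fin N → X) (i : Fin N) :
      ‖(∏ j ∈ Finset.univ.erase i, (1 - t * h (x j))) * h (x i)‖ ≤
        (1 + (|t₀| + 1) * R) ^ N * R := by
    rw [norm_mul]
    exact mul_le_mul (abs_prod_one_sub_mul_le hR (abs_le ht) _ x) (hR _) (norm_nonneg _)
      (by positivity)
  have t₀_mem : t₀ ∈ Metric.ball t₀ 1 := Metric.mem_ball_self one_pos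
  rw [← integral_finsetSum _ fun i _ => .of_bound (term_measurable t₀ i).aestronglyMeasurable _
    (ae_of_all _ fun x => term_le t₀_mem x i), ← integral_neg]
  refine (hasDerivAt_integral_of_dominated_loc_of_deriv_le
    (F' := fun t x => -∑ i, (∏ j ∈ Finset.univ.erase i, (1 - t * h (x j))) * h (x i))
    (bound := fun _ => N * ((1 + (|t₀| + 1) * R) ^ N * R)) (Metric.ball_mem_nhds t₀ one_pos)
    (.of_forall fun t => (prod_measurable t _).aestronglyMeasurable)
    (.of_bound (prod_measurable t₀ _).aestronglyMeasurable _
      (ae_of_all _ fun x => abs_prod_one_sub_mul_le hR (abs_le t₀_mem) _ x))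
    (Finset.measurable_sum _ fun i _ => term_measurable t₀ i).neg.aestronglyMeasurable
    (ae_of_all _ fun x t ht => ?_) (integrable_const _)
    (ae_of_all _ fun x t _ => hasDerivAt_prod_one_sub_mul h x t)).2
  rw [norm_neg]
  exact (norm_sum_le_of_le _ fun i _ => term_le ht x i).trans_eq (by simp)

theorem abs_sub_exp_neg_le_of_deriv {A D : ℝ → ℝ} {τ ε : ℝ} (hτ : 0 ≤ τ)
    (hA : ∀ t, HasDerivAt A (-D t) t) (hA0 : A 0 = 1)
    (hD : ∀ t ∈ unitInterval, |D t - τ * A t| ≤ ε) : |A 1 - Real.exp (-τ)| ≤ ε := by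
  have deriv_exp_mul (t : ℝ) : HasDerivAt (fun t => Real.exp (τ * t) * A t)
      (Real.exp (τ * t) * (τ * A t - D t)) t := by
    have exp_deriv : HasDerivAt (fun t => Real.exp (τ * t)) (Real.exp (τ * t) * τ) t := by
      simpa using ((hasDerivAt_id t).const_mul τ).exp
    convert! exp_deriv.mul (hA t) using 1
    ring
  have deriv_le (t : ℝ) (ht : t ∈ unitInterval) :
      ‖Real.exp (τ * t) * (τ * A t - D t)‖ ≤ Real.exp τ * ε := by
    rw [norm_mul, Real.norm_eq_abs, Real.norm_eq_abs, Real.abs_exp, abs_sub_comm]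
    refine mul_le_mul (Real.exp_le_exp.2 ?_) (hD t ht) (abs_nonneg _) (Real.exp_nonneg _)
    exact mul_le_of_le_one_right hτ ht.2
  have mean_value := (convex_Icc (0 : ℝ) 1).norm_image_sub_le_of_norm_hasDerivWithin_le
    (fun t _ => (deriv_exp_mul t).hasDerivWithinAt) deriv_le unitInterval.zero_mem
    unitInterval.one_mem
  have increment_eq : Real.exp (τ * 1) * A 1 - Real.exp (τ * 0) * A 0 =
      Real.exp τ * (A 1 - Real.exp (-τ)) := by
    simp [hA0, mul_sub, ← Real.exp_add]
  rw [increment_eq, norm_mul, Real.norm_eq_abs, Real.norm_eq_abs, Real.abs_exp, sub_zero, norm_one,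
    mul_one] at mean_value
  exact le_of_mul_le_mul_left mean_value (Real.exp_pos τ)

end Interpolation

section Laplace

variable {X : Type*} [MeasurableSpace X] {m : Measure X} [IsProbabilityMeasure m]
  {g : X → X → ℝ≥0∞}

theorem abs_one_sub_partitionRatio_mul_le (hgm : Measurable (Function.uncurry g))
    (hg : ∀ u x, g u x = g x u) {G : ℝ≥0∞} (hGt : G ≠ ∞) (hG : ∀ y, ∫⁻ x, g y x ∂m ≤ G)
    (b : ℝ≥0) (N : ℕ) {l : X → ℝ} (hl : Measurable l) (hl01 : ∀ y, l y ∈ unitInterval) :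
    |1 - partitionRatio m g b N * ∫ y, l y ∂m| ≤ partitionRatio m g b N *
      ∫ y, ∫ x, |insertionWeight g b y x - l y| ∂(gasProb m g b N) ∂m := by
  have := isProbabilityMeasure_gasProb m hgm hg hGt hG b N
  have := isProbabilityMeasure_gasProb m hgm hg hGt hG b (N + 1)
  have weight_close := abs_integral_integral_mul_sub_mul_le (m := m) (P := gasProb m g b N)
    (Λ := fun _ => 1) measurable_const (fun _ => unitInterval.one_mem)
    (measurable_insertionWeight hgm b N) (insertionWeight_mem_unitInterval g b) hl hl01
  have ratio_mul_eq : 1 = partitionRatio m g b N *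
      ∫ y, ∫ x, 1 * insertionWeight g b y x ∂(gasProb m g b N) ∂m := by
    simpa using integral_gasProb_succ_prod m hgm hg hGt hG b N (f := fun _ => 1) measurable_const
      fun _ => unitInterval.one_mem
  rw [integral_const, probReal_univ, one_smul, mul_one] at weight_close
  nth_rewrite 1 [ratio_mul_eq]
  rw [← mul_sub, abs_mul, abs_of_nonneg (partitionRatio_nonneg m g b N)]
  exact mul_le_mul_of_nonneg_left weight_close (partitionRatio_nonneg m g b N)

theorem abs_sum_integral_prod_erase_mul_sub_le (hgm : Measurable (Function.uncurry g))
    (hg : ∀ u x, g u x = g x u) {G : ℝ≥0∞} (hGt : G ≠ ∞) (hG : ∀ y, ∫⁻ x, g y x ∂m ≤ G)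
    (b : ℝ≥0) (N : ℕ) {f h : X → ℝ} (hf : Measurable f) (hf01 : ∀ y, f y ∈ unitInterval)
    (hh : Measurable h) (hh01 : ∀ y, h y ∈ unitInterval) {η : ℝ}
    (hη : ∀ y, h y ≠ 0 → ∫ x, (1 - insertionWeight g b y x) ∂(gasProb m g b N) ≤ η) :
    |∑ i, ∫ x, (∏ j ∈ Finset.univ.erase i, f (x j)) * h (x i) ∂(gasProb m g b (N + 1)) -
        partitionRatio m g b N * ((N + 1 : ℕ) * ∫ y, h y ∂m) *
          ∫ x, ∏ j, f (x j) ∂(gasProb m g b N)| ≤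
      partitionRatio m g b N * ((N + 1 : ℕ) * ∫ y, h y ∂m) * η := by
  have := isProbabilityMeasure_gasProb m hgm hg hGt hG b N
  set P := gasProb m g b N
  set κ := partitionRatio m g b N
  have κ_nonneg : 0 ≤ κ := partitionRatio_nonneg m g b N
  set a : X → ℝ := fun y => ∫ x, (∏ j, f (x j)) * insertionWeight g b y x ∂P
  have weight_measurable := measurable_insertionWeight hgm b N
  have prod_measurable : Measurable fun x : Fin N → X => ∏ j, f (x j) :=
    measurable_prod_comp_eval hf _
  have prod_mem (x : Fin N → X) : ∏ j, f (x j) ∈ unitInterval :=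
    unitInterval.prod_mem fun j _ => hf01 _
  have a_measurable : Measurable a :=
    (StronglyMeasurable.integral_prod_right' (ν := P)
      ((prod_measurable.comp measurable_snd).mul weight_measurable).stronglyMeasurable).measurable
  have a_mem (y : X) : a y ∈ unitInterval :=
    integral_mem_unitInterval (prod_measurable.mul weight_measurable.of_uncurry_left)
      fun x => unitInterval.mul_mem (prod_mem x) (insertionWeight_mem_unitInterval g b y x)
  have a_close (y : X) (hy : h y ≠ 0) : |a y - ∫ x, ∏ j, f (x j) ∂P| ≤ η := by
    have := abs_integral_mul_sub_mul_integral_le prod_measurable prod_mem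
      (integrable_of_mem_unitInterval (P := P) (weight_measurable.of_uncurry_left (x := y))
        (insertionWeight_mem_unitInterval g b y)) 1
    rw [one_mul] at this
    refine this.trans (le_trans (le_of_eq ?_) (hη y hy))
    congr 1 with x
    rw [abs_sub_comm, abs_of_nonneg (sub_nonneg.2 (insertionWeight_mem_unitInterval g b y x).2)]
  have integral_close := abs_integral_mul_sub_integral_mul_le
    (integrable_of_mem_unitInterval (P := m) hh hh01)
    (integrable_of_mem_unitInterval (hh.mul a_measurable)
      fun y => unitInterval.mul_mem (hh01 y) (a_mem y)) (fun y => (hh01 y).1) a_close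
  simp_rw [integral_gasProb_succ_prod_erase_mul m hgm hg hGt hG b _ hf hf01 hh hh01]
  rw [Finset.sum_const, Finset.card_univ, Fintype.card_fin, nsmul_eq_mul]
  calc |((N + 1 : ℕ) : ℝ) * (κ * ∫ y, h y * a y ∂m) -
        κ * ((N + 1 : ℕ) * ∫ y, h y ∂m) * ∫ x, ∏ j, f (x j) ∂P|
      = κ * (N + 1 : ℕ) * |∫ y, h y * a y ∂m - (∫ y, h y ∂m) * ∫ x, ∏ j, f (x j) ∂P| := by
        conv_rhs => rw [← abs_of_nonneg κ_nonneg, ← Nat.abs_cast, ← abs_mul, ← abs_mul]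
        congr 1
        ring
    _ ≤ κ * (N + 1 : ℕ) * ((∫ y, h y ∂m) * η) := by gcongr
    _ = κ * ((N + 1 : ℕ) * ∫ y, h y ∂m) * η := by ring

theorem abs_mul_sub_sub_le {κ u v A L ξ H : ℝ} (hκ : 0 ≤ κ) (hA : A ∈ unitInterval)
    (hv0 : 0 ≤ v) (hv : v ≤ H) (hu : |u - L * A| ≤ ξ) (hL : |1 - κ * L| ≤ κ * ξ) :
    |κ * (u - v) - A| ≤ κ * (2 * ξ + H) := by
  calc |κ * (u - v) - A| = |κ * (u - L * A) + (-(κ * v) + -((1 - κ * L) * A))| := by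
        congr 1
        ring
    _ ≤ |κ * (u - L * A)| + (|κ * v| + |(1 - κ * L) * A|) := by
        grw [abs_add_le, abs_add_le, abs_neg, abs_neg]
    _ ≤ κ * ξ + (κ * H + κ * ξ * 1) := by
        rw [abs_mul, abs_mul, abs_mul, abs_of_nonneg hκ, abs_of_nonneg hv0, abs_of_nonneg hA.1]
        gcongr
        · exact hA.1
        · exact (abs_nonneg _).trans hL
        · exact hA.2
    _ = κ * (2 * ξ + H) := by ring

theorem abs_integral_gasProb_succ_prod_sub_le (hgm : Measurable (Function.uncurry g))
    (hg : ∀ u x, g u x = g x u) {G : ℝ≥0∞} (hGt : G ≠ ∞) (hG : ∀ y, ∫⁻ x, g y x ∂m ≤ G)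
    (b : ℝ≥0) (N : ℕ) {f l : X → ℝ} (hf : Measurable f) (hf01 : ∀ y, f y ∈ unitInterval)
    (hl : Measurable l) (hl01 : ∀ y, l y ∈ unitInterval) :
    |∫ x, ∏ j, f (x j) ∂(gasProb m g b (N + 1)) - ∫ x, ∏ j, f (x j) ∂(gasProb m g b N)| ≤
      partitionRatio m g b N *
        (2 * ∫ y, ∫ x, |insertionWeight g b y x - l y| ∂(gasProb m g b N) ∂m +
          ∫ y, (1 - f y) ∂m) := by
  have := isProbabilityMeasure_gasProb m hgm hg hGt hG b N
  set P := gasProb m g b N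
  set a : X → ℝ := fun y => ∫ x, (∏ j, f (x j)) * insertionWeight g b y x ∂P
  have weight_measurable := measurable_insertionWeight hgm b N
  have prod_measurable : Measurable fun x : Fin N → X => ∏ j, f (x j) :=
    measurable_prod_comp_eval hf _
  have prod_mem (x : Fin N → X) : ∏ j, f (x j) ∈ unitInterval :=
    unitInterval.prod_mem fun j _ => hf01 _
  have a_measurable : Measurable a :=
    (StronglyMeasurable.integral_prod_right' (ν := P)
      ((prod_measurable.comp measurable_snd).mul weight_measurable).stronglyMeasurable).measurable
  have a_mem (y : X) : a y ∈ unitInterval :=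
    integral_mem_unitInterval (prod_measurable.mul weight_measurable.of_uncurry_left)
      fun x => unitInterval.mul_mem (prod_mem x) (insertionWeight_mem_unitInterval g b y x)
  have one_sub_mem (y : X) : 1 - f y ∈ unitInterval := Set.Icc.mem_iff_one_sub_mem.1 (hf01 y)
  have one_sub_integrable : Integrable (fun y => 1 - f y) m :=
    integrable_of_mem_unitInterval (hf.const_sub 1) one_sub_mem
  have mul_integrable : Integrable (fun y => (1 - f y) * a y) m :=
    integrable_of_mem_unitInterval ((hf.const_sub 1).mul a_measurable)
      fun y => unitInterval.mul_mem (one_sub_mem y) (a_mem y)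
  have integral_mul_eq : ∫ y, f y * a y ∂m = ∫ y, a y ∂m - ∫ y, (1 - f y) * a y ∂m := by
    rw [← integral_sub (integrable_of_mem_unitInterval a_measurable a_mem) mul_integrable]
    congr 1 with y
    ring
  rw [integral_gasProb_succ_prod m hgm hg hGt hG b N hf hf01, integral_mul_eq]
  exact abs_mul_sub_sub_le (partitionRatio_nonneg m g b N)
    (integral_mem_unitInterval prod_measurable prod_mem)
    (integral_nonneg fun y => mul_nonneg (one_sub_mem y).1 (a_mem y).1)
    (integral_mono mul_integrable one_sub_integrable fun y =>
      mul_le_of_le_one_right (one_sub_mem y).1 (a_mem y).2)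
    (abs_integral_integral_mul_sub_mul_le prod_measurable prod_mem weight_measurable
      (insertionWeight_mem_unitInterval g b) hl hl01)
    (abs_one_sub_partitionRatio_mul_le hgm hg hGt hG b N hl hl01)

/-- The interpolation `A t = 𝔼_{N+1}[∏ (1 - t h(x_j))]` nearly solves `A' = -τ A`: differentiating
singles out one particle, removing it produces the factor `τ` up to its interaction with the rest,
and adding it back costs little. -/
theorem abs_integral_gasProb_prod_sub_exp_neg_le (hgm : Measurable (Function.uncurry g))
    (hg : ∀ u x, g u x = g x u) {G : ℝ≥0∞} (hGt : G ≠ ∞) (hG : ∀ y, ∫⁻ x, g y x ∂m ≤ G)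
    (b : ℝ≥0) (N : ℕ) {h l : X → ℝ} (hh : Measurable h) (hh01 : ∀ y, h y ∈ unitInterval)
    (hl : Measurable l) (hl01 : ∀ y, l y ∈ unitInterval) {τ η : ℝ}
    (hτ : τ = partitionRatio m g b N * ((N + 1 : ℕ) * ∫ y, h y ∂m))
    (hη : ∀ y, h y ≠ 0 → ∫ x, (1 - insertionWeight g b y x) ∂(gasProb m g b N) ≤ η) :
    |∫ x, ∏ j, (1 - h (x j)) ∂(gasProb m g b (N + 1)) - Real.exp (-τ)| ≤
      τ * (η + partitionRatio m g b N *
        (2 * ∫ y, ∫ x, |insertionWeight g b y x - l y| ∂(gasProb m g b N) ∂m +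
          ∫ y, h y ∂m)) := by
  have := isProbabilityMeasure_gasProb m hgm hg hGt hG b (N + 1)
  have h_integral_nonneg : 0 ≤ ∫ y, h y ∂m := integral_nonneg fun y => (hh01 y).1
  have κ_nonneg := partitionRatio_nonneg m g b N
  have τ_nonneg : 0 ≤ τ := by
    rw [hτ]
    positivity
  have near_ode (t : ℝ) (ht : t ∈ unitInterval) :
      |∑ i, ∫ x, (∏ j ∈ Finset.univ.erase i, (1 - t * h (x j))) * h (x i) ∂gasProb m g b (N + 1) -
        τ * ∫ x, ∏ j, (1 - t * h (x j)) ∂(gasProb m g b (N + 1))| ≤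
      τ * (η + partitionRatio m g b N *
        (2 * ∫ y, ∫ x, |insertionWeight g b y x - l y| ∂(gasProb m g b N) ∂m +
          ∫ y, h y ∂m)) := by
    have f_measurable : Measurable fun y => 1 - t * h y := by fun_prop
    have f_mem (y : X) : 1 - t * h y ∈ unitInterval := one_sub_mul_mem_unitInterval ht (hh01 y)
    have remove_le := abs_sum_integral_prod_erase_mul_sub_le hgm hg hGt hG b N f_measurable f_mem
      hh hh01 hη
    have insert_le := abs_integral_gasProb_succ_prod_sub_le hgm hg hGt hG b N f_measurable f_mem
      hl hl01
    have mul_integral_le : t * ∫ y, h y ∂m ≤ ∫ y, h y ∂m :=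
      mul_le_of_le_one_left h_integral_nonneg ht.2
    simp only [sub_sub_cancel, integral_const_mul] at insert_le
    rw [← hτ] at remove_le
    grw [abs_sub_le _ _ _, remove_le, ← mul_sub, abs_mul, abs_of_nonneg τ_nonneg, abs_sub_comm,
      insert_le, mul_integral_le]
    exact (mul_add _ _ _).ge
  simpa using abs_sub_exp_neg_le_of_deriv τ_nonneg
    (hasDerivAt_integral_prod_one_sub_mul (gasProb m g b (N + 1)) hh (R := 1)
      fun y => by simpa [abs_of_nonneg (hh01 y).1] using (hh01 y).2) (by simp) near_ode

end Laplace

/-! ### Convergence of the Laplace functionals -/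

section PoissonLimit

theorem tendsto_inv_of_abs_one_sub_mul_le {κ ξ : ℕ → ℝ} {l : ℝ} (hl : 0 < l) (hκ : ∀ N, 0 ≤ κ N)
    (hξ : Tendsto ξ atTop (𝓝 0)) (h : ∀ N, |1 - κ N * l| ≤ κ N * ξ N) :
    Tendsto κ atTop (𝓝 l⁻¹) := by
  have κ_le : ∀ᶠ N in atTop, κ N ≤ 2 / l := by
    filter_upwards [hξ.eventually (gt_mem_nhds (half_pos hl))] with N hN
    have := (abs_le.1 (h N)).1
    have := mul_le_mul_of_nonneg_left hN.le (hκ N)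
    rw [le_div_iff₀ hl]
    linarith
  have sub_le : ∀ᶠ N in atTop, |κ N - l⁻¹| ≤ 2 / l * |ξ N| * l⁻¹ := by
    filter_upwards [κ_le] with N hN
    have sub_eq : κ N - l⁻¹ = -((1 - κ N * l) * l⁻¹) := by
      field_simp
      ring
    rw [sub_eq, abs_neg, abs_mul, abs_of_pos (inv_pos.2 hl)]
    grw [h N, le_abs_self (ξ N), hN]
    exact hκ N
  have bound_tendsto : Tendsto (fun N => 2 / l * |ξ N| * l⁻¹) atTop (𝓝 0) := by
    simpa using (hξ.abs.const_mul (2 / l)).mul_const l⁻¹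
  rw [tendsto_iff_norm_sub_tendsto_zero]
  exact squeeze_zero' (Eventually.of_forall fun _ => norm_nonneg _) sub_le bound_tendsto

theorem tendsto_biSup_zero_of_tendsto_smallSets {ι X : Type*} {φ : X → ℝ≥0∞} {k : Filter ι}
    {l : Filter X} {A : ι → Set X} (hφ : Tendsto φ l (𝓝 0)) (hA : Tendsto A k l.smallSets) :
    Tendsto (fun i => ⨆ y ∈ A i, φ y) k (𝓝 0) :=
  ENNReal.tendsto_nhds_zero.2 fun ε hε => by
    filter_upwards [tendsto_smallSets_iff.1 hA _ (ENNReal.tendsto_nhds_zero.1 hφ ε hε)] with i hi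
    exact iSup₂_le fun y hy => hi hy

theorem tendsto_zero_of_tendsto_add_two_mul {a : ℕ → ℝ} {T : ℝ}
    (ha : Tendsto (fun N => ((N + 1 + 1 : ℕ) : ℝ) * a N) atTop (𝓝 T)) :
    Tendsto a atTop (𝓝 0) := by
  have inv_tendsto : Tendsto (fun N : ℕ => ((N + 1 + 1 : ℕ) : ℝ)⁻¹) atTop (𝓝 0) :=
    tendsto_inv_atTop_zero.comp (tendsto_natCast_atTop_atTop.comp (tendsto_add_atTop_nat 2))
  rw [← mul_zero T]
  exact (ha.mul inv_tendsto).congr fun N => by field_simp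

variable {X : Type*} [MeasurableSpace X]

/-- The Boltzmann factor `exp (-γ U y)` of the mean field potential `U y = ∫ g y z ∂μ`, which is the
limit of `insertionWeight` under the law of large numbers. -/
noncomputable def meanFieldWeight (γ : ℝ) (g : X → X → ℝ≥0∞) (μ : Measure X) (y : X) : ℝ :=
  (expNeg (ENNReal.ofReal γ * ∫⁻ z, g y z ∂μ)).toReal

theorem meanFieldWeight_mem_unitInterval (γ : ℝ) (g : X → X → ℝ≥0∞) (μ : Measure X) (y : X) :
    meanFieldWeight γ g μ y ∈ unitInterval :=
  toReal_expNeg_mem_unitInterval _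

theorem measurable_meanFieldWeight (γ : ℝ) {g : X → X → ℝ≥0∞}
    (hgm : Measurable (Function.uncurry g)) (μ : Measure X) [SFinite μ] :
    Measurable (meanFieldWeight γ g μ) :=
  (measurable_expNeg.comp (hgm.lintegral_prod_right'.const_mul _)).ennreal_toReal

theorem integral_meanFieldWeight_pos (γ : ℝ) {m : Measure X} [IsProbabilityMeasure m]
    {g : X → X → ℝ≥0∞} (hgm : Measurable (Function.uncurry g)) {G : ℝ≥0∞} (hGt : G ≠ ∞)
    (hG : ∀ y, ∫⁻ x, g y x ∂m ≤ G) {μ : Measure X} [SFinite μ] {C : ℝ≥0∞} (hC : C ≠ ∞)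
    (hμ : μ ≤ C • m) : 0 < ∫ y, meanFieldWeight γ g μ y ∂m := by
  have potential_le (y : X) : ∫⁻ z, g y z ∂μ ≤ C * G := by
    grw [lintegral_mono' hμ le_rfl, lintegral_smul_measure, smul_eq_mul, hG y]
  have weight_pos (y : X) : 0 < meanFieldWeight γ g μ y :=
    ENNReal.toReal_pos (expNeg_pos (ENNReal.mul_ne_top ENNReal.ofReal_ne_top
      (ne_top_of_le_ne_top (ENNReal.mul_ne_top hC hGt) (potential_le y)))).ne' (expNeg_ne_top _)
  rw [integral_pos_iff_support_of_nonneg (fun y => (weight_pos y).le)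
    (integrable_of_mem_unitInterval (measurable_meanFieldWeight γ hgm μ)
      (meanFieldWeight_mem_unitInterval γ g μ)),
    Set.eq_univ_of_forall fun y => Function.mem_support.2 (weight_pos y).ne']
  simp

theorem integral_one_sub_insertionWeight {g : X → X → ℝ≥0∞} (hgm : Measurable (Function.uncurry g))
    (b : ℝ≥0) {N : ℕ} (P : Measure (Fin N → X)) (y : X) :
    ∫ x, (1 - insertionWeight g b y x) ∂P =
      (∫⁻ x, (1 - expNeg (b * ∑ j, g y (x j))) ∂P).toReal := by
  have weight_measurable : Measurable (insertionWeight g b (N := N) y) :=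
    (measurable_insertionWeight hgm b N).of_uncurry_left
  rw [integral_eq_lintegral_of_nonneg_ae
    (ae_of_all _ fun x => sub_nonneg.2 (insertionWeight_mem_unitInterval g b y x).2)
    (measurable_const.sub weight_measurable).aestronglyMeasurable]
  simp_rw [insertionWeight, ENNReal.ofReal_sub _ ENNReal.toReal_nonneg, ENNReal.ofReal_one,
    ENNReal.ofReal_toReal (expNeg_ne_top _)]

variable {γ : ℝ} {m : Measure X} [IsProbabilityMeasure m] {g : X → X → ℝ≥0∞} {b : ℕ → ℝ≥0}

theorem exists_tendsto_zero_integral_one_sub_insertionWeight_le [TopologicalSpace X]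
    [OpensMeasurableSpace X] [(cocompact X).IsCountablyGenerated]
    (hgm : Measurable (Function.uncurry g)) (hg : ∀ u x, g u x = g x u)
    (happ : IsApproxKernel g m) {B : ℝ≥0} (hB : ∀ N, b N * (N + 1 : ℕ) ≤ B) {A : ℕ → Set X}
    (hA : Tendsto A atTop (cocompact X).smallSets) :
    ∃ η : ℕ → ℝ, Tendsto η atTop (𝓝 0) ∧ ∀ N, ∀ y ∈ A N,
      ∫ x, (1 - insertionWeight g (b N) y x) ∂(gasProb m g (b N) (N + 1)) ≤ η N := by
  obtain ⟨G, hG⟩ := happ.exists_lintegral_le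
  have hC : (expNeg (B * G))⁻¹ ≠ ∞ :=
    ENNReal.inv_ne_top.2 (expNeg_pos (ENNReal.mul_ne_top (by simp) (by simp))).ne'
  set φ : X → ℝ≥0∞ := fun y => B * ((expNeg (B * G))⁻¹ * ∫⁻ z, g y z ∂m)
  have φ_tendsto : Tendsto φ (cocompact X) (𝓝 0) := by
    simpa using ENNReal.Tendsto.const_mul (ENNReal.Tendsto.const_mul
      happ.tendsto_lintegral_cocompact (Or.inr hC)) (Or.inr (ENNReal.coe_ne_top (r := B)))
  have iSup_ne_top (N : ℕ) : ⨆ y ∈ A N, φ y ≠ ∞ := by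
    refine ne_top_of_le_ne_top (b := B * ((expNeg (B * G))⁻¹ * G)) ?_ (iSup₂_le fun y _ => ?_)
    · finiteness
    · simp only [φ]
      grw [hG y]
  refine ⟨fun N => (⨆ y ∈ A N, φ y).toReal, ?_, fun N y hy => ?_⟩
  · exact (ENNReal.tendsto_toReal ENNReal.zero_ne_top).comp
      (tendsto_biSup_zero_of_tendsto_smallSets φ_tendsto hA)
  · rw [integral_one_sub_insertionWeight hgm]
    refine ENNReal.toReal_mono (iSup_ne_top N) ?_
    exact (lintegral_gasProb_one_sub_expNeg_le m hgm hg ENNReal.coe_ne_top hG (hB N) y).trans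
      (le_iSup₂ (f := fun y _ => φ y) y hy)

variable [MetricSpace X] [SecondCountableTopology X] [BorelSpace X] {μ : ProbabilityMeasure X}

theorem tendsto_integral_abs_insertionWeight_sub_meanFieldWeight (hγ : 0 ≤ γ)
    (hgm : Measurable (Function.uncurry g)) (hg : ∀ u x, g u x = g x u) (happ : IsApproxKernel g m)
    (hb : Tendsto (fun N => ((N + 1 : ℕ) : ℝ) * b N) atTop (𝓝 γ))
    (hlln : ∀ f : X →ᵇ ℝ, Tendsto (fun N => ∫⁻ x, ENNReal.ofReal
      |∫ z, f z ∂(empirical x : Measure X) - ∫ z, f z ∂(μ : Measure X)|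
        ∂(gasProb m g (b N) (N + 1))) atTop (𝓝 0)) :
    Tendsto (fun N => ∫ y, ∫ x, |insertionWeight g (b N) y x - meanFieldWeight γ g μ y|
      ∂(gasProb m g (b N) (N + 1)) ∂m) atTop (𝓝 0) := by
  obtain ⟨G, hG⟩ := happ.exists_lintegral_le
  have hP (N : ℕ) : IsProbabilityMeasure (gasProb m g (b N) (N + 1)) :=
    isProbabilityMeasure_gasProb m hgm hg ENNReal.coe_ne_top hG (b N) (N + 1)
  set d : (N : ℕ) → X × (Fin (N + 1) → X) → ℝ := fun N q =>
    |insertionWeight g (b N) q.1 q.2 - meanFieldWeight γ g μ q.1|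
  have d_measurable (N : ℕ) : Measurable (d N) :=
    ((measurable_insertionWeight hgm (b N) (N + 1)).sub
      ((measurable_meanFieldWeight γ hgm _).comp measurable_fst)).abs
  have d_mem (N : ℕ) (q : X × (Fin (N + 1) → X)) : d N q ∈ unitInterval :=
    abs_sub_mem_unitInterval (insertionWeight_mem_unitInterval ..)
      (meanFieldWeight_mem_unitInterval ..)
  have lintegral_d_le (N : ℕ) (y : X) :
      ∫⁻ x, ENNReal.ofReal (d N (y, x)) ∂(gasProb m g (b N) (N + 1)) ≤ 1 := by
    grw [lintegral_mono fun x => ENNReal.ofReal_le_one.2 (d_mem N (y, x)).2]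
    simp
  have lintegral_tendsto : Tendsto (fun N => ∫⁻ y, ∫⁻ x, ENNReal.ofReal (d N (y, x))
      ∂(gasProb m g (b N) (N + 1)) ∂m) atTop (𝓝 (∫⁻ _, 0 ∂m)) :=
    tendsto_lintegral_of_dominated_convergence (fun _ => 1)
      (fun N => (d_measurable N).ennreal_ofReal.lintegral_prod_right')
      (fun N => ae_of_all _ (lintegral_d_le N)) (by simp)
      (ae_of_all _ (tendsto_lintegral_gasProb_abs_expNeg_sub hγ hgm hg happ hb hlln))
  rw [lintegral_zero] at lintegral_tendsto
  refine ((ENNReal.tendsto_toReal ENNReal.zero_ne_top).comp lintegral_tendsto).congr fun N => ?_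
  exact (integral_integral_eq_toReal (d_measurable N) (fun q => (d_mem N q).1)
    (integrable_of_mem_unitInterval (d_measurable N) (d_mem N))).symm

theorem tendsto_integral_gasProb_prod [(cocompact X).IsCountablyGenerated] (hγ : 0 ≤ γ)
    (hgm : Measurable (Function.uncurry g)) (hg : ∀ u x, g u x = g x u) (happ : IsApproxKernel g m)
    (hb : Tendsto (fun N => ((N + 1 : ℕ) : ℝ) * b N) atTop (𝓝 γ))
    (hlln : ∀ f : X →ᵇ ℝ, Tendsto (fun N => ∫⁻ x, ENNReal.ofReal
      |∫ z, f z ∂(empirical x : Measure X) - ∫ z, f z ∂(μ : Measure X)|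
        ∂(gasProb m g (b N) (N + 1))) atTop (𝓝 0)) {h : ℕ → X → ℝ}
    (hm : ∀ N, Measurable (h N)) (h01 : ∀ N x, h N x ∈ unitInterval)
    (hsupp : Tendsto (fun N => Function.support (h N)) atTop (cocompact X).smallSets) {T : ℝ}
    (hT : Tendsto (fun N => ((N + 1 + 1 : ℕ) : ℝ) * ∫ y, h N y ∂m) atTop (𝓝 T)) :
    Tendsto (fun N => ∫ x, ∏ j, (1 - h N (x j)) ∂(gasProb m g (b N) (N + 1 + 1))) atTop
      (𝓝 (Real.exp (-((∫ y, meanFieldWeight γ g μ y ∂m)⁻¹ * T)))) := by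
  obtain ⟨G, hG⟩ := happ.exists_lintegral_le
  have hGt : (G : ℝ≥0∞) ≠ ∞ := ENNReal.coe_ne_top
  obtain ⟨B, hB⟩ := exists_mul_le_of_tendsto hb
  have hl := measurable_meanFieldWeight γ hgm (μ : Measure X)
  have hl01 := meanFieldWeight_mem_unitInterval γ g (μ : Measure X)
  have l_pos : 0 < ∫ y, meanFieldWeight γ g μ y ∂m :=
    integral_meanFieldWeight_pos γ hgm hGt hG (ENNReal.inv_ne_top.2
      (expNeg_pos (ENNReal.mul_ne_top (ENNReal.coe_ne_top (r := B)) hGt)).ne')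
      (le_smul_of_tendsto_gasProb hgm hg hGt hG hB hlln)
  have ξ_tendsto :=
    tendsto_integral_abs_insertionWeight_sub_meanFieldWeight hγ hgm hg happ hb hlln
  obtain ⟨η, η_tendsto, hη⟩ :=
    exists_tendsto_zero_integral_one_sub_insertionWeight_le hgm hg happ hB hsupp
  have κ_tendsto : Tendsto (fun N => partitionRatio m g (b N) (N + 1)) atTop
      (𝓝 (∫ y, meanFieldWeight γ g μ y ∂m)⁻¹) :=
    tendsto_inv_of_abs_one_sub_mul_le l_pos (fun N => partitionRatio_nonneg ..) ξ_tendsto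
      fun N => abs_one_sub_partitionRatio_mul_le hgm hg hGt hG (b N) (N + 1) hl hl01
  have τ_tendsto := κ_tendsto.mul hT
  have error_tendsto := τ_tendsto.mul (η_tendsto.add (κ_tendsto.mul
    ((ξ_tendsto.const_mul 2).add (tendsto_zero_of_tendsto_add_two_mul hT))))
  simp only [mul_zero, add_zero] at error_tendsto
  have sub_tendsto := squeeze_zero (fun N => abs_nonneg _) (fun N =>
    abs_integral_gasProb_prod_sub_exp_neg_le hgm hg hGt hG (b N) (N + 1) (hm N) (h01 N) hl hl01
      rfl (hη N)) error_tendsto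
  have exp_tendsto := (Real.continuous_exp.tendsto _).comp τ_tendsto.neg
  simpa using exp_tendsto.add ((tendsto_zero_iff_abs_tendsto_zero _).2 sub_tendsto)

end PoissonLimit

/-! ### Decaying kernels and the Gibbs measure -/

section Kernel

theorem isCountablyGenerated_cocompact (X : Type*) [NormedAddCommGroup X] [ProperSpace X] :
    (cocompact X).IsCountablyGenerated := by
  rw [← Metric.cobounded_eq_cocompact, ← comap_norm_atTop]
  infer_instance

theorem le_add_rpow_mul {a : ℝ≥0∞} {δ : ℝ≥0} (hδ : 0 < δ) {p : ℝ} (hp : 1 < p) :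
    a ≤ δ + ((δ : ℝ≥0∞) ^ (p - 1))⁻¹ * a ^ p := by
  rcases le_total a δ with a_le | δ_le
  · exact a_le.trans le_self_add
  refine le_trans ?_ le_add_self
  have pow_ne_zero : (δ : ℝ≥0∞) ^ (p - 1) ≠ 0 := by
    simp [ENNReal.rpow_eq_zero_iff, hδ.ne']
  have pow_ne_top : (δ : ℝ≥0∞) ^ (p - 1) ≠ ∞ :=
    ENNReal.rpow_ne_top_of_nonneg (by linarith) (by simp)
  rw [mul_comm, ← div_eq_mul_inv,
    ENNReal.le_div_iff_mul_le (Or.inl pow_ne_zero) (Or.inl pow_ne_top)]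
  calc a * (δ : ℝ≥0∞) ^ (p - 1) ≤ a ^ (1 : ℝ) * a ^ (p - 1) := by
        rw [ENNReal.rpow_one]
        gcongr
    _ = a ^ p := by
        rw [← ENNReal.rpow_add_of_nonneg _ _ zero_le_one (by linarith)]
        congr 1
        ring

theorem le_ofReal_add_of_coe_eq {a : ℝ≥0∞} {r : ℝ} {c : ℝ≥0∞}
    (h : (a : EReal) = (r : EReal) + (c : EReal)) :
    ENNReal.ofReal r ≤ a ∧ a ≤ ENNReal.ofReal r + c := by
  constructor
  · rw [← EReal.coe_ennreal_le_coe_ennreal_iff, EReal.coe_ennreal_ofReal]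
    rcases le_total r 0 with hr | hr
    · rw [max_eq_right hr]
      exact EReal.coe_ennreal_nonneg a
    · rw [max_eq_left hr, h]
      exact le_add_of_nonneg_right (EReal.coe_ennreal_nonneg c)
  · rw [← EReal.coe_ennreal_le_coe_ennreal_iff, EReal.coe_ennreal_add, h, EReal.coe_ennreal_ofReal]
    gcongr
    exact le_max_left _ _

theorem lintegral_sub_le_of_le_add {X : Type*} [MeasurableSpace X] {P m : Measure X}
    [IsProbabilityMeasure m] {C : ℝ≥0} (hm : m ≤ C • P) {f q φ : X → ℝ≥0∞}
    (hf : ∀ x, f x ≤ q x + φ x) {p : ℝ} (hp : 1 < p) {c : ℝ≥0∞} (hφ : ∫⁻ x, φ x ^ p ∂P ≤ c)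
    {δ : ℝ≥0} (hδ : 0 < δ) :
    ∫⁻ x, (f x - q x) ∂m ≤ δ + ((δ : ℝ≥0∞) ^ (p - 1))⁻¹ * (C * c) := by
  have δ_pow_ne_zero : (δ : ℝ≥0∞) ^ (p - 1) ≠ 0 := by simp [ENNReal.rpow_eq_zero_iff, hδ.ne']
  calc ∫⁻ x, (f x - q x) ∂m
      ≤ ∫⁻ x, (δ + ((δ : ℝ≥0∞) ^ (p - 1))⁻¹ * φ x ^ p) ∂m := lintegral_mono fun x =>
        (tsub_le_iff_left.2 (hf x)).trans (le_add_rpow_mul hδ hp)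
    _ = δ + ((δ : ℝ≥0∞) ^ (p - 1))⁻¹ * ∫⁻ x, φ x ^ p ∂m := by
        rw [lintegral_add_left measurable_const,
          lintegral_const_mul' _ _ (ENNReal.inv_ne_top.2 δ_pow_ne_zero)]
        simp
    _ ≤ δ + ((δ : ℝ≥0∞) ^ (p - 1))⁻¹ * (C * c) := by
        grw [lintegral_mono' hm le_rfl, lintegral_smul_measure, hφ]
        rfl

theorem IsDecayingKernel.isApproxKernel {n : ℕ}
    {g : EuclideanSpace ℝ (Fin n) → EuclideanSpace ℝ (Fin n) → ℝ≥0∞} (hg : IsDecayingKernel g)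
    {m : Measure (EuclideanSpace ℝ (Fin n))} [IsProbabilityMeasure m] {C : ℝ≥0}
    (hm : m ≤ C • volume) : IsApproxKernel g m := by
  obtain ⟨gLow, gUp, p, c, hp, hc, decomp⟩ := hg.decomp
  intro ε hε
  obtain ⟨δ, hδ, rfl⟩ : ∃ δ : ℝ≥0, 0 < δ ∧ δ + δ = ε := ⟨ε / 2, half_pos hε, add_halves ε⟩
  set D : ℝ≥0∞ := ((δ : ℝ≥0∞) ^ (p - 1))⁻¹
  have D_ne_top : D ≠ ∞ := ENNReal.inv_ne_top.2 (by simp [ENNReal.rpow_eq_zero_iff, hδ.ne'])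
  have tail_tendsto : Tendsto (fun k => D * (C * (c k : ℝ≥0∞))) atTop (𝓝 0) := by
    simpa using ENNReal.Tendsto.const_mul (ENNReal.Tendsto.const_mul (ENNReal.tendsto_coe.2 hc)
      (Or.inr (ENNReal.coe_ne_top (r := C)))) (Or.inr D_ne_top)
  obtain ⟨k, tail_le, one_le_k⟩ := ((ENNReal.tendsto_nhds_zero.1 tail_tendsto δ
    (by exact_mod_cast hδ)).and (eventually_ge_atTop 1)).exists
  obtain ⟨hdec, hcont, hle, hup, hinf⟩ := decomp k one_le_k
  refine ⟨k, fun u x => (gLow k u x).toNNReal, continuous_real_toNNReal.comp hcont, fun u x => ?_,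
    fun u x => (le_ofReal_add_of_coe_eq (hdec u x)).1, fun u => ?_, fun x => ?_⟩
  · exact Real.toNNReal_le_iff_le_coe.2 (by exact_mod_cast hle u x)
  · refine (lintegral_sub_le_of_le_add hm (fun x => (le_ofReal_add_of_coe_eq (hdec u x)).2) hp
      (hup u) hδ).trans ?_
    grw [tail_le]
    rw [ENNReal.coe_add]
  · simpa [Function.comp_def] using (continuous_real_toNNReal.tendsto 0).comp (hinf x)

end Kernel

section Reference

theorem pi_withDensity {X : Type*} [MeasurableSpace X] (m : Measure X) [SigmaFinite m]
    {f : X → ℝ≥0∞} (hf : Measurable f) [SigmaFinite (m.withDensity f)] (N : ℕ) :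
    Measure.pi (fun _ : Fin N => m.withDensity f) =
      (Measure.pi fun _ : Fin N => m).withDensity fun x => ∏ i, f (x i) := by
  refine Measure.pi_eq fun s hs => ?_
  rw [withDensity_apply _ (MeasurableSet.univ_pi hs),
    ← lintegral_indicator (MeasurableSet.univ_pi hs)]
  have indicator_pi (x : Fin N → X) : (Set.univ.pi s).indicator (fun x => ∏ i, f (x i)) x =
      ∏ i, (s i).indicator f (x i) := by
    by_cases hx : x ∈ Set.univ.pi s
    · rw [Set.indicator_of_mem hx]
      exact Finset.prod_congr rfl fun i _ => (Set.indicator_of_mem (hx i trivial) f).symm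
    · rw [Set.indicator_of_notMem hx]
      obtain ⟨i, hi⟩ : ∃ i, x i ∉ s i := by simpa [Set.mem_univ_pi] using hx
      exact (Finset.prod_eq_zero (Finset.mem_univ i) (Set.indicator_of_notMem hi f)).symm
  simp_rw [indicator_pi]
  rw [lintegral_pi_prod m fun i => hf.indicator (hs i)]
  exact Finset.prod_congr rfl fun i _ => by
    rw [lintegral_indicator (hs i), withDensity_apply _ (hs i)]

theorem tilted_neg_eq_withDensity_expNeg {X : Type*} [MeasurableSpace X] (P : Measure X) {V : X → ℝ}
    (hV0 : ∀ x, 0 ≤ V x) :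
    P.tilted (fun x => -V x) = P.withDensity fun x =>
      ENNReal.ofReal (∫ x, Real.exp (-V x) ∂P)⁻¹ * expNeg (ENNReal.ofReal (V x)) := by
  rw [Measure.tilted]
  congr 1 with x
  rw [expNeg_ofReal (hV0 x), ← ENNReal.ofReal_mul' (Real.exp_nonneg _), div_eq_inv_mul]

theorem tilted_neg_le_smul {X : Type*} [MeasurableSpace X] (P : Measure X) {V : X → ℝ}
    (hV0 : ∀ x, 0 ≤ V x) :
    P.tilted (fun x => -V x) ≤ (∫ x, Real.exp (-V x) ∂P)⁻¹.toNNReal • P := by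
  rw [tilted_neg_eq_withDensity_expNeg P hV0]
  calc _ ≤ P.withDensity fun _ => ENNReal.ofReal (∫ x, Real.exp (-V x) ∂P)⁻¹ :=
        withDensity_mono (ae_of_all _ fun x => mul_le_of_le_one_right' (expNeg_le_one _))
    _ = _ := by rw [withDensity_const]; rfl

variable {n : ℕ} {V : EuclideanSpace ℝ (Fin n) → ℝ}
variable {g : EuclideanSpace ℝ (Fin n) → EuclideanSpace ℝ (Fin n) → ℝ≥0∞}

theorem expNeg_hamiltonian (β : ℝ) (N : ℕ) (x : Fin N → EuclideanSpace ℝ (Fin n)) :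
    expNeg (hamiltonian g V β N x) =
      (∏ j, expNeg (ENNReal.ofReal (V (x j)))) * expNeg (β.toNNReal * pairEnergy g x) := by
  rw [hamiltonian, expNeg_add, expNeg_sum, mul_comm]
  rfl

theorem gas_tilted (hV0 : ∀ x, 0 ≤ V x) (hVm : Measurable V)
    (hgm : Measurable (Function.uncurry g)) (β : ℝ) (N : ℕ) :
    gas (volume.tilted fun x => -V x) g β.toNNReal N =
      ENNReal.ofReal (∫ x, Real.exp (-V x))⁻¹ ^ N •
        volume.withDensity (fun x => expNeg (hamiltonian g V β N x)) := by
  have tilted_eq := tilted_neg_eq_withDensity_expNeg volume hV0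
  set f : EuclideanSpace ℝ (Fin n) → ℝ≥0∞ := fun x =>
    ENNReal.ofReal (∫ x, Real.exp (-V x))⁻¹ * expNeg (ENNReal.ofReal (V x)) with hf
  have f_measurable : Measurable f := by fun_prop
  have : SigmaFinite (volume.withDensity f) := by
    rw [← tilted_eq]
    infer_instance
  rw [gas, tilted_eq, pi_withDensity volume f_measurable,
    ← withDensity_mul _ (by fun_prop) (by fun_prop), ← volume_pi, ← withDensity_smul' _ _ (by simp)]
  congr 1 with x
  simp only [hf, Pi.mul_apply, Pi.smul_apply, smul_eq_mul, Finset.prod_mul_distrib,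
    Finset.prod_const, Finset.card_univ, Fintype.card_fin, expNeg_hamiltonian, mul_assoc]

theorem gibbs_eq_gasProb (hV0 : ∀ x, 0 ≤ V x) (hVm : Measurable V)
    (hV : Integrable fun x => Real.exp (-V x))
    (hgm : Measurable (Function.uncurry g)) (β : ℝ) (N : ℕ) :
    gibbs g V β N = gasProb (volume.tilted fun x => -V x) g β.toNNReal N := by
  set c := ENNReal.ofReal (∫ x, Real.exp (-V x))⁻¹ ^ N with hc
  have c_ne_zero : c ≠ 0 :=
    pow_ne_zero _ (ENNReal.ofReal_pos.2 (inv_pos.2 (integral_exp_pos hV))).ne'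
  have c_ne_top : c ≠ ∞ := ENNReal.pow_ne_top ENNReal.ofReal_ne_top
  rw [gasProb, gas_tilted hV0 hVm hgm, ← hc, gibbs, partitionFunction, Measure.smul_apply,
    withDensity_apply _ MeasurableSet.univ, setLIntegral_univ, smul_smul, smul_eq_mul,
    ENNReal.mul_inv (Or.inl c_ne_zero) (Or.inl c_ne_top), mul_right_comm,
    ENNReal.inv_mul_cancel c_ne_zero c_ne_top, one_mul]

theorem normConst_eq (hV0 : ∀ x, 0 ≤ V x) (hV : Integrable fun x => Real.exp (-V x))
    (hVm : Measurable V) (hgm : Measurable (Function.uncurry g)) (γ : ℝ)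
    (μ : Measure (EuclideanSpace ℝ (Fin n))) [SFinite μ] :
    normConst γ g V μ = (∫ x, Real.exp (-V x)) *
      ∫ y, meanFieldWeight γ g μ y ∂(volume.tilted fun x => -V x) := by
  have exp_pos := integral_exp_pos hV
  have weight_measurable : Measurable fun y => expNeg (ENNReal.ofReal γ * ∫⁻ z, g y z ∂μ) :=
    measurable_expNeg.comp (hgm.lintegral_prod_right'.const_mul _)
  simp_rw [meanFieldWeight]
  rw [integral_toReal weight_measurable.aemeasurable
      (ae_of_all _ fun y => (expNeg_ne_top _).lt_top),
    ← ENNReal.toReal_ofReal exp_pos.le, ← ENNReal.toReal_mul, normConst,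
    tilted_neg_eq_withDensity_expNeg volume hV0,
    lintegral_withDensity_eq_lintegral_mul _ (by fun_prop) weight_measurable]
  simp_rw [Pi.mul_apply, mul_assoc]
  rw [lintegral_const_mul' _ _ ENNReal.ofReal_ne_top, ← mul_assoc,
    ← ENNReal.ofReal_mul exp_pos.le, mul_inv_cancel₀ exp_pos.ne', ENNReal.ofReal_one, one_mul]
  simp_rw [expNeg_add, mul_comm, potential]

theorem IsUniqueMinimizer.lt {γ : ℝ} {μ : ProbabilityMeasure (EuclideanSpace ℝ (Fin n))}
    (h : IsUniqueMinimizer γ g V μ) (P : ProbabilityMeasure (EuclideanSpace ℝ (Fin n)))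
    (hP : P ≠ μ) : freeEnergy γ g V μ < freeEnergy γ g V P := by
  by_contra h_le
  exact hP (h.2 P fun ν => (not_lt.1 h_le).trans (h.1 ν))

theorem energy_ne_top_and_klDiv_ne_top_of_refFreeEnergy_le {X : Type*} [MeasurableSpace X] {γ : ℝ}
    (hγ : 0 ≤ γ) {m : Measure X} [IsProbabilityMeasure m] {g : X → X → ℝ≥0∞} {G : ℝ≥0∞}
    (hGt : G ≠ ∞) (hG : ∀ y, ∫⁻ x, g y x ∂m ≤ G) {μ : Measure X} [IsProbabilityMeasure μ]
    (hμ : refFreeEnergy γ g m μ ≤ refFreeEnergy γ g m m) :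
    ∫⁻ y, ∫⁻ z, g y z ∂μ ∂μ ≠ ∞ ∧ klDiv μ m ≠ ∞ := by
  have energy_le : ∫⁻ y, ∫⁻ z, g y z ∂m ∂m ≤ G := by
    grw [lintegral_mono hG]
    simp
  have free_le : refFreeEnergy γ g m μ ≤ ENNReal.ofReal (γ / 2) * G := by
    grw [hμ, refFreeEnergy, klDiv_self, add_zero, energy_le]
  have summands_ne_top := ENNReal.add_ne_top.1
    (ne_top_of_le_ne_top (ENNReal.mul_ne_top ENNReal.ofReal_ne_top hGt) free_le)
  refine ⟨?_, summands_ne_top.2⟩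
  rcases hγ.eq_or_lt with rfl | γ_pos
  · have klDiv_zero : klDiv μ m = 0 := by simpa [refFreeEnergy] using free_le
    rw [klDiv_eq_zero_iff.1 klDiv_zero]
    exact ne_top_of_le_ne_top hGt energy_le
  · intro energy_top
    refine summands_ne_top.1 ?_
    rw [energy_top, ENNReal.mul_top]
    simpa using γ_pos

theorem tendsto_succ_mul_toNNReal {γ : ℝ} {β : ℕ → ℝ} (hβ0 : ∀ N, 0 ≤ β N)
    (hβ : Tendsto (fun N : ℕ => (N : ℝ) * β N) atTop (𝓝 γ)) :
    Tendsto (fun N => ((N + 1 : ℕ) : ℝ) * (β (N + 2)).toNNReal) atTop (𝓝 γ) := by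
  have ratio_tendsto : Tendsto (fun N : ℕ => ((N + 1 : ℕ) : ℝ) / ((N + 1 : ℕ) + 1)) atTop (𝓝 1) :=
    (tendsto_add_atTop_iff_nat 1).2 (tendsto_natCast_div_add_atTop (1 : ℝ))
  have product_tendsto := ratio_tendsto.mul ((tendsto_add_atTop_iff_nat 2).2 hβ)
  rw [one_mul] at product_tendsto
  refine product_tendsto.congr fun N => ?_
  rw [Real.coe_toNNReal _ (hβ0 _)]
  push_cast
  field_simp
  ring

theorem integral_tilted_neg {X : Type*} [MeasurableSpace X] (P : Measure X) (V h : X → ℝ) :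
    ∫ y, h y ∂(P.tilted fun x => -V x) =
      (∫ x, Real.exp (-V x) ∂P)⁻¹ * ∫ y, Real.exp (-V y) * h y ∂P := by
  rw [integral_tilted, ← integral_const_mul]
  congr 1 with y
  rw [smul_eq_mul]
  ring

theorem tendsto_integral_gibbs_prod {γ : ℝ} (hg : ∀ u x, g u x = g x u)
    (hlsc : LowerSemicontinuous (Function.uncurry g))
    (happ : IsApproxKernel g (volume.tilted fun x => -V x))
    (hV0 : ∀ x, 0 ≤ V x) (hVm : Measurable V) (hV : Integrable fun x => Real.exp (-V x))
    {μ : ProbabilityMeasure (EuclideanSpace ℝ (Fin n))} (hμ : IsUniqueMinimizer γ g V μ)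
    {β : ℕ → ℝ} (hβ0 : ∀ N, 0 ≤ β N)
    (hβ : Tendsto (fun N : ℕ => (N : ℝ) * β N) atTop (𝓝 γ))
    {h : ℕ → EuclideanSpace ℝ (Fin n) → ℝ}
    (hm : ∀ N, Measurable (h N)) (h01 : ∀ N x, h N x ∈ unitInterval)
    (hsupp : Tendsto (fun N => Function.support (h N)) atTop
      (cocompact (EuclideanSpace ℝ (Fin n))).smallSets)
    {T : ℝ} (hT : Tendsto (fun N : ℕ => (N : ℝ) * ∫ y, Real.exp (-V y) * h N y) atTop (𝓝 T)) :
    Tendsto (fun N => ∫ x, ∏ j, (1 - h N (x j)) ∂(gibbs g V (β N) N)) atTop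
      (𝓝 (Real.exp (-((normConst γ g V μ)⁻¹ * T)))) := by
  have hγ : 0 ≤ γ := ge_of_tendsto' hβ fun N => mul_nonneg N.cast_nonneg (hβ0 N)
  have : IsProbabilityMeasure (volume.tilted fun x => -V x) := isProbabilityMeasure_tilted hV
  have := isCountablyGenerated_cocompact (EuclideanSpace ℝ (Fin n))
  have hgm : Measurable (Function.uncurry g) := hlsc.measurable
  obtain ⟨G, hG⟩ := happ.exists_lintegral_le
  have hGt : (G : ℝ≥0∞) ≠ ∞ := ENNReal.coe_ne_top
  have hb := tendsto_succ_mul_toNNReal hβ0 hβ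
  obtain ⟨energy_ne_top, klDiv_ne_top⟩ := energy_ne_top_and_klDiv_ne_top_of_refFreeEnergy_le hγ hGt
    hG (μ := (μ : Measure (EuclideanSpace ℝ (Fin n)))) (hμ.1 ⟨_, ‹_›⟩)
  have hlln := tendsto_lintegral_gasProb_abs_sub hγ hg hlsc hGt hG energy_ne_top klDiv_ne_top
    hμ.lt hb
  have hT' : Tendsto (fun N : ℕ => ((N + 1 + 1 : ℕ) : ℝ) *
      ∫ y, h (N + 2) y ∂(volume.tilted fun x => -V x)) atTop
      (𝓝 ((∫ x, Real.exp (-V x))⁻¹ * T)) :=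
    (((tendsto_add_atTop_iff_nat 2).2 hT).const_mul _).congr fun N => by
      rw [integral_tilted_neg, mul_left_comm]
  have laplace_tendsto := tendsto_integral_gasProb_prod hγ hgm hg happ hb hlln
    (fun N => hm (N + 2)) (fun N => h01 (N + 2)) (hsupp.comp (tendsto_add_atTop_nat 2)) hT'
  rw [← tendsto_add_atTop_iff_nat 2, normConst_eq hV0 hV hVm hgm, mul_inv_rev, mul_assoc]
  exact laplace_tendsto.congr fun N => by rw [gibbs_eq_gasProb hV0 hVm hV hgm]

end Reference

/-! ### Escape to infinity -/

section Escape

variable {ι : Type*} {l : Filter ι} {X : Type*} [NormedAddCommGroup X] {E : ι → X} {α : ι → ℝ}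

theorem eventually_div_le_half_norm (hα : ∀ᶠ N in l, 0 < α N)
    (hαE : Tendsto (fun N => α N * ‖E N‖) l atTop) (R : ℝ) :
    ∀ᶠ N in l, R / α N ≤ ‖E N‖ / 2 := by
  filter_upwards [hα, hαE.eventually_ge_atTop (2 * R)] with N α_pos le_mul
  rw [div_le_div_iff₀ α_pos two_pos]
  linarith

theorem tendsto_closedBall_smallSets (hE : Tendsto (fun N => ‖E N‖) l atTop)
    (hα : ∀ᶠ N in l, 0 < α N) (hαE : Tendsto (fun N => α N * ‖E N‖) l atTop) (R : ℝ) :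
    Tendsto (fun N => Metric.closedBall (E N) (R / α N)) l (Bornology.cobounded X).smallSets := by
  refine tendsto_smallSets_iff.2 fun S hS => ?_
  rw [← comap_norm_atTop, mem_comap] at hS
  obtain ⟨t, ht, htS⟩ := hS
  obtain ⟨c, hc⟩ := mem_atTop_sets.1 ht
  filter_upwards [eventually_div_le_half_norm hα hαE R, hE.eventually_ge_atTop (2 * c)]
    with N radius_le le_norm y hy
  refine htS (hc _ ?_)
  have dist_le := mem_closedBall_iff_norm'.1 hy
  have norm_sub_le_dist := norm_sub_norm_le (E N) y
  linarith

end Escape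

/-! ### Taylor expansion on the zooming scale -/

section Taylor

variable {X : Type*} [NormedAddCommGroup X] [InnerProductSpace ℝ X] [CompleteSpace X]

theorem abs_sub_sub_inner_le {V : X → ℝ} {e v : X} {r M : ℝ} (hM : 0 ≤ M)
    (hV : ∀ p ∈ Metric.closedBall e r, ContDiffAt ℝ 2 V p) (hgrad : HasGradientAt V v e)
    (hH : ∀ p ∈ Metric.closedBall e r, ‖iteratedFDeriv ℝ 2 V p‖ ≤ M) {y : X} (hy : ‖y‖ ≤ r) :
    |V (e + y) - V e - ⟪v, y⟫| ≤ M * r * r := by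
  have r_nonneg : 0 ≤ r := (norm_nonneg y).trans hy
  have ball_convex : Convex ℝ (Metric.closedBall e r) := convex_closedBall e r
  have center_mem : e ∈ Metric.closedBall e r := Metric.mem_closedBall_self r_nonneg
  have fderiv_center : fderiv ℝ V e = InnerProductSpace.toDual ℝ X v :=
    (hasGradientAt_iff_hasFDerivAt.1 hgrad).fderiv
  have fderiv_sub_le : ∀ p ∈ Metric.closedBall e r,
      ‖fderiv ℝ V p - InnerProductSpace.toDual ℝ X v‖ ≤ M * r := fun p hp => by
    rw [← fderiv_center]
    refine (ball_convex.norm_image_sub_le_of_norm_fderiv_le (𝕜 := ℝ) (C := M) (fun q hq => ?_)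
      (fun q hq => ?_) center_mem hp).trans ?_
    · exact ((hV q hq).fderiv_right (m := 1) (by norm_num)).differentiableAt (by simp)
    · rw [← norm_iteratedFDeriv_one, norm_iteratedFDeriv_fderiv]
      exact hH q hq
    · exact mul_le_mul_of_nonneg_left (mem_closedBall_iff_norm.1 hp) hM
  have increment_le := ball_convex.norm_image_sub_le_of_norm_fderiv_le' (𝕜 := ℝ)
    (fun p hp => (hV p hp).differentiableAt (by simp)) fderiv_sub_le center_mem
    (show e + y ∈ Metric.closedBall e r by simpa [mem_closedBall_iff_norm] using hy)
  rw [add_sub_cancel_left, InnerProductSpace.toDual_apply_apply, Real.norm_eq_abs] at increment_le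
  exact increment_le.trans (mul_le_mul_of_nonneg_left hy (by positivity))

end Taylor

section Zoom

variable {n : ℕ} {V : EuclideanSpace ℝ (Fin n) → ℝ}
  {ψ : Diffeomorph 𝓘(ℝ, EuclideanSpace ℝ (Fin n)) 𝓘(ℝ, EuclideanSpace ℝ (Fin n))
      (EuclideanSpace ℝ (Fin n)) (EuclideanSpace ℝ (Fin n)) 1}
  {e : EuclideanSpace ℝ (Fin n)} {a : ℝ}

theorem mem_closedBall_of_zoomInv_mem (ha : 0 < a) {K : Set (EuclideanSpace ℝ (Fin n))} {R : ℝ}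
    (hR : ∀ x ∈ K, ‖ψ x‖ ≤ R) {y : EuclideanSpace ℝ (Fin n)} (hy : zoomInv e a ψ.symm y ∈ K) :
    y ∈ Metric.closedBall e (R / a) := by
  have scaled_norm_le := hR _ hy
  rw [zoomInv, ψ.apply_symm_apply, norm_smul, Real.norm_eq_abs, abs_of_pos ha] at scaled_norm_le
  rw [mem_closedBall_iff_norm, le_div_iff₀ ha]
  linarith

theorem continuous_zoomInv (e : EuclideanSpace ℝ (Fin n)) (a : ℝ) :
    Continuous (zoomInv e a ψ.symm) :=
  ψ.symm.continuous.comp (by fun_prop : Continuous fun y => a • (y - e))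

theorem norm_le_sq_mul_toReal_iSup_zoom {Y : Type*} [SeminormedAddCommGroup Y]
    (H : EuclideanSpace ℝ (Fin n) → Y) (ha : 0 < a) {R : ℝ}
    (hfin : ENNReal.ofReal ((a ^ 2)⁻¹) *
      ⨆ x ∈ ψ.symm '' Metric.closedBall 0 R, ‖H (zoom e a ψ x)‖ₑ ≠ ∞)
    {p : EuclideanSpace ℝ (Fin n)} (hp : p ∈ Metric.closedBall e (R / a)) :
    ‖H p‖ ≤ a ^ 2 * (ENNReal.ofReal ((a ^ 2)⁻¹) *
      ⨆ x ∈ ψ.symm '' Metric.closedBall 0 R, ‖H (zoom e a ψ x)‖ₑ).toReal := by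
  have scaled_mem : a • (p - e) ∈ Metric.closedBall (0 : EuclideanSpace ℝ (Fin n)) R := by
    have norm_le := mem_closedBall_iff_norm.1 hp
    rw [le_div_iff₀ ha] at norm_le
    rw [mem_closedBall_zero_iff, norm_smul, Real.norm_eq_abs, abs_of_pos ha]
    linarith
  have zoom_eq : zoom e a ψ (ψ.symm (a • (p - e))) = p := zoom_zoomInv e ha ψ.toEquiv p
  have enorm_le : ‖H p‖ₑ ≤ ⨆ x ∈ ψ.symm '' Metric.closedBall 0 R, ‖H (zoom e a ψ x)‖ₑ :=
    le_iSup₂_of_le (f := fun x (_ : x ∈ ψ.symm '' Metric.closedBall 0 R) =>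
      ‖H (zoom e a ψ x)‖ₑ) _ ⟨_, scaled_mem, rfl⟩ (by rw [zoom_eq])
  have scaled_le := ENNReal.toReal_mono hfin (mul_le_mul_right enorm_le _)
  rwa [ENNReal.toReal_mul, ENNReal.toReal_ofReal (by positivity), toReal_enorm,
    inv_mul_le_iff₀ (by positivity)] at scaled_le

theorem abs_sub_sub_inner_zoom_le {v : EuclideanSpace ℝ (Fin n)} (ha : 0 < a) {R : ℝ}
    (hV : ∀ p ∈ Metric.closedBall e (R / a), ContDiffAt ℝ 2 V p)
    (hgrad : HasGradientAt V (a • v) e)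
    (hfin : ENNReal.ofReal ((a ^ 2)⁻¹) * ⨆ x ∈ ψ.symm '' Metric.closedBall 0 R,
      ‖iteratedFDeriv ℝ 2 V (zoom e a ψ x)‖ₑ ≠ ∞)
    {z : EuclideanSpace ℝ (Fin n)} (hz : ‖z‖ ≤ R) :
    |V (e + a⁻¹ • z) - V e - ⟪v, z⟫| ≤ (ENNReal.ofReal ((a ^ 2)⁻¹) *
      ⨆ x ∈ ψ.symm '' Metric.closedBall 0 R,
        ‖iteratedFDeriv ℝ 2 V (zoom e a ψ x)‖ₑ).toReal * R * R := by
  have scaled_norm_le : ‖a⁻¹ • z‖ ≤ R / a := by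
    rw [norm_smul, norm_inv, Real.norm_eq_abs, abs_of_pos ha, div_eq_inv_mul]
    gcongr
  have taylor := abs_sub_sub_inner_le (by positivity) hV hgrad
    (fun p hp => norm_le_sq_mul_toReal_iSup_zoom (iteratedFDeriv ℝ 2 V) ha hfin hp) scaled_norm_le
  rw [inner_smul_left, inner_smul_right, conj_trivial, ← mul_assoc, mul_inv_cancel₀ ha.ne',
    one_mul] at taylor
  refine taylor.trans_eq ?_
  field_simp

variable {E : ℕ → EuclideanSpace ℝ (Fin n)} {α : ℕ → ℝ} {υ : ℕ → EuclideanSpace ℝ (Fin n)}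
  {υlim : EuclideanSpace ℝ (Fin n)}

theorem exists_tendsto_zero_abs_sub_sub_inner_zoom_le
    (hV_C2 : ∃ K : Set (EuclideanSpace ℝ (Fin n)), IsCompact K ∧ ContDiffOn ℝ 2 V Kᶜ)
    (hE : Tendsto (fun N => ‖E N‖) atTop atTop) (hα : ∀ᶠ N in atTop, 0 < α N)
    (hgrad : ∀ᶠ N in atTop, HasGradientAt V (α N • υ N) (E N))
    (hαE : Tendsto (fun N => α N * ‖E N‖) atTop atTop)
    (hH : ∀ 𝒦 : Set (EuclideanSpace ℝ (Fin n)), IsCompact 𝒦 →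
      Tendsto (fun N => ENNReal.ofReal ((α N ^ 2)⁻¹) *
        ⨆ x ∈ 𝒦, ‖iteratedFDeriv ℝ 2 V (zoom (E N) (α N) ψ x)‖ₑ) atTop (𝓝 0)) (R : ℝ) :
    ∃ δ : ℕ → ℝ, Tendsto δ atTop (𝓝 0) ∧ ∀ᶠ N in atTop, ∀ z, ‖z‖ ≤ R →
      |V (E N + (α N)⁻¹ • z) - V (E N) - ⟪υ N, z⟫| ≤ δ N := by
  obtain ⟨K, K_compact, V_C2⟩ := hV_C2
  have hessian_tendsto := hH _ ((isCompact_closedBall 0 R).image ψ.symm.continuous)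
  have bound_tendsto :=
    (((ENNReal.tendsto_toReal ENNReal.zero_ne_top).comp hessian_tendsto).mul_const R).mul_const R
  rw [ENNReal.toReal_zero, zero_mul, zero_mul] at bound_tendsto
  have compl_mem : Kᶜ ∈ Bornology.cobounded (EuclideanSpace ℝ (Fin n)) := by
    rw [Metric.cobounded_eq_cocompact]
    exact K_compact.compl_mem_cocompact
  refine ⟨_, bound_tendsto, ?_⟩
  filter_upwards [hα, hgrad,
    tendsto_smallSets_iff.1 (tendsto_closedBall_smallSets hE hα hαE R) _ compl_mem,
    hessian_tendsto.eventually (gt_mem_nhds zero_lt_one)]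
    with N α_pos gradient ball_subset hessian_lt_one z hz
  exact abs_sub_sub_inner_zoom_le α_pos (fun p hp => V_C2.contDiffAt
    (K_compact.isClosed.isOpen_compl.mem_nhds (ball_subset hp))) gradient
    (hessian_lt_one.trans ENNReal.one_lt_top).ne hz

theorem tendsto_support_comp_zoomInv (hE : Tendsto (fun N => ‖E N‖) atTop atTop)
    (hα : ∀ᶠ N in atTop, 0 < α N) (hαE : Tendsto (fun N => α N * ‖E N‖) atTop atTop)
    {F : EuclideanSpace ℝ (Fin n) → ℝ} (hF : HasCompactSupport F) :
    Tendsto (fun N => Function.support fun y => F (zoomInv (E N) (α N) ψ.symm y)) atTop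
      (cocompact (EuclideanSpace ℝ (Fin n))).smallSets := by
  obtain ⟨R, hR⟩ := (hF.isCompact.image ψ.continuous).isBounded.exists_norm_le
  rw [← Metric.cobounded_eq_cocompact]
  refine tendsto_smallSets_iff.2 fun S hS => ?_
  filter_upwards [hα, tendsto_smallSets_iff.1 (tendsto_closedBall_smallSets hE hα hαE R) S hS]
    with N α_pos ball_subset y hy
  exact ball_subset (mem_closedBall_of_zoomInv_mem α_pos (fun x hx => hR _ ⟨x, hx, rfl⟩)
    (subset_tsupport F hy))

end Zoom

/-! ### Change of variables on the zooming scale -/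

section ChangeOfVariables

theorem integral_comp_diffeomorph {X : Type*} [NormedAddCommGroup X] [NormedSpace ℝ X]
    [FiniteDimensional ℝ X] [MeasurableSpace X] [BorelSpace X] (P : Measure X)
    [P.IsAddHaarMeasure] {ψ : Diffeomorph 𝓘(ℝ, X) 𝓘(ℝ, X) X X 1}
    (hψ : ∀ x, |(fderiv ℝ ψ x).det| = 1) (f : X → ℝ) : ∫ x, f (ψ x) ∂P = ∫ z, f z ∂P := by
  have image_eq := integral_image_eq_integral_abs_det_fderiv_smul P MeasurableSet.univ
    (fun x _ => ((ψ.contDiff.differentiable (by simp)) x).hasFDerivAt.hasFDerivWithinAt)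
    ψ.injective.injOn f
  have range_eq : Set.range ψ = Set.univ := ψ.surjective.range_eq
  rw [Set.image_univ, range_eq] at image_eq
  simpa [hψ] using image_eq.symm

theorem integral_eq_inv_pow_mul_integral_add_smul {X : Type*} [NormedAddCommGroup X]
    [NormedSpace ℝ X] [FiniteDimensional ℝ X] [MeasurableSpace X] [BorelSpace X] (P : Measure X)
    [P.IsAddHaarMeasure] (f : X → ℝ) (e : X) {a : ℝ} (ha : 0 < a) :
    ∫ y, f y ∂P = (a ^ Module.finrank ℝ X)⁻¹ * ∫ z, f (e + a⁻¹ • z) ∂P := by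
  have pow_pos : 0 < a ^ Module.finrank ℝ X := pow_pos ha _
  rw [Measure.integral_comp_smul P (fun z => f (e + z)), integral_add_left_eq_self f e,
    smul_eq_mul, inv_pow, inv_inv, abs_of_pos pow_pos, inv_mul_cancel_left₀ pow_pos.ne']

theorem integral_exp_neg_mul_zoomInv {n : ℕ} (V F : EuclideanSpace ℝ (Fin n) → ℝ)
    (ψinv : EuclideanSpace ℝ (Fin n) → EuclideanSpace ℝ (Fin n)) (e : EuclideanSpace ℝ (Fin n))
    {a : ℝ} (ha : 0 < a) :
    ∫ y, Real.exp (-V y) * F (zoomInv e a ψinv y) = Real.exp (-V e) / a ^ n *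
      ∫ z, Real.exp (-(V (e + a⁻¹ • z) - V e)) * F (ψinv z) := by
  have exp_mul_exp : ∀ z, Real.exp (-V (e + a⁻¹ • z)) * F (zoomInv e a ψinv (e + a⁻¹ • z)) =
      Real.exp (-V e) * (Real.exp (-(V (e + a⁻¹ • z) - V e)) * F (ψinv z)) := fun z => by
    rw [← mul_assoc, ← Real.exp_add, zoomInv, add_sub_cancel_left, smul_smul,
      mul_inv_cancel₀ ha.ne', one_smul]
    congr 2
    ring
  rw [integral_eq_inv_pow_mul_integral_add_smul volume _ e ha, finrank_euclideanSpace_fin]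
  simp_rw [exp_mul_exp]
  rw [integral_const_mul, div_eq_inv_mul, mul_assoc]

theorem tendsto_integral_exp_neg_sub_mul {X : Type*} [NormedAddCommGroup X]
    [InnerProductSpace ℝ X] [ProperSpace X] [MeasurableSpace X] [BorelSpace X] (P : Measure X)
    [IsFiniteMeasureOnCompacts P] {W : ℕ → X → ℝ} (hW : ∀ N, Measurable (W N)) {υ : ℕ → X}
    {υlim : X} (hυ : Tendsto υ atTop (𝓝 υlim)) {R : ℝ} {δ : ℕ → ℝ} (hδ : Tendsto δ atTop (𝓝 0))
    (hWδ : ∀ᶠ N in atTop, ∀ z, ‖z‖ ≤ R → |W N z - ⟪υ N, z⟫| ≤ δ N) {Φ : X → ℝ}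
    (hΦm : Measurable Φ) (hΦ : ∀ z, Φ z ∈ unitInterval) (hΦR : ∀ z, R < ‖z‖ → Φ z = 0) :
    Tendsto (fun N => ∫ z, Real.exp (-W N z) * Φ z ∂P) atTop
      (𝓝 (∫ z, Real.exp (-⟪υlim, z⟫) * Φ z ∂P)) := by
  refine tendsto_integral_filter_of_dominated_convergence
    ((Metric.closedBall 0 R).indicator fun _ => Real.exp ((‖υlim‖ + 1) * R + 1))
    (Eventually.of_forall fun N => by fun_prop) ?_ ?_ (ae_of_all _ fun z => ?_)
  · filter_upwards [hWδ, hυ.norm.eventually_le_const (lt_add_one _),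
      hδ.eventually (gt_mem_nhds zero_lt_one)] with N abs_le norm_le δ_lt_one
    refine ae_of_all _ fun z => ?_
    by_cases hz : ‖z‖ ≤ R
    · rw [Set.indicator_of_mem (mem_closedBall_zero_iff.2 hz), norm_mul, Real.norm_eq_abs,
        Real.norm_eq_abs, Real.abs_exp, abs_of_nonneg (hΦ z).1]
      refine (mul_le_of_le_one_right (Real.exp_nonneg _) (hΦ z).2).trans (Real.exp_le_exp.2 ?_)
      have neg_δ_le := (_root_.abs_le.1 (abs_le z hz)).1
      have neg_norm_le := (_root_.abs_le.1 (abs_real_inner_le_norm (υ N) z)).1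
      have norm_mul_le : ‖υ N‖ * ‖z‖ ≤ (‖υlim‖ + 1) * R := by gcongr
      linarith
    · rw [hΦR z (not_le.1 hz), mul_zero, norm_zero]
      exact Set.indicator_nonneg (fun _ _ => Real.exp_nonneg _) z
  · exact (integrable_indicator_iff Metric.isClosed_closedBall.measurableSet).2
      (integrableOn_const (isCompact_closedBall _ _).measure_lt_top.ne)
  · by_cases hz : ‖z‖ ≤ R
    · refine Tendsto.mul_const _ ((Real.continuous_exp.tendsto _).comp (Tendsto.neg ?_))
      have remainder_tendsto : Tendsto (fun N => W N z - ⟪υ N, z⟫) atTop (𝓝 0) :=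
        squeeze_zero_norm' (hWδ.mono fun N h => h z hz) hδ
      simpa using remainder_tendsto.add (hυ.inner (tendsto_const_nhds (x := z)))
    · simp [hΦR z (not_le.1 hz)]

theorem tendsto_integral_zoom {n : ℕ} {V : EuclideanSpace ℝ (Fin n) → ℝ}
    {E : ℕ → EuclideanSpace ℝ (Fin n)} {α : ℕ → ℝ} {υ : ℕ → EuclideanSpace ℝ (Fin n)}
    {υlim : EuclideanSpace ℝ (Fin n)}
    {ψ : Diffeomorph 𝓘(ℝ, EuclideanSpace ℝ (Fin n)) 𝓘(ℝ, EuclideanSpace ℝ (Fin n))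
      (EuclideanSpace ℝ (Fin n)) (EuclideanSpace ℝ (Fin n)) 1}
    (hVm : Measurable V)
    (hV_C2 : ∃ K : Set (EuclideanSpace ℝ (Fin n)), IsCompact K ∧ ContDiffOn ℝ 2 V Kᶜ)
    (hE : Tendsto (fun N => ‖E N‖) atTop atTop) (hα : ∀ᶠ N in atTop, 0 < α N)
    (hgrad : ∀ᶠ N in atTop, HasGradientAt V (α N • υ N) (E N))
    {L : ℝ} (hL : Tendsto (fun N : ℕ => (N : ℝ) * Real.exp (-V (E N)) / α N ^ n) atTop (𝓝 L))
    (hυ : Tendsto υ atTop (𝓝 υlim)) (hαE : Tendsto (fun N => α N * ‖E N‖) atTop atTop)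
    (hψ : ∀ x, |(fderiv ℝ ψ x).det| = 1)
    (hH : ∀ 𝒦 : Set (EuclideanSpace ℝ (Fin n)), IsCompact 𝒦 →
      Tendsto (fun N => ENNReal.ofReal ((α N ^ 2)⁻¹) *
        ⨆ x ∈ 𝒦, ‖iteratedFDeriv ℝ 2 V (zoom (E N) (α N) ψ x)‖ₑ) atTop (𝓝 0))
    {F : EuclideanSpace ℝ (Fin n) → ℝ} (hFm : Measurable F) (hF : ∀ x, F x ∈ unitInterval)
    (hFc : HasCompactSupport F) :
    Tendsto (fun N : ℕ => (N : ℝ) * ∫ y, Real.exp (-V y) * F (zoomInv (E N) (α N) ψ.symm y)) atTop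
      (𝓝 (L * ∫ x, Real.exp (-⟪υlim, ψ x⟫) * F x)) := by
  obtain ⟨R, hR⟩ := (hFc.isCompact.image ψ.continuous).isBounded.exists_norm_le
  have eq_zero_of_lt_norm : ∀ z, R < ‖z‖ → F (ψ.symm z) = 0 := fun z hz => by
    by_contra ne_zero
    exact hz.not_ge (hR z ⟨ψ.symm z, subset_tsupport F ne_zero, ψ.apply_symm_apply z⟩)
  obtain ⟨δ, hδ, hVδ⟩ := exists_tendsto_zero_abs_sub_sub_inner_zoom_le hV_C2 hE hα hgrad hαE hH R
  have integral_tendsto := tendsto_integral_exp_neg_sub_mul volume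
    (fun N => (by fun_prop : Measurable fun z => V (E N + (α N)⁻¹ • z) - V (E N))) hυ hδ hVδ
    (hFm.comp ψ.symm.continuous.measurable) (fun z => hF _) eq_zero_of_lt_norm
  rw [← integral_comp_diffeomorph volume hψ] at integral_tendsto
  simp only [Function.comp_apply, ψ.symm_apply_apply] at integral_tendsto
  refine (hL.mul integral_tendsto).congr' ?_
  filter_upwards [hα] with N α_pos
  rw [integral_exp_neg_mul_zoomInv V F ψ.symm (E N) α_pos, mul_div_assoc, mul_assoc]

end ChangeOfVariables

/-! ### Construction of Poisson processes -/

section PointProcess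

variable {X : Type*} [MeasurableSpace X]

/-- The point measure `∑_k ∑_{i < N_k} δ_{x_{k,i}}` of a sequence `ω k = (N_k, x_k)`, indexed by a
set of natural numbers through the pairing `Nat.unpair j = (k, i)`. -/
noncomputable def pointSum (ω : ℕ → ℕ × (ℕ → X)) : Measure X :=
  Measure.sum fun i : {j : ℕ | j.unpair.2 < (ω j.unpair.1).1} =>
    Measure.dirac ((ω (i : ℕ).unpair.1).2 (i : ℕ).unpair.2)

theorem lintegral_pointSum (ω : ℕ → ℕ × (ℕ → X)) {f : X → ℝ≥0∞} (hf : Measurable f) :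
    ∫⁻ x, f x ∂(pointSum ω) = ∑' k, ∑ i ∈ Finset.range (ω k).1, f ((ω k).2 i) := by
  rw [pointSum, lintegral_sum_measure]
  simp_rw [lintegral_dirac' _ hf]
  rw [tsum_subtype {j : ℕ | j.unpair.2 < (ω j.unpair.1).1}
    (fun j => f ((ω j.unpair.1).2 j.unpair.2)), ← Nat.pairEquiv.tsum_eq, ENNReal.tsum_prod']
  refine tsum_congr fun k => ?_
  rw [tsum_eq_sum (s := Finset.range (ω k).1)]
  · refine Finset.sum_congr rfl fun i hi => ?_
    simp [Set.indicator, Finset.mem_range.1 hi]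
  · intro i hi
    rw [Finset.mem_range, not_lt] at hi
    simp [Set.indicator, hi.not_gt]

theorem measurable_sum_range {f : X → ℝ≥0∞} (hf : Measurable f) :
    Measurable fun q : ℕ × (ℕ → X) => ∑ i ∈ Finset.range q.1, f (q.2 i) :=
  measurable_from_prod_countable_right fun N =>
    (show Measurable fun a : ℕ → X => ∑ i ∈ Finset.range N, f (a i) from
      Finset.measurable_sum _ fun i _ =>
        (show Measurable fun a : ℕ → X => f (a i) from hf.comp (measurable_pi_apply i)))

theorem measurable_pointSum : Measurable (pointSum : (ℕ → ℕ × (ℕ → X)) → Measure X) := by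
  refine Measure.measurable_of_measurable_coe _ fun s hs => ?_
  have indicator_measurable : Measurable (s.indicator (1 : X → ℝ≥0∞)) :=
    measurable_one.indicator hs
  have pointSum_apply : ∀ ω : ℕ → ℕ × (ℕ → X), pointSum ω s =
      ∑' k, ∑ i ∈ Finset.range (ω k).1, s.indicator 1 ((ω k).2 i) := fun ω => by
    rw [← lintegral_pointSum ω indicator_measurable, lintegral_indicator_one hs]
  simp_rw [pointSum_apply]
  exact Measurable.tsum fun k =>
    (measurable_sum_range indicator_measurable).comp (measurable_pi_apply k)

theorem lintegral_infinitePi_prod {ι : Type*} {Y : ι → Type*} [∀ i, MeasurableSpace (Y i)]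
    (P : ∀ i, Measure (Y i)) [∀ i, IsProbabilityMeasure (P i)] {F : ∀ i, Y i → ℝ≥0∞}
    (hF : ∀ i, Measurable (F i)) (s : Finset ι) :
    ∫⁻ ω, ∏ i ∈ s, F i (ω i) ∂(Measure.infinitePi P) = ∏ i ∈ s, ∫⁻ y, F i y ∂(P i) := by
  refine (lintegral_prod_eq_prod_lintegral_of_indepFun s
    (fun i (ω : ∀ i, Y i) => F i (ω i)) (iIndepFun_infinitePi hF)
    fun i => (hF i).comp (measurable_pi_apply i)).trans ?_
  refine Finset.prod_congr rfl fun i _ => ?_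
  rw [← Measure.infinitePi_map_eval P i, lintegral_map (hF i) (measurable_pi_apply i)]

theorem hasSum_exp_neg_mul_pow_div_factorial_mul_pow (r t : ℝ) :
    HasSum (fun N : ℕ => Real.exp (-r) * r ^ N / N.factorial * t ^ N) (Real.exp (r * t - r)) := by
  have exp_series := (NormedSpace.expSeries_div_hasSum_exp (r * t)).mul_left (Real.exp (-r))
  rw [← Real.exp_eq_exp_ℝ, ← Real.exp_add, neg_add_eq_sub] at exp_series
  refine exp_series.congr_fun fun N => ?_
  rw [mul_pow]
  ring

theorem lintegral_pow_poissonMeasure (r : ℝ≥0) {p : ℝ≥0∞} (hp : p ≤ 1) :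
    ∫⁻ N, p ^ N ∂(poissonMeasure r) = expNeg (r * (1 - p)) := by
  lift p to ℝ≥0 using ne_top_of_le_ne_top ENNReal.one_ne_top hp
  have generating_series := hasSum_exp_neg_mul_pow_div_factorial_mul_pow r p
  have ofReal_term : ∀ N : ℕ,
      ENNReal.ofReal (Real.exp (-r) * r ^ N / N.factorial) * (p : ℝ≥0∞) ^ N =
        ENNReal.ofReal (Real.exp (-r) * r ^ N / N.factorial * (p : ℝ) ^ N) := fun N => by
    rw [ENNReal.ofReal_mul (by positivity), ENNReal.ofReal_pow p.coe_nonneg,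
      ENNReal.ofReal_coe_nnreal]
  rw [poissonMeasure, lintegral_sum_measure]
  simp_rw [lintegral_smul_measure, lintegral_dirac, smul_eq_mul, ofReal_term]
  rw [← ENNReal.ofReal_tsum_of_nonneg (fun N => by positivity) generating_series.summable,
    generating_series.tsum_eq, ← ENNReal.coe_one, ← ENNReal.coe_sub, ← ENNReal.coe_mul, expNeg_coe,
    NNReal.coe_mul, NNReal.coe_sub (by exact_mod_cast hp), NNReal.coe_one]
  congr 2
  ring

theorem lintegral_expNeg_poisson (r : ℝ≥0) (ρ : Measure X) [IsProbabilityMeasure ρ]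
    {f : X → ℝ≥0∞} (hf : Measurable f) :
    ∫⁻ q, expNeg (∑ i ∈ Finset.range q.1, f (q.2 i))
      ∂((poissonMeasure r).prod (Measure.infinitePi fun _ : ℕ => ρ)) =
      expNeg (∫⁻ x, (1 - expNeg (f x)) ∂(r • ρ)) := by
  have expNeg_measurable : Measurable fun x => expNeg (f x) := measurable_expNeg.comp hf
  have lintegral_le_one : ∫⁻ x, expNeg (f x) ∂ρ ≤ 1 := by
    grw [lintegral_mono fun x => expNeg_le_one (f x)]
    simp
  have sum_measurable : Measurable fun q : ℕ × (ℕ → X) =>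
      expNeg (∑ i ∈ Finset.range q.1, f (q.2 i)) := measurable_expNeg.comp (measurable_sum_range hf)
  rw [lintegral_prod _ sum_measurable.aemeasurable]
  simp_rw [expNeg_sum, lintegral_infinitePi_prod (fun _ : ℕ => ρ) (fun _ => expNeg_measurable),
    Finset.prod_const, Finset.card_range]
  rw [lintegral_pow_poissonMeasure r lintegral_le_one, lintegral_smul_measure,
    lintegral_sub expNeg_measurable (ne_top_of_le_ne_top ENNReal.one_ne_top lintegral_le_one)
      (ae_of_all _ fun x => expNeg_le_one _)]
  simp [ENNReal.smul_def]

theorem tendsto_expNeg_tsum (a : ℕ → ℝ≥0∞) :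
    Tendsto (fun K => ∏ k ∈ Finset.range K, expNeg (a k)) atTop (𝓝 (expNeg (∑' k, a k))) := by
  simp_rw [← expNeg_sum]
  exact (continuous_expNeg.tendsto _).comp (ENNReal.tendsto_nat_tsum a)

/-- The law of a sequence of independent pairs `(N_k, x_k)`, where `N_k` is Poisson with mean `r k`
and `x_k` is an independent i.i.d. sequence of law `ρ k`. Under it `pointSum` is a superposition of
independent Poisson processes with intensities `r k • ρ k`. -/
noncomputable abbrev poissonFamily (r : ℕ → ℝ≥0) (ρ : ℕ → Measure X) :
    Measure (ℕ → ℕ × (ℕ → X)) :=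
  Measure.infinitePi fun k => (poissonMeasure (r k)).prod (Measure.infinitePi fun _ : ℕ => ρ k)

theorem lintegral_expNeg_pointSum (r : ℕ → ℝ≥0) (ρ : ℕ → Measure X)
    [∀ k, IsProbabilityMeasure (ρ k)] {f : X → ℝ≥0∞} (hf : Measurable f) :
    ∫⁻ ω, expNeg (∫⁻ x, f x ∂(pointSum ω)) ∂(poissonFamily r ρ) =
      expNeg (∫⁻ x, (1 - expNeg (f x)) ∂(Measure.sum fun k => r k • ρ k)) := by
  have sum_measurable : Measurable fun q : ℕ × (ℕ → X) =>
      expNeg (∑ i ∈ Finset.range q.1, f (q.2 i)) := measurable_expNeg.comp (measurable_sum_range hf)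
  simp_rw [lintegral_pointSum _ hf, lintegral_sum_measure]
  refine tendsto_nhds_unique ?_ (tendsto_expNeg_tsum _)
  simp_rw [← lintegral_expNeg_poisson _ _ hf]
  simp_rw [← lintegral_infinitePi_prod (fun k => (poissonMeasure (r k)).prod
    (Measure.infinitePi fun _ : ℕ => ρ k)) (fun _ => sum_measurable)]
  refine tendsto_lintegral_of_dominated_convergence (fun _ => 1)
    (fun K => Finset.measurable_prod _ fun k _ => sum_measurable.comp (measurable_pi_apply k))
    (fun K => ae_of_all _ fun ω => Finset.prod_le_one' fun k _ => expNeg_le_one _) (by simp)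
    (ae_of_all _ fun ω => tendsto_expNeg_tsum _)

theorem ae_lt_top_of_tendsto_lintegral_expNeg {Ω : Type*} [MeasurableSpace Ω] {P : Measure Ω}
    [IsProbabilityMeasure P] {Y : Ω → ℝ≥0∞} (hY : Measurable Y)
    (h : Tendsto (fun t : ℝ≥0 => ∫⁻ ω, expNeg (t * Y ω) ∂P) (𝓝[>] 0) (𝓝 1)) :
    ∀ᵐ ω ∂P, Y ω < ∞ := by
  have finite_measurable : MeasurableSet {ω | Y ω < ∞} := hY measurableSet_Iio
  refine (prob_compl_eq_zero_iff finite_measurable).2 (le_antisymm prob_le_one ?_)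
  refine le_of_tendsto h (eventually_mem_nhdsWithin.mono fun t ht => ?_)
  rw [← lintegral_indicator_one finite_measurable]
  refine lintegral_mono fun ω => ?_
  by_cases hω : Y ω < ∞
  · rw [Set.indicator_of_mem (by exact hω)]
    exact expNeg_le_one _
  · rw [not_lt_top_iff.1 hω, ENNReal.mul_top (by exact_mod_cast (ne_of_gt ht)), expNeg_top]
    exact zero_le

theorem lintegral_expNeg_mul_pointSum_apply (r : ℕ → ℝ≥0) (ρ : ℕ → Measure X)
    [∀ k, IsProbabilityMeasure (ρ k)] {K : Set X} (hK : MeasurableSet K) (t : ℝ≥0∞) :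
    ∫⁻ ω, expNeg (t * pointSum ω K) ∂(poissonFamily r ρ) =
      expNeg ((1 - expNeg t) * Measure.sum (fun k => r k • ρ k) K) := by
  have one_sub_indicator : ∀ x, 1 - expNeg (K.indicator (fun _ => t) x) =
      K.indicator (fun _ => 1 - expNeg t) x := fun x => by by_cases hx : x ∈ K <;> simp [hx]
  simpa only [one_sub_indicator, lintegral_indicator_const hK] using
    lintegral_expNeg_pointSum r ρ (measurable_const.indicator hK (f := fun _ : X => t))

theorem ae_pointSum_lt_top (r : ℕ → ℝ≥0) (ρ : ℕ → Measure X) [∀ k, IsProbabilityMeasure (ρ k)]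
    {K : Set X} (hK : MeasurableSet K) (hfin : Measure.sum (fun k => r k • ρ k) K ≠ ∞) :
    ∀ᵐ ω ∂(poissonFamily r ρ), pointSum ω K < ∞ := by
  refine ae_lt_top_of_tendsto_lintegral_expNeg
    ((Measure.measurable_coe hK).comp measurable_pointSum) ?_
  simp_rw [lintegral_expNeg_mul_pointSum_apply r ρ hK]
  have one_sub_tendsto : Tendsto (fun t : ℝ≥0 => 1 - expNeg t) (𝓝[>] 0) (𝓝 0) := by
    have expNeg_tendsto := (continuous_expNeg.comp ENNReal.continuous_coe).tendsto 0
    simpa using (ENNReal.Tendsto.sub tendsto_const_nhds expNeg_tendsto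
      (Or.inl ENNReal.one_ne_top)).mono_left nhdsWithin_le_nhds
  simpa [Function.comp_def] using (continuous_expNeg.tendsto _).comp
    (ENNReal.Tendsto.mul_const one_sub_tendsto (Or.inr hfin))

theorem exists_eq_smul_probabilityMeasure [Nonempty X] (ν : Measure X) [IsFiniteMeasure ν] :
    ∃ (r : ℝ≥0) (ρ : Measure X), IsProbabilityMeasure ρ ∧ ν = r • ρ := by
  rcases eq_or_ne ν 0 with rfl | hν
  · exact ⟨0, Measure.dirac (Classical.arbitrary X), inferInstance, by simp⟩
  have mass_ne_zero : ν Set.univ ≠ 0 := by simpa using hν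
  refine ⟨(ν Set.univ).toNNReal, (ν Set.univ)⁻¹ • ν, ⟨?_⟩, ?_⟩
  · rw [Measure.smul_apply, smul_eq_mul, ENNReal.inv_mul_cancel mass_ne_zero (measure_ne_top _ _)]
  · rw [ENNReal.smul_def, ENNReal.coe_toNNReal (measure_ne_top _ _), smul_smul,
      ENNReal.mul_inv_cancel mass_ne_zero (measure_ne_top _ _), one_smul]

theorem exists_isPoissonProcess {n : ℕ} (θ : Measure (EuclideanSpace ℝ (Fin n))) [SFinite θ]
    (hθ : ∀ K : Set (EuclideanSpace ℝ (Fin n)), IsCompact K → θ K < ∞) :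
    ∃ (Ω : Type) (_ : MeasurableSpace Ω) (P : Measure Ω)
      (Ξ : Ω → Measure (EuclideanSpace ℝ (Fin n))), IsPoissonProcess P Ξ θ := by
  choose r ρ hρ smul_eq using fun k => exists_eq_smul_probabilityMeasure (sfiniteSeq θ k)
  have sum_eq : Measure.sum (fun k => r k • ρ k) = θ := by
    simp_rw [← smul_eq]
    exact sum_sfiniteSeq θ
  refine ⟨_, inferInstance, poissonFamily r ρ, pointSum, ⟨inferInstance, measurable_pointSum,
    ae_of_all _ fun ω => ⟨_, fun j => (ω j.unpair.1).2 j.unpair.2, rfl⟩, ?_⟩, fun f hf => ?_⟩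
  · have ball_lt_top (j : ℕ) :
        ∀ᵐ ω ∂(poissonFamily r ρ), pointSum ω (Metric.closedBall 0 j) < ∞ :=
      ae_pointSum_lt_top r ρ Metric.isClosed_closedBall.measurableSet
        (by rw [sum_eq]; exact (hθ _ (isCompact_closedBall _ _)).ne)
    filter_upwards [ae_all_iff.2 ball_lt_top] with ω hω K hK
    obtain ⟨R, hR⟩ := hK.isBounded.subset_closedBall 0
    obtain ⟨j, hj⟩ := exists_nat_ge R
    exact (measure_mono (hR.trans (Metric.closedBall_subset_closedBall hj))).trans_lt (hω j)
  · rw [laplace, lintegral_expNeg_pointSum r ρ hf.coe_nnreal_ennreal, sum_eq]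

end PointProcess

/-! ### The Laplace functional of the zoomed process -/

section Laplace

/-- The function `1 - e^{-f}`: the Laplace functional at `f` of a finite configuration is the
expectation of the product of `1 - oneSubExp f` over its points. -/
noncomputable def oneSubExp {X : Type*} (f : X → ℝ≥0) (x : X) : ℝ := 1 - Real.exp (-(f x : ℝ))

theorem oneSubExp_mem_unitInterval {X : Type*} (f : X → ℝ≥0) (x : X) :
    oneSubExp f x ∈ unitInterval :=
  ⟨sub_nonneg.2 (Real.exp_le_one_iff.2 (neg_nonpos.2 (f x).coe_nonneg)),
    sub_le_self _ (Real.exp_nonneg _)⟩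

theorem ofReal_oneSubExp {X : Type*} (f : X → ℝ≥0) (x : X) :
    ENNReal.ofReal (oneSubExp f x) = 1 - expNeg (f x : ℝ≥0∞) := by
  rw [oneSubExp, expNeg_coe, ENNReal.ofReal_sub _ (Real.exp_nonneg _), ENNReal.ofReal_one]

variable {X : Type*} [TopologicalSpace X]

theorem continuous_oneSubExp {f : X → ℝ≥0} (hf : Continuous f) : Continuous (oneSubExp f) :=
  continuous_const.sub (Real.continuous_exp.comp (NNReal.continuous_coe.comp hf).neg)

theorem hasCompactSupport_oneSubExp {f : X → ℝ≥0} (hf : HasCompactSupport f) :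
    HasCompactSupport (oneSubExp f) :=
  hf.comp_left (g := fun t : ℝ≥0 => 1 - Real.exp (-(t : ℝ))) (by simp)

variable [MeasurableSpace X] [OpensMeasurableSpace X] {P : Measure X}
  [IsFiniteMeasureOnCompacts P] {w : X → ℝ}

theorem expNeg_lintegral_one_sub_expNeg_withDensity (hw : Continuous w) {f : X → ℝ≥0}
    (hf : Continuous f) (hfc : HasCompactSupport f) :
    expNeg (∫⁻ x, (1 - expNeg (f x : ℝ≥0∞))
      ∂(P.withDensity fun x => ENNReal.ofReal (Real.exp (w x)))) =
      ENNReal.ofReal (Real.exp (-∫ x, Real.exp (w x) * oneSubExp f x ∂P)) := by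
  have integrand_nonneg : ∀ x, 0 ≤ Real.exp (w x) * oneSubExp f x := fun x =>
    mul_nonneg (Real.exp_nonneg _) (oneSubExp_mem_unitInterval f x).1
  have integrand_integrable : Integrable (fun x => Real.exp (w x) * oneSubExp f x) P :=
    ((Real.continuous_exp.comp hw).mul (continuous_oneSubExp hf)).integrable_of_hasCompactSupport
      (hasCompactSupport_oneSubExp hfc).mul_left
  rw [← expNeg_ofReal (integral_nonneg integrand_nonneg),
    ofReal_integral_eq_lintegral_ofReal integrand_integrable (ae_of_all _ integrand_nonneg),
    lintegral_withDensity_eq_lintegral_mul _ (by fun_prop) (by fun_prop)]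
  simp_rw [ENNReal.ofReal_mul (Real.exp_nonneg _), ofReal_oneSubExp]
  rfl

theorem withDensity_exp_lt_top_of_isCompact [T2Space X] (hw : Continuous w) {K : Set X}
    (hK : IsCompact K) : P.withDensity (fun x => ENNReal.ofReal (Real.exp (w x))) K < ∞ := by
  rw [withDensity_apply _ hK.measurableSet]
  exact ((Real.continuous_exp.comp hw).continuousOn.integrableOn_compact hK).lintegral_lt_top

theorem laplace_zoomedProcess {n N : ℕ} (P : Measure (Fin N → EuclideanSpace ℝ (Fin n)))
    [IsProbabilityMeasure P] (e : EuclideanSpace ℝ (Fin n)) (a : ℝ)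
    {ψinv : EuclideanSpace ℝ (Fin n) → EuclideanSpace ℝ (Fin n)}
    (hψ : Measurable (zoomInv e a ψinv)) {f : EuclideanSpace ℝ (Fin n) → ℝ≥0}
    (hf : Measurable f) :
    laplace P (zoomedProcess e a ψinv N) f =
      ENNReal.ofReal (∫ x, ∏ j, (1 - oneSubExp f (zoomInv e a ψinv (x j))) ∂P) := by
  have prod_mem (x : Fin N → EuclideanSpace ℝ (Fin n)) :
      ∏ j, Real.exp (-(f (zoomInv e a ψinv (x j)) : ℝ)) ∈ unitInterval :=
    ⟨Finset.prod_nonneg fun j _ => Real.exp_nonneg _,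
      Finset.prod_le_one (fun j _ => Real.exp_nonneg _) fun j _ =>
        Real.exp_le_one_iff.2 (neg_nonpos.2 (f _).coe_nonneg)⟩
  simp only [oneSubExp, sub_sub_cancel]
  rw [ofReal_integral_eq_lintegral_ofReal (integrable_of_mem_unitInterval (by fun_prop) prod_mem)
    (ae_of_all _ fun x => (prod_mem x).1), laplace]
  refine lintegral_congr fun x => ?_
  rw [zoomedProcess, lintegral_finsetSum_measure, expNeg_sum,
    ENNReal.ofReal_prod_of_nonneg fun j _ => Real.exp_nonneg _]
  refine Finset.prod_congr rfl fun j _ => ?_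
  rw [lintegral_dirac' _ hf.coe_nnreal_ennreal, expNeg_coe]

end Laplace

section Gibbs

variable {n : ℕ} {g : EuclideanSpace ℝ (Fin n) → EuclideanSpace ℝ (Fin n) → ℝ≥0∞}
  {V : EuclideanSpace ℝ (Fin n) → ℝ}

theorem isProbabilityMeasure_gibbs (hg : ∀ u x, g u x = g x u)
    (hgm : Measurable (Function.uncurry g))
    (happ : IsApproxKernel g (volume.tilted fun x => -V x)) (hV0 : ∀ x, 0 ≤ V x)
    (hVm : Measurable V) (hV : Integrable fun x => Real.exp (-V x)) (β : ℝ) (N : ℕ) :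
    IsProbabilityMeasure (gibbs g V β N) := by
  have : IsProbabilityMeasure (volume.tilted fun x => -V x) := isProbabilityMeasure_tilted hV
  obtain ⟨G, hG⟩ := happ.exists_lintegral_le
  rw [gibbs_eq_gasProb hV0 hVm hV hgm]
  exact isProbabilityMeasure_gasProb _ hgm hg ENNReal.coe_ne_top hG _ _

theorem tendsto_mul_exp_neg_div_pow {L : ℝ} {E : ℕ → EuclideanSpace ℝ (Fin n)} {α : ℕ → ℝ}
    (h : Tendsto (fun N : ℕ => (N : ℝ) * Real.exp (-V (E N)) / (L * α N ^ n)) atTop (𝓝 1)) :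
    L ≠ 0 ∧ Tendsto (fun N : ℕ => (N : ℝ) * Real.exp (-V (E N)) / α N ^ n) atTop (𝓝 L) := by
  have L_ne_zero : L ≠ 0 := by
    rintro rfl
    simp only [zero_mul, div_zero] at h
    exact zero_ne_one (tendsto_nhds_unique tendsto_const_nhds h)
  refine ⟨L_ne_zero, ?_⟩
  have scaled_tendsto := h.const_mul L
  rw [mul_one] at scaled_tendsto
  exact scaled_tendsto.congr fun N => by rw [← div_div, mul_div_assoc', mul_div_cancel₀ _ L_ne_zero]

end Gibbs

end MeanFieldGas

theorem mainTheorem7_general {n : ℕ} (γ : ℝ)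
    (g : EuclideanSpace ℝ (Fin n) → EuclideanSpace ℝ (Fin n) → ℝ≥0∞)
    (hg_symm : ∀ u x, g u x = g x u) (hg_lsc : LowerSemicontinuous (Function.uncurry g))
    (V : EuclideanSpace ℝ (Fin n) → ℝ) (hV_nonneg : ∀ x, 0 ≤ V x) (hV_meas : Measurable V)
    (hg_approx : IsApproxKernel g (volume.tilted fun x => -V x))
    (hV_C2 : ∃ K : Set (EuclideanSpace ℝ (Fin n)), IsCompact K ∧ ContDiffOn ℝ 2 V Kᶜ)
    (hV_int : Integrable (fun x => Real.exp (-V x)))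
    (μ : ProbabilityMeasure (EuclideanSpace ℝ (Fin n))) (hμ : IsUniqueMinimizer γ g V μ)
    (β : ℕ → ℝ) (hβ_nonneg : ∀ N, 0 ≤ β N)
    (hβ : Tendsto (fun N : ℕ => (N : ℝ) * β N) atTop (𝓝 γ))
    (E : ℕ → EuclideanSpace ℝ (Fin n)) (hE : Tendsto (fun N => ‖E N‖) atTop atTop)
    (α : ℕ → ℝ) (υ : ℕ → EuclideanSpace ℝ (Fin n)) (υlim : EuclideanSpace ℝ (Fin n))
    (hα : ∀ᶠ N in atTop, 0 < α N)
    (hgrad : ∀ᶠ N in atTop, HasGradientAt V (α N • υ N) (E N))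
    (hc1 : Tendsto (fun N : ℕ => (N : ℝ) * Real.exp (-V (E N)) /
      (normConst γ g V (μ : Measure (EuclideanSpace ℝ (Fin n))) * α N ^ n)) atTop (𝓝 1))
    (hυlim : Tendsto υ atTop (𝓝 υlim))
    (hαE : Tendsto (fun N => α N * ‖E N‖) atTop atTop)
    (ψ : Diffeomorph 𝓘(ℝ, EuclideanSpace ℝ (Fin n)) 𝓘(ℝ, EuclideanSpace ℝ (Fin n))
      (EuclideanSpace ℝ (Fin n)) (EuclideanSpace ℝ (Fin n)) 1)
    (hψ : ∀ x, |(fderiv ℝ ψ x).det| = 1)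
    (hc2 : ∀ 𝒦 : Set (EuclideanSpace ℝ (Fin n)), IsCompact 𝒦 →
      Tendsto (fun N => ENNReal.ofReal ((α N ^ 2)⁻¹) *
        ⨆ x ∈ 𝒦, ‖iteratedFDeriv ℝ 2 V (zoom (E N) (α N) ψ x)‖ₑ) atTop (𝓝 0)) :
    ∃ (Ω : Type) (_ : MeasurableSpace Ω) (P : Measure Ω)
      (Ξ : Ω → Measure (EuclideanSpace ℝ (Fin n))),
      IsPoissonProcess P Ξ
        (volume.withDensity (fun x => ENNReal.ofReal (Real.exp (-⟪υlim, ψ x⟫)))) ∧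
      ConvergesInDistribution (fun N => gibbs g V (β N) N)
        (fun N => zoomedProcess (E N) (α N) ψ.symm N) P Ξ := by
  have hw : Continuous fun x => -⟪υlim, ψ x⟫ := (continuous_const.inner ψ.continuous).neg
  obtain ⟨Ω, mΩ, P, Ξ, hΞ⟩ := exists_isPoissonProcess
    (volume.withDensity fun x => ENNReal.ofReal (Real.exp (-⟪υlim, ψ x⟫)))
    fun K hK => withDensity_exp_lt_top_of_isCompact hw hK
  refine ⟨Ω, mΩ, P, Ξ, hΞ, fun f hf hfc => ?_⟩
  obtain ⟨L_ne_zero, L_tendsto⟩ := tendsto_mul_exp_neg_div_pow hc1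
  have intensity_tendsto := tendsto_integral_zoom hV_meas hV_C2 hE hα hgrad L_tendsto hυlim hαE hψ
    hc2 (continuous_oneSubExp hf).measurable (oneSubExp_mem_unitInterval f)
    (hasCompactSupport_oneSubExp hfc)
  have expectation_tendsto := tendsto_integral_gibbs_prod hg_symm hg_lsc hg_approx hV_nonneg
    hV_meas hV_int hμ hβ_nonneg hβ
    (h := fun N y => oneSubExp f (zoomInv (E N) (α N) ψ.symm y))
    (fun N => ((continuous_oneSubExp hf).comp (continuous_zoomInv (E N) (α N))).measurable)
    (fun N y => oneSubExp_mem_unitInterval f _)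
    (tendsto_support_comp_zoomInv hE hα hαE (hasCompactSupport_oneSubExp hfc)) intensity_tendsto
  rw [inv_mul_cancel_left₀ L_ne_zero] at expectation_tendsto
  rw [hΞ.laplace_eq f hf.measurable, expNeg_lintegral_one_sub_expNeg_withDensity hw hf hfc]
  refine (ENNReal.tendsto_ofReal expectation_tendsto).congr fun N => ?_
  have := isProbabilityMeasure_gibbs hg_symm hg_lsc.measurable hg_approx hV_nonneg hV_meas hV_int
    (β N) N
  exact (laplace_zoomedProcess _ _ _ (continuous_zoomInv _ _).measurable hf.measurable).symm

theorem mainTheorem7 {n : ℕ} (γ : ℝ) (hγ : 0 ≤ γ)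
    -- the interaction kernel and the potential
    (g : EuclideanSpace ℝ (Fin n) → EuclideanSpace ℝ (Fin n) → ℝ≥0∞)
    (hg : IsDecayingKernel g)
    (V : EuclideanSpace ℝ (Fin n) → ℝ) (hV_nonneg : ∀ x, 0 ≤ V x) (hV_cont : Continuous V)
    (hV_C2 : ∃ K : Set (EuclideanSpace ℝ (Fin n)), IsCompact K ∧ ContDiffOn ℝ 2 V Kᶜ)
    (hV_int : Integrable (fun x => Real.exp (-V x)))
    -- the equilibrium measure
    (μ : ProbabilityMeasure (EuclideanSpace ℝ (Fin n))) (hμ : IsUniqueMinimizer γ g V μ)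
    -- the inverse temperatures
    (β : ℕ → ℝ) (hβ_pos : ∀ N, 0 < β N)
    (hβ : Tendsto (fun N : ℕ => (N : ℝ) * β N) atTop (𝓝 γ))
    -- the points around which one zooms
    (E : ℕ → EuclideanSpace ℝ (Fin n)) (hE : Tendsto (fun N => ‖E N‖) atTop atTop)
    (α : ℕ → ℝ) (υ : ℕ → EuclideanSpace ℝ (Fin n)) (υlim : EuclideanSpace ℝ (Fin n))
    (hα : ∀ᶠ N in atTop, 0 < α N) (hυ : ∀ᶠ N in atTop, ‖υ N‖ = 1)
    (hgrad : ∀ᶠ N in atTop, HasGradientAt V (α N • υ N) (E N))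
    (hc1 : Tendsto (fun N : ℕ => (N : ℝ) * Real.exp (-V (E N)) /
      (normConst γ g V (μ : Measure (EuclideanSpace ℝ (Fin n))) * α N ^ n)) atTop (𝓝 1))
    (hυlim : Tendsto υ atTop (𝓝 υlim))
    (hαE : Tendsto (fun N => α N * ‖E N‖) atTop atTop)
    -- the volume-preserving diffeomorphism and the Hessian condition
    (ψ : Diffeomorph 𝓘(ℝ, EuclideanSpace ℝ (Fin n)) 𝓘(ℝ, EuclideanSpace ℝ (Fin n))
      (EuclideanSpace ℝ (Fin n)) (EuclideanSpace ℝ (Fin n)) 1)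
    (hψ : ∀ x, |(fderiv ℝ ψ x).det| = 1)
    (hc2 : ∀ 𝒦 : Set (EuclideanSpace ℝ (Fin n)), IsCompact 𝒦 →
      Tendsto (fun N => ENNReal.ofReal ((α N ^ 2)⁻¹) *
        ⨆ x ∈ 𝒦, ‖iteratedFDeriv ℝ 2 V (zoom (E N) (α N) ψ x)‖ₑ) atTop (𝓝 0)) :
    ∃ (Ω : Type) (_ : MeasurableSpace Ω) (P : Measure Ω)
      (Ξ : Ω → Measure (EuclideanSpace ℝ (Fin n))),
      IsPoissonProcess P Ξ
        (volume.withDensity (fun x => ENNReal.ofReal (Real.exp (-⟪υlim, ψ x⟫)))) ∧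
      ConvergesInDistribution (fun N => gibbs g V (β N) N)
        (fun N => zoomedProcess (E N) (α N) ψ.symm N) P Ξ := by
  have := isProbabilityMeasure_tilted hV_int
  exact mainTheorem7_general γ g hg.symm hg.lsc V hV_nonneg hV_cont.measurable
    (hg.isApproxKernel (tilted_neg_le_smul volume hV_nonneg)) hV_C2 hV_int μ hμ β
    (fun N => (hβ_pos N).le) hβ E hE α υ υlim hα hgrad hc1 hυlim hαE ψ hψ hc2
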